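/- **Setting.** Let $N\in\mathbb N$, $v_0>0$, and let $a_1,\dots,a_N\in\mathbb R^3\setminus\{0\}$ satisfy (B) $|a_1|<|a_2|<\dots<|a_N|$ and $a_i\cdot a_j\neq|a_i||a_j|$ for $i\neq j$. Put $\hat a_j=a_j/|a_j|$. For $\varepsilon>0$ consider in $L^2(\mathbb R^{3(N+1)})$, with variables $(R,r_1,\dots,r_N)$ and norm $\|\cdot\|$, the operators $$H_0^\varepsilon=-\tfrac{\varepsilon^4}{2}\Delta_R+\sum_{j=1}^N\varepsilon^{-1}\Big[-\tfrac{\varepsilon^4}{2}\Delta_{r_j}+\tfrac12|r_j-a_j|^2\Big],\qquad \mathcal U_0^\varepsilon(t)=e^{-i\frac{t}{\varepsilon^2}H_0^\varepsilon},$$ and, for $V:\mathbb R^3\to\mathbb R$, the multiplication operator $V_j^\varepsilon=V(\varepsilon^{-1}(R-r_j))$ and $$I_j^\varepsilon(t)=-i\int_0^t ds\;\mathcal U_0^\varepsilon(-s)\,V_j^\varepsilon\,\mathcal U_0^\varepsilon(s).$$ Let $f(x)=\pi^{-3/4}e^{-|x|^2/2}$, let $du$ be the surface measure on the unit sphere $S^2$,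 and for $A\subseteq S^2$ measurable put $$\psi_A^\varepsilon(R)=\frac{\mathcal N_\varepsilon}{\varepsilon^{5/2}}\,f(\varepsilon^{-1}R)\int_A du\;e^{\frac{i}{\varepsilon^2}v_0u\cdot R},$$ where $\mathcal N_\varepsilon>0$ is such that $\|\psi_{S^2}^\varepsilon\|_{L^2(\mathbb R^3)}=1$. Let $\varphi^\varepsilon_{0,k}(r)=\varepsilon^{-3/2}\pi^{-3/4}e^{-|r-a_k|^2/(2\varepsilon^2)}$ be the ground state of the $k$-th oscillator, let $\theta_0=\frac12\min\big(\{\pi\}\cup\{\theta_{jk}: j\ne k\}\big)$ with $\theta_{jk}\in[0,\pi]$ the angle between $a_j$ and $a_k$, and let $$\mathcal C_j=\{u\in S^2:\ 1-(u\cdot\hat a_j)^2<\sin^2\theta_0,\ u\cdot\hat a_j>0\}$$ be the spherical cap of half-angle $\theta_0$ around $\hat a_j$. Put $$\Psi_0^\varepsilon=\psi^\varepsilon_{S^2}(R)\prod_{k=1}^N\varphi_{0,k}^\varepsilon(r_k),\qquad \Psi_{0,j}^\varepsilon=\psi^\varepsilon_{\mathcal C_j}(R)\prod_{k=1}^N\varphi_{0,k}^\varepsilon(r_k).$$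 The Fourier transform is $\widetilde V(\xi)=(2\pi)^{-3/2}\int e^{-i\xi\cdot x}V(x)\,dx$, extended to tempered distributions, and, with $\langle\xi\rangle=(1+|\xi|^2)^{1/2}$ and weak derivatives $D^\alpha$, $W^{k,1}_k(\mathbb R^3)$ is the space of functions for which $$\|g\|_{W^{k,1}_k}=\sum_{|\alpha|\le k}\int\langle\xi\rangle^k|D^\alpha g(\xi)|\,d\xi<\infty .$$ **Proposition 3.2.** Let $k\ge1$ be an integer and assume (B). Then for every $t>0$ there is a constant $C_k^2(t)>0$, independent of $\varepsilon$, $j$ and $V$, such that for all $V$ with $\widetilde V\in W^{k,1}_k(\mathbb R^3)$, all $j=1,\dots,N$ and all $\varepsilon>0$ the integral over $[0,t]$ defining $I_j^\varepsilon(t)\big(\Psi_0^\varepsilon-\Psi_{0,j}^\varepsilon\big)$ converges absolutely in $L^2(\mathbb R^{3(N+1)})$ and $$\big\|I_j^\varepsilon(t)\big(\Psi_0^\varepsilon-\Psi_{0,j}^\varepsilon\big)\big\|\le C_k^2(t)\,\|\widetilde V\|_{W^{k,1}_k}\,\varepsilon^{k-1}.$$ -/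

import Mathlib

open MeasureTheory

namespace SphericalWave

noncomputable section

/-! ### Euclidean space, square-integrable functions -/

/-- Physical space `ℝ³` with the Euclidean norm and Lebesgue measure. -/
abbrev E3 : Type := EuclideanSpace ℝ (Fin 3)

/-- Configurations `(R, r₁, …, r_N)`: one test particle and `N` oscillators in `ℝ³`. -/
abbrev Config (N : ℕ) : Type := E3 × (Fin N → E3)

/-- The complex Hilbert space `L²(X)`. -/
abbrev L2 (X : Type) [MeasureSpace X] : Type := Lp ℂ 2 (volume : Measure X)

open scoped Classical in
/-- The element of `L²(X)` represented by a square-integrable function `f`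
(and `0` if `f` is not square-integrable). -/
def toL2 {X : Type} [MeasureSpace X] (f : X → ℂ) : L2 X :=
  if h : MemLp f 2 (volume : Measure X) then h.toLp f else 0

/-- The operator of multiplication by the function `m`. -/
def mulL2 {X : Type} [MeasureSpace X] (m : X → ℂ) (Ψ : L2 X) : L2 X :=
  toL2 (fun x => m x * Ψ x)

/-! ### The Fourier transform (unitary convention, angular frequency) -/

/-- `φ̃(ξ) = (2π)^{-3/2} ∫ e^{-i ξ·x} φ(x) dx`. -/
def fourierT (φ : E3 → ℂ) (ξ : E3) : ℂ :=
  (((2 * Real.pi) ^ (-(3 / 2) : ℝ) : ℝ) : ℂ) *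
    ∫ x : E3, Complex.exp (-Complex.I * ((inner ℝ ξ x : ℝ) : ℂ)) * φ x

/-- `g` is the Fourier transform of `V` in the sense of tempered distributions:
`∫ V φ̃ = ∫ g φ` for every Schwartz function `φ`. -/
def IsFourierTransform (V : E3 → ℝ) (g : E3 → ℂ) : Prop :=
  ∀ φ : SchwartzMap E3 ℂ,
    Integrable (fun x : E3 => (V x : ℂ) * φ x) ∧
    Integrable (fun ξ : E3 => g ξ * φ ξ) ∧
    ∫ x : E3, (V x : ℂ) * fourierT φ x = ∫ ξ : E3, g ξ * φ ξ

/-! ### The weighted Sobolev space `W^{n,1}_s(ℝ³)` -/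

/-- The partial derivative `∂φ/∂x_i`. -/
def partialDeriv (i : Fin 3) (φ : E3 → ℝ) (x : E3) : ℝ :=
  fderiv ℝ φ x (EuclideanSpace.single i 1)

/-- `D^α φ = ∂^{|α|} φ / ∂x₁^{α₁} ∂x₂^{α₂} ∂x₃^{α₃}`. -/
def multiDeriv (α : Fin 3 → ℕ) (φ : E3 → ℝ) : E3 → ℝ :=
  (partialDeriv 0)^[α 0] ((partialDeriv 1)^[α 1] ((partialDeriv 2)^[α 2] φ))

/-- `g` is the weak derivative `D^α f`. -/
def IsWeakDeriv (α : Fin 3 → ℕ) (f g : E3 → ℂ) : Prop :=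
  LocallyIntegrable f ∧ LocallyIntegrable g ∧
    ∀ φ : E3 → ℝ, ContDiff ℝ (⊤ : ℕ∞) φ → HasCompactSupport φ →
      ∫ x : E3, (multiDeriv α φ x : ℂ) * f x =
        (-1) ^ (∑ i, α i) * ∫ x : E3, (φ x : ℂ) * g x

open scoped Classical in
/-- The weak derivative `D^α f` (unique almost everywhere) if it exists. -/
def weakDeriv (α : Fin 3 → ℕ) (f : E3 → ℂ) : E3 → ℂ :=
  if h : ∃ g, IsWeakDeriv α f g then h.choose else 0

/-- The multi-indices `α ∈ ℕ³` with `|α| ≤ n`. -/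
def multiIndices (n : ℕ) : Finset (Fin 3 → ℕ) :=
  (Fintype.piFinset fun _ => Finset.range (n + 1)).filter fun α => ∑ i, α i ≤ n

/-- The weight `⟨x⟩^s`, where `⟨x⟩ = (1 + |x|²)^{1/2}`. -/
def weight (s : ℝ) (x : E3) : ℝ := (1 + ‖x‖ ^ 2) ^ (s / 2)

/-- Membership in `W^{n,1}_s(ℝ³)`: all weak derivatives of order at most `n` exist and are
integrable with weight `⟨x⟩^s`. -/
def MemW (n : ℕ) (s : ℝ) (f : E3 → ℂ) : Prop :=
  ∀ α ∈ multiIndices n, (∃ g, IsWeakDeriv α f g) ∧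
    Integrable (fun x : E3 => weight s x * ‖weakDeriv α f x‖)

/-- `‖f‖_{W^{n,1}_s} = ∑_{|α| ≤ n} ∫ ⟨x⟩^s |D^α f(x)| dx`. -/
def normW (n : ℕ) (s : ℝ) (f : E3 → ℂ) : ℝ :=
  ∑ α ∈ multiIndices n, ∫ x : E3, weight s x * ‖weakDeriv α f x‖

/-! ### Oscillator eigenfunctions -/

/-- The normalized Hermite function
`φ_n(x) = (2^n n! √π)^{-1/2} H_n(x) e^{-x²/2}`. It is written with the polynomials of
Mathlib, which are orthogonal for `e^{-x²/2}`: `H_n(x) = 2^{n/2} He_n(√2 x)`. -/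
def hermiteFun (n : ℕ) (x : ℝ) : ℝ :=
  (Real.sqrt (n.factorial * Real.sqrt Real.pi))⁻¹ *
    Polynomial.aeval (Real.sqrt 2 * x) (Polynomial.hermite n) * Real.exp (-x ^ 2 / 2)

/-- `φ_n(x) = φ_{n₁}(x₁) φ_{n₂}(x₂) φ_{n₃}(x₃)` for `n ∈ ℕ³`. -/
def hermiteFun3 (n : Fin 3 → ℕ) (x : E3) : ℝ := ∏ i, hermiteFun (n i) (x i)

/-- `φ^ε_{n,j}(r) = ε^{-3/2} φ_n(ε^{-1}(r - a_j))`, where `c = a_j`. -/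
def oscFun (ε : ℝ) (c : E3) (n : Fin 3 → ℕ) (r : E3) : ℝ :=
  ε ^ (-(3 / 2) : ℝ) * hermiteFun3 n (ε⁻¹ • (r - c))

/-- `E^ε_n = ε (|n| + 3/2)`, the energy of `φ^ε_{n,j}` with respect to
`h_j^ε = ε^{-1} [-(ε⁴/2) Δ + |r - a_j|²/2]`. -/
def oscEnergy (ε : ℝ) (n : Fin 3 → ℕ) : ℝ := ε * ((∑ i, n i : ℕ) + 3 / 2)

/-- `(r₁, …, r_N) ↦ ∏_k φ^ε_{n_k,k}(r_k)`. -/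
def oscProd {N : ℕ} (ε : ℝ) (a : Fin N → E3) (n : Fin N → Fin 3 → ℕ) (r : Fin N → E3) : ℝ :=
  ∏ k, oscFun ε (a k) (n k) (r k)

/-! ### The free evolution -/

theorem memLp_tensor {X Y : Type} [MeasureSpace X] [MeasureSpace Y]
    [SFinite (volume : Measure X)] [SFinite (volume : Measure Y)] (f : L2 X) (g : L2 Y) :
    MemLp (fun p : X × Y => f p.1 * g p.2) 2 (volume : Measure (X × Y)) ∧
    eLpNorm (fun p : X × Y => f p.1 * g p.2) 2 (volume : Measure (X × Y)) =
      eLpNorm f 2 volume * eLpNorm g 2 volume := by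
  have hf := Lp.memLp f
  have hg := Lp.memLp g
  have key : eLpNorm (fun p : X × Y => f p.1 * g p.2) 2 (volume : Measure (X × Y)) =
      eLpNorm f 2 volume * eLpNorm g 2 volume := by
    rw [eLpNorm_eq_lintegral_rpow_enorm_toReal (by norm_num) (by norm_num),
      eLpNorm_eq_lintegral_rpow_enorm_toReal (by norm_num) (by norm_num),
      eLpNorm_eq_lintegral_rpow_enorm_toReal (by norm_num) (by norm_num),
      ← ENNReal.mul_rpow_of_nonneg _ _ (by norm_num)]
    congr 1
    rw [Measure.volume_eq_prod,
      ← lintegral_prod_mul (hf.1.enorm.pow_const _) (hg.1.enorm.pow_const _)]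
    refine lintegral_congr fun p => ?_
    rw [enorm_mul, ENNReal.mul_rpow_of_nonneg _ _ (by norm_num)]
  refine ⟨⟨?_, ?_⟩, key⟩
  · rw [Measure.volume_eq_prod]
    exact hf.1.comp_fst.mul hg.1.comp_snd
  · rw [key]
    exact ENNReal.mul_lt_top hf.2 hg.2

/-- The bounded operator `f ↦ f ⊗ g` from `L²(X)` to `L²(X × Y)`,
where `(f ⊗ g)(x, y) = f(x) g(y)`. -/
def tensorRight {X Y : Type} [MeasureSpace X] [MeasureSpace Y]
    [SFinite (volume : Measure X)] [SFinite (volume : Measure Y)] (g : L2 Y) :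
    L2 X →L[ℂ] L2 (X × Y) :=
  LinearMap.mkContinuous
    { toFun := fun f => (memLp_tensor f g).1.toLp _
      map_add' := by
        intro f₁ f₂
        rw [← MemLp.toLp_add]
        refine MemLp.toLp_congr _ _ ?_
        rw [Measure.volume_eq_prod]
        have h := Measure.quasiMeasurePreserving_fst
          (μ := (volume : Measure X)) (ν := (volume : Measure Y)) |>.ae
          (Lp.coeFn_add f₁ f₂)
        filter_upwards [h] with p hp
        simp only [Pi.add_apply] at hp ⊢
        rw [hp, add_mul]
      map_smul' := by
        intro c f
        rw [RingHom.id_apply, ← MemLp.toLp_const_smul]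
        refine MemLp.toLp_congr _ _ ?_
        rw [Measure.volume_eq_prod]
        have h := Measure.quasiMeasurePreserving_fst
          (μ := (volume : Measure X)) (ν := (volume : Measure Y)) |>.ae
          (Lp.coeFn_smul c f)
        filter_upwards [h] with p hp
        simp only [Pi.smul_apply, smul_eq_mul] at hp ⊢
        rw [hp, mul_assoc] }
    ‖g‖ (by
      intro f
      change ‖(memLp_tensor f g).1.toLp _‖ ≤ _
      rw [Lp.norm_toLp, (memLp_tensor f g).2, ENNReal.toReal_mul, ← Lp.norm_def, ← Lp.norm_def,
        mul_comm])

/-- `e^{-i (t/ε²) h₀^ε}` on `L²(ℝ³)`, with `h₀^ε = -(ε⁴/2) Δ`: multiplication by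
`e^{-i t ε² |k|²/2}` in Fourier space. The Fourier transform of Mathlib uses the frequency `p`
with `k = 2π p`. -/
def freeEvol (ε t : ℝ) (ψ : L2 E3) : L2 E3 :=
  (Lp.fourierTransformₗᵢ E3 ℂ).symm
    (mulL2 (fun p : E3 => Complex.exp
      (-Complex.I * ((t * ε ^ 2 * (2 * Real.pi * ‖p‖) ^ 2 / 2 : ℝ) : ℂ)))
      (Lp.fourierTransformₗᵢ E3 ℂ ψ))

/-- The operator `ψ ↦ ψ ⊗ ∏_k φ^ε_{n_k,k}` from `L²(ℝ³)` to `L²(ℝ^{3(N+1)})`. -/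
def oscEmbed {N : ℕ} (ε : ℝ) (a : Fin N → E3) (n : Fin N → Fin 3 → ℕ) :
    L2 E3 →L[ℂ] L2 (Config N) :=
  tensorRight (toL2 fun r : Fin N → E3 => (oscProd ε a n r : ℂ))

/-- The unitary group `𝓤₀^ε(t) = e^{-i (t/ε²) H₀^ε}` with `H₀^ε = h₀^ε + ∑_j h_j^ε`. The
oscillator part is diagonal in the Hilbert basis `∏_k φ^ε_{n_k,k}` of eigenfunctions: the
component `ψ_n(R) = ∫ ∏_k φ^ε_{n_k,k}(r_k) Ψ(R, r) dr` of `Ψ` evolves freely and picks up the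
phase `e^{-i (t/ε²) ∑_k E^ε_{n_k}}`. The map `Ψ ↦ ψ_n` is the adjoint of `oscEmbed`, and the
series converges in `L²`. -/
def freeProp {N : ℕ} (ε : ℝ) (a : Fin N → E3) (t : ℝ) (Ψ : L2 (Config N)) : L2 (Config N) :=
  ∑' n : Fin N → Fin 3 → ℕ,
    Complex.exp (-Complex.I * ((t / ε ^ 2 * ∑ k, oscEnergy ε (n k) : ℝ) : ℂ)) •
      oscEmbed ε a n (freeEvol ε t ((oscEmbed ε a n).adjoint Ψ))

/-! ### The interaction and the first-order term -/

/-- `V_j^ε(R, r_j) = V(ε^{-1}(R - r_j))`. -/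
def interaction {N : ℕ} (V : E3 → ℝ) (ε : ℝ) (j : Fin N) (q : Config N) : ℝ :=
  V (ε⁻¹ • (q.1 - q.2 j))

/-- `s ↦ 𝓤₀^ε(-s) V_j^ε 𝓤₀^ε(s) Ψ`. -/
def bornIntegrand {N : ℕ} (V : E3 → ℝ) (ε : ℝ) (a : Fin N → E3) (j : Fin N)
    (Ψ : L2 (Config N)) (s : ℝ) : L2 (Config N) :=
  freeProp ε a (-s) (mulL2 (fun q => (interaction V ε j q : ℂ)) (freeProp ε a s Ψ))

/-- `I_j^ε(t) Ψ = -i ∫₀ᵗ 𝓤₀^ε(-s) V_j^ε 𝓤₀^ε(s) Ψ ds`. -/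
def bornTerm {N : ℕ} (V : E3 → ℝ) (ε : ℝ) (a : Fin N → E3) (j : Fin N) (t : ℝ)
    (Ψ : L2 (Config N)) : L2 (Config N) :=
  (-Complex.I) • ∫ s in (0 : ℝ)..t, bornIntegrand V ε a j Ψ s

/-! ### The spherical wave and its portions -/

/-- The unit sphere `S²`; its surface measure is `volume.toSphere`, of total mass `4π`. -/
abbrev S2 : Type := Metric.sphere (0 : E3) 1

/-- `f(x) = π^{-3/4} e^{-|x|²/2}`. -/
def gaussian (x : E3) : ℝ := Real.pi ^ (-(3 / 4) : ℝ) * Real.exp (-‖x‖ ^ 2 / 2)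

/-- The wave `ε^{-5/2} f(ε^{-1} R) ∫_A e^{(i/ε²) v₀ u·R} du` issuing from the portion `A`
of the sphere, without normalization. -/
def rawWave (v₀ ε : ℝ) (A : Set S2) (R : E3) : ℂ :=
  ((ε ^ (-(5 / 2) : ℝ) * gaussian (ε⁻¹ • R) : ℝ) : ℂ) *
    ∫ u in A, Complex.exp (Complex.I * ((v₀ / ε ^ 2 * inner ℝ (u : E3) R : ℝ) : ℂ))
      ∂(volume : Measure E3).toSphere

/-- The normalization constant `𝓝_ε > 0`, for which the spherical wave has unit `L²` norm. -/
def normConst (v₀ ε : ℝ) : ℝ :=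
  (Real.sqrt (∫ R : E3, ‖rawWave v₀ ε Set.univ R‖ ^ 2))⁻¹

/-- The state of the whole system in which the test particle is in the portion `A` of the
normalized spherical wave and all the oscillators are in their ground states. -/
def waveState {N : ℕ} (v₀ ε : ℝ) (a : Fin N → E3) (A : Set S2) : L2 (Config N) :=
  toL2 fun q : Config N =>
    (normConst v₀ ε : ℂ) * rawWave v₀ ε A q.1 * (oscProd ε a (fun _ _ => 0) q.2 : ℂ)

/-- `θ₀ = ½ min {θ_{jk}, π}` over `j ≠ k`, where `θ_{jk}` is the angle between `a_j`
and `a_k`. -/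
def theta0 {N : ℕ} (a : Fin N → E3) : ℝ :=
  1 / 2 * sInf ({Real.pi} ∪
    {θ | ∃ j k : Fin N, j ≠ k ∧ θ = InnerProductGeometry.angle (a j) (a k)})

/-- The portion `𝓒_j` of the sphere around `â_j`. If `𝓡_j` is a rotation with
`𝓡_j â_j = (0,0,1)`, then `(𝓡_j u)₃ = u·â_j` and
`(𝓡_j u)₁² + (𝓡_j u)₂² = 1 - (u·â_j)²`. -/
def cap {N : ℕ} (a : Fin N → E3) (j : Fin N) : Set S2 :=
  {u | 1 - (inner ℝ (u : E3) (‖a j‖⁻¹ • a j)) ^ 2 < Real.sin (theta0 a) ^ 2 ∧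
    0 < inner ℝ (u : E3) (‖a j‖⁻¹ • a j)}

/-- `Ψ₀^ε`, the initial state. -/
def initialState {N : ℕ} (v₀ ε : ℝ) (a : Fin N → E3) : L2 (Config N) :=
  waveState v₀ ε a Set.univ

/-- `Ψ_{0,j}^ε`, where only the portion of the spherical wave around `â_j` is kept. -/
def initialStatePortion {N : ℕ} (v₀ ε : ℝ) (a : Fin N → E3) (j : Fin N) : L2 (Config N) :=
  waveState v₀ ε a (cap a j)

/-- The assumption `(B)` on the positions of the oscillators:
`|a₁| < … < |a_N|`, and `a_i·a_j ≠ |a_i| |a_j|` for `i ≠ j`. -/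
def PositionsB {N : ℕ} (a : Fin N → E3) : Prop :=
  (∀ i j : Fin N, i < j → ‖a i‖ < ‖a j‖) ∧
    ∀ i j : Fin N, i ≠ j → inner ℝ (a i) (a j) ≠ ‖a i‖ * ‖a j‖

end

end SphericalWave

open SphericalWave

namespace SphericalWave

/-! ### Orthonormality of the Hermite functions -/

/-! The difference of the two states is a superposition, over directions `u` outside the cap around
`â_j`, of Gaussian packets, tensored with the oscillator ground states. The free evolution moves the
packet with direction `u` along the ray `s v₀ u` and widens it from `ε` to `ε √(1+s²)`; each
oscillator stays in its ground state, concentrated within `ε` of its centre. A ray outside the cap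
keeps a distance at least `β > 0` from `a_j`, uniformly in `s`, `u` and `j`
(`le_norm_smul_sub_of_notMem_cap`). Hence `V` is evaluated at points of size about `β/ε`, where it
is of order `ε^k`.

The decay of `V` comes from `Ṽ`: each weak derivative of `Ṽ` becomes a factor `x_i` on the inverse
Fourier integral, so `V` agrees almost everywhere with a continuous `W` bounded by a multiple of
`(1+|x|)^{-k}` (`exists_continuous_decaying_ae_eq`). Gaussian tails are handled by
submultiplicativity of `1+|·|`: the distance from the packet's centre to `a_j` is traded for
`|R-r_j|`, which `W` pays for, and the deviations of `R` and `r_j` from their centres, which only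
change Gaussian moments (`norm_mulL2_interactionC_le`).

The directions are summed with the triangle inequality. Each unnormalized packet contributes
`ε^{3/2}`, while the normalized amplitude is at most a constant times `(1+ε) ε^{-5/2}`
(`exists_normConst_mul_waveAmp_le`); together they cost `ε^{-1}`, and `ε^{-1} ε^k = ε^{k-1}`. The
amplitude bound is a lower bound for the norm of the whole spherical wave: its packets have positive
Gaussian Fourier transforms concentrated near one spherical shell, so Cauchy–Schwarz with the
indicator of the shell applies. The factor `1+ε`, relevant for large `ε`, is absorbed by
`one_add_mul_pow_le`.

The outer propagator enters only through `norm_freeProp_le` and measurability in time; both follow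
from orthonormality of the oscillator eigenfunctions. -/

theorem integrable_eval_mul_exp (p : Polynomial ℝ) :
    Integrable fun x : ℝ => p.eval x * Real.exp (-x ^ 2 / 2) := by
  induction p using Polynomial.induction_on' with
  | add p q hp hq =>
    refine (hp.add hq).congr (Filter.Eventually.of_forall fun x => ?_)
    simp only [Pi.add_apply, Polynomial.eval_add, add_mul]
  | monomial n c =>
    have h := (integrable_rpow_mul_exp_neg_mul_sq (b := 1 / 2) (by norm_num) (s := (n : ℝ))
      (by have := Nat.cast_nonneg (α := ℝ) n; linarith)).const_mul c
    refine h.congr (Filter.Eventually.of_forall fun x => ?_)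
    simp only [Polynomial.eval_monomial, Real.rpow_natCast]
    rw [mul_assoc]
    congr 3
    ring

/-- The Hermite polynomial with real coefficients. -/
noncomputable def realHermite (n : ℕ) : Polynomial ℝ :=
  (Polynomial.hermite n).map (Int.castRingHom ℝ)

theorem realHermite_succ (n : ℕ) :
    realHermite (n + 1) = Polynomial.X * realHermite n - Polynomial.derivative (realHermite n) := by
  simp [realHermite, Polynomial.hermite_succ, Polynomial.derivative_map]

theorem natDegree_realHermite (n : ℕ) : (realHermite n).natDegree = n := by
  rw [realHermite, (Polynomial.hermite_monic n).natDegree_map, Polynomial.natDegree_hermite]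

/-- Integration by parts: the recursion for Hermite polynomials says that `He_{n+1} e^{-x²/2}` is
minus the derivative of `He_n e^{-x²/2}`. Iterating it moves `n` derivatives onto `p`, which kills
polynomials of degree below `n`. -/
theorem integral_mul_realHermite_succ (p : Polynomial ℝ) (n : ℕ) :
    ∫ x : ℝ, (p * realHermite (n + 1)).eval x * Real.exp (-x ^ 2 / 2) =
      ∫ x : ℝ, (Polynomial.derivative p * realHermite n).eval x * Real.exp (-x ^ 2 / 2) := by
  have hu : ∀ x : ℝ, HasDerivAt (fun x => p.eval x) ((Polynomial.derivative p).eval x) x :=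
    fun x => p.hasDerivAt x
  have hv : ∀ x : ℝ, HasDerivAt (fun x => (realHermite n).eval x * Real.exp (-x ^ 2 / 2))
      (-((realHermite (n + 1)).eval x * Real.exp (-x ^ 2 / 2))) x := by
    intro x
    have h1 : HasDerivAt (fun x : ℝ => -x ^ 2 / 2) (-x) x := by
      refine ((hasDerivAt_pow 2 x).neg.div_const 2).congr_deriv ?_
      norm_num
      ring
    refine (((realHermite n).hasDerivAt x).mul h1.exp).congr_deriv ?_
    rw [realHermite_succ]
    simp only [Polynomial.eval_sub, Polynomial.eval_mul, Polynomial.eval_X]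
    ring
  have key := integral_mul_deriv_eq_deriv_mul_of_integrable (u := fun x : ℝ => p.eval x)
    (v := fun x => (realHermite n).eval x * Real.exp (-x ^ 2 / 2)) (fun x _ => hu x) (fun x _ => hv x)
    ?_ ?_ ?_
  · simp only [mul_neg, integral_neg, neg_inj] at key
    simpa only [Polynomial.eval_mul, mul_assoc] using key
  · refine (integrable_eval_mul_exp (p * realHermite (n + 1))).neg.congr
      (Filter.Eventually.of_forall fun x => ?_)
    simp [mul_assoc]
  · refine (integrable_eval_mul_exp (Polynomial.derivative p * realHermite n)).congr
      (Filter.Eventually.of_forall fun x => ?_)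
    simp [mul_assoc]
  · refine (integrable_eval_mul_exp (p * realHermite n)).congr
      (Filter.Eventually.of_forall fun x => ?_)
    simp [mul_assoc]

theorem integral_mul_realHermite (n : ℕ) (p : Polynomial ℝ) :
    ∫ x : ℝ, (p * realHermite n).eval x * Real.exp (-x ^ 2 / 2) =
      ∫ x : ℝ, (Polynomial.derivative^[n] p).eval x * Real.exp (-x ^ 2 / 2) := by
  induction n generalizing p with
  | zero => simp [realHermite]
  | succ n ih => rw [integral_mul_realHermite_succ, ih, Function.iterate_succ_apply]

theorem integral_realHermite_mul_of_lt {m n : ℕ} (h : m < n) :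
    ∫ x : ℝ, (realHermite m * realHermite n).eval x * Real.exp (-x ^ 2 / 2) = 0 := by
  rw [integral_mul_realHermite, Polynomial.iterate_derivative_eq_zero]
  · simp
  · rwa [natDegree_realHermite]

theorem iterate_derivative_realHermite (n : ℕ) :
    Polynomial.derivative^[n] (realHermite n) = Polynomial.C (n.factorial : ℝ) := by
  have hdeg : (Polynomial.derivative^[n] (realHermite n)).natDegree ≤ 0 := by
    have := Polynomial.natDegree_iterate_derivative (realHermite n) n
    rwa [natDegree_realHermite, Nat.sub_self] at this
  rw [Polynomial.eq_C_of_natDegree_le_zero hdeg, Polynomial.coeff_iterate_derivative]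
  simp [realHermite, Nat.descFactorial_self]

theorem integral_realHermite_mul (m n : ℕ) :
    ∫ x : ℝ, (realHermite m * realHermite n).eval x * Real.exp (-x ^ 2 / 2) =
      if m = n then n.factorial * Real.sqrt (2 * Real.pi) else 0 := by
  split_ifs with h
  · subst h
    rw [integral_mul_realHermite, iterate_derivative_realHermite]
    simp only [Polynomial.eval_C]
    rw [integral_const_mul]
    congr 1
    have := integral_gaussian (1 / 2)
    rw [show Real.pi / (1 / 2) = 2 * Real.pi by ring] at this
    rw [← this]
    congr 1
    ext x
    congr 1
    ring
  · rcases lt_or_gt_of_ne h with h | h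
    · exact integral_realHermite_mul_of_lt h
    · rw [mul_comm]
      exact integral_realHermite_mul_of_lt h

theorem hermiteFun_eq (n : ℕ) (x : ℝ) :
    hermiteFun n x = (Real.sqrt (n.factorial * Real.sqrt Real.pi))⁻¹ *
      (realHermite n).eval (Real.sqrt 2 * x) * Real.exp (-x ^ 2 / 2) := by
  rw [hermiteFun, realHermite, Polynomial.eval_map, Polynomial.aeval_def]
  rfl

/-- The two factors `e^{-x²/2}` combine to `e^{-y²/2}` at `y = √2 x`, which is the argument of the
polynomials. Orthogonality with weight `e^{-y²/2}` thus transfers by a linear change of variable. -/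
theorem hermiteFun_mul_eq (m n : ℕ) (x : ℝ) :
    hermiteFun m x * hermiteFun n x = (Real.sqrt (m.factorial * Real.sqrt Real.pi))⁻¹ *
      (Real.sqrt (n.factorial * Real.sqrt Real.pi))⁻¹ *
      ((realHermite m * realHermite n).eval (Real.sqrt 2 * x) *
        Real.exp (-(Real.sqrt 2 * x) ^ 2 / 2)) := by
  rw [hermiteFun_eq, hermiteFun_eq, Polynomial.eval_mul,
    show Real.exp (-(Real.sqrt 2 * x) ^ 2 / 2) = Real.exp (-x ^ 2 / 2) * Real.exp (-x ^ 2 / 2) by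
      rw [← Real.exp_add, mul_pow, Real.sq_sqrt (by norm_num)]
      congr 1
      ring]
  ring

theorem integrable_hermiteFun_mul (m n : ℕ) :
    Integrable fun x => hermiteFun m x * hermiteFun n x := by
  simp only [hermiteFun_mul_eq]
  exact ((integrable_eval_mul_exp (realHermite m * realHermite n)).comp_mul_left'
    (by positivity)).const_mul _

theorem integral_hermiteFun_mul (m n : ℕ) :
    ∫ x, hermiteFun m x * hermiteFun n x = if m = n then 1 else 0 := by
  simp only [hermiteFun_mul_eq]
  rw [integral_const_mul,
    Measure.integral_comp_mul_left (fun x : ℝ => (realHermite m * realHermite n).eval x *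
      Real.exp (-x ^ 2 / 2)), integral_realHermite_mul]
  split_ifs with h
  · subst h
    have hp : 0 < (m.factorial : ℝ) * Real.sqrt Real.pi := by positivity
    rw [← mul_inv, Real.mul_self_sqrt hp.le, Real.sqrt_mul (by norm_num), abs_of_pos (by positivity),
      smul_eq_mul]
    field_simp
  · simp

theorem continuous_hermiteFun (n : ℕ) : Continuous (hermiteFun n) := by
  unfold hermiteFun
  have h : Continuous fun x : ℝ => Polynomial.aeval (Real.sqrt 2 * x) (Polynomial.hermite n) :=
    (Polynomial.continuous_aeval (R := ℤ) (A := ℝ) (Polynomial.hermite n)).comp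
      (continuous_const.mul continuous_id)
  fun_prop

end SphericalWave

namespace SphericalWave

/-! ### Representatives of square-integrable functions -/

theorem coeFn_toL2 {X : Type} [MeasureSpace X] {f : X → ℂ} (h : MemLp f 2 (volume : Measure X)) :
    toL2 f =ᵐ[volume] f := by
  rw [toL2, dif_pos h]
  exact h.coeFn_toLp

/-- The default value `0` is also respected, so a potential may be replaced by an almost everywhere
equal one without first knowing that the product is square-integrable. -/
theorem toL2_congr {X : Type} [MeasureSpace X] {f g : X → ℂ}
    (h : f =ᵐ[(volume : Measure X)] g) : toL2 f = toL2 g := by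
  by_cases hf : MemLp f 2 (volume : Measure X)
  · have hg : MemLp g 2 (volume : Measure X) := (memLp_congr_ae h).1 hf
    rw [toL2, toL2, dif_pos hf, dif_pos hg]
    exact MemLp.toLp_congr _ _ h
  · have hg : ¬ MemLp g 2 (volume : Measure X) := fun hg => hf ((memLp_congr_ae h).2 hg)
    rw [toL2, toL2, dif_neg hf, dif_neg hg]

theorem toL2_coeFn {X : Type} [MeasureSpace X] (f : L2 X) : toL2 (f : X → ℂ) = f := by
  rw [toL2, dif_pos (Lp.memLp f)]
  exact Lp.toLp_coeFn f (Lp.memLp f)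

theorem eq_toL2 {X : Type} [MeasureSpace X] {f : L2 X} {g : X → ℂ}
    (h : f =ᵐ[volume] g) : f = toL2 g := by
  rw [← toL2_congr h, toL2_coeFn]

theorem inner_toL2 {X : Type} [MeasureSpace X] {f g : X → ℂ}
    (hf : MemLp f 2 (volume : Measure X)) (hg : MemLp g 2 (volume : Measure X)) :
    inner ℂ (toL2 f) (toL2 g) = ∫ x, inner ℂ (f x) (g x) := by
  rw [L2.inner_def]
  refine integral_congr_ae ?_
  filter_upwards [coeFn_toL2 hf, coeFn_toL2 hg] with x h1 h2
  rw [h1, h2]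

theorem norm_sq_L2 {X : Type} [MeasureSpace X] (f : L2 X) :
    ‖f‖ ^ 2 = ∫ x, ‖f x‖ ^ 2 := by
  have h := L2.inner_def (𝕜 := ℂ) f f
  rw [inner_self_eq_norm_sq_to_K] at h
  simp only [inner_self_eq_norm_sq_to_K] at h
  have h2 : (((‖f‖ ^ 2 : ℝ)) : ℂ) = ((∫ x, ‖f x‖ ^ 2 : ℝ) : ℂ) := by
    rw [← integral_complex_ofReal]
    push_cast
    exact h
  exact_mod_cast h2

theorem norm_sq_toL2 {X : Type} [MeasureSpace X] {f : X → ℂ}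
    (hf : MemLp f 2 (volume : Measure X)) : ‖toL2 f‖ ^ 2 = ∫ x, ‖f x‖ ^ 2 := by
  rw [norm_sq_L2]
  refine integral_congr_ae ?_
  filter_upwards [coeFn_toL2 hf] with x h
  rw [h]

/-! ### Multiplication operators -/

theorem memLp_mul_of_bound {X : Type} [MeasureSpace X] {m : X → ℂ} {C : ℝ}
    (hm : AEStronglyMeasurable m (volume : Measure X)) (hC : ∀ x, ‖m x‖ ≤ C) (Ψ : L2 X) :
    MemLp (fun x => m x * Ψ x) 2 (volume : Measure X) := by
  refine MemLp.of_le_mul (Lp.memLp Ψ) (hm.mul (Lp.memLp Ψ).1) (c := C) ?_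
  filter_upwards with x
  rw [norm_mul]
  exact mul_le_mul_of_nonneg_right (hC x) (norm_nonneg _)

theorem coeFn_mulL2 {X : Type} [MeasureSpace X] {m : X → ℂ} {C : ℝ}
    (hm : AEStronglyMeasurable m (volume : Measure X)) (hC : ∀ x, ‖m x‖ ≤ C) (Ψ : L2 X) :
    mulL2 m Ψ =ᵐ[volume] fun x => m x * Ψ x :=
  coeFn_toL2 (memLp_mul_of_bound hm hC Ψ)

/-- Multiplication by a bounded function, as a bounded operator. -/
noncomputable def mulCLM {X : Type} [MeasureSpace X] (m : X → ℂ) (C : ℝ)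
    (hm : AEStronglyMeasurable m (volume : Measure X)) (hC : ∀ x, ‖m x‖ ≤ C) :
    L2 X →L[ℂ] L2 X :=
  LinearMap.mkContinuous
    { toFun := mulL2 m
      map_add' := by
        intro f g
        refine Lp.ext ?_
        filter_upwards [coeFn_mulL2 hm hC (f + g), coeFn_mulL2 hm hC f, coeFn_mulL2 hm hC g,
          Lp.coeFn_add f g, Lp.coeFn_add (mulL2 m f) (mulL2 m g)] with x h1 h2 h3 h4 h5
        rw [h1, h5, Pi.add_apply, h2, h3, h4, Pi.add_apply, mul_add]
      map_smul' := by
        intro c f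
        refine Lp.ext ?_
        filter_upwards [coeFn_mulL2 hm hC (c • f), coeFn_mulL2 hm hC f,
          Lp.coeFn_smul c f, Lp.coeFn_smul c (mulL2 m f)] with x h1 h2 h4 h5
        rw [RingHom.id_apply, h1, h5, Pi.smul_apply, h2, h4, Pi.smul_apply, smul_eq_mul,
          smul_eq_mul]
        ring }
    C (by
      intro f
      refine Lp.norm_le_mul_norm_of_ae_le_mul ?_
      filter_upwards [coeFn_mulL2 hm hC f] with x hx
      change ‖mulL2 m f x‖ ≤ _
      rw [hx, norm_mul]
      exact mul_le_mul_of_nonneg_right (hC x) (norm_nonneg _))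

theorem mulCLM_apply {X : Type} [MeasureSpace X] {m : X → ℂ} {C : ℝ}
    (hm : AEStronglyMeasurable m (volume : Measure X)) (hC : ∀ x, ‖m x‖ ≤ C) (Ψ : L2 X) :
    mulCLM m C hm hC Ψ = mulL2 m Ψ := rfl

theorem norm_mulL2_of_norm_eq_one {X : Type} [MeasureSpace X] {m : X → ℂ}
    (hm : AEStronglyMeasurable m (volume : Measure X)) (h1 : ∀ x, ‖m x‖ = 1) (Ψ : L2 X) :
    ‖mulL2 m Ψ‖ = ‖Ψ‖ := by
  have h := coeFn_mulL2 hm (fun x => (h1 x).le) Ψ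
  refine le_antisymm (Lp.norm_le_norm_of_ae_le ?_) (Lp.norm_le_norm_of_ae_le ?_) <;>
  · filter_upwards [h] with x hx
    rw [hx, norm_mul, h1, one_mul]

/-- Dominated convergence with majorant `4|Ψ|²`. It gives strong continuity of the free evolution in
time and continuity of the packets in their direction. -/
theorem continuous_mulL2 {X T : Type} [MeasureSpace X] [TopologicalSpace T]
    [FirstCountableTopology T] {m : T → X → ℂ}
    (hm : ∀ s, AEStronglyMeasurable (m s) (volume : Measure X)) (h1 : ∀ s x, ‖m s x‖ ≤ 1)
    (hc : ∀ x, Continuous fun s => m s x) (Ψ : L2 X) : Continuous fun s => mulL2 (m s) Ψ := by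
  rw [continuous_iff_continuousAt]
  intro s₀
  rw [ContinuousAt, tendsto_iff_norm_sub_tendsto_zero]
  have hsq : ∀ s, ‖mulL2 (m s) Ψ - mulL2 (m s₀) Ψ‖ ^ 2 =
      ∫ x, ‖m s x - m s₀ x‖ ^ 2 * ‖Ψ x‖ ^ 2 := by
    intro s
    rw [norm_sq_L2]
    refine integral_congr_ae ?_
    filter_upwards [coeFn_mulL2 (hm s) (h1 s) Ψ, coeFn_mulL2 (hm s₀) (h1 s₀) Ψ,
      Lp.coeFn_sub (mulL2 (m s) Ψ) (mulL2 (m s₀) Ψ)] with x h2 h3 h4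
    rw [h4, Pi.sub_apply, h2, h3, ← sub_mul, norm_mul, mul_pow]
  have hΨ : Integrable fun x : X => ‖Ψ x‖ ^ 2 := (Lp.memLp Ψ).integrable_norm_pow (by norm_num)
  have hlim : Filter.Tendsto (fun s => ∫ x, ‖m s x - m s₀ x‖ ^ 2 * ‖Ψ x‖ ^ 2) (nhds s₀)
      (nhds (∫ _ : X, (0 : ℝ))) := by
    refine tendsto_integral_filter_of_dominated_convergence (fun x => 4 * ‖Ψ x‖ ^ 2)
      (Filter.Eventually.of_forall fun s => ?_) (Filter.Eventually.of_forall fun s => ?_)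
      (hΨ.const_mul 4) (Filter.Eventually.of_forall fun x => ?_)
    · exact (((hm s).sub (hm s₀)).norm.pow 2).mul hΨ.1
    · filter_upwards with x
      rw [Real.norm_of_nonneg (by positivity)]
      refine mul_le_mul_of_nonneg_right ?_ (by positivity)
      have : ‖m s x - m s₀ x‖ ≤ 2 := (norm_sub_le _ _).trans (by linarith [h1 s x, h1 s₀ x])
      nlinarith [norm_nonneg (m s x - m s₀ x)]
    · have : Filter.Tendsto (fun s => ‖m s x - m s₀ x‖ ^ 2 * ‖Ψ x‖ ^ 2) (nhds s₀)
          (nhds (‖m s₀ x - m s₀ x‖ ^ 2 * ‖Ψ x‖ ^ 2)) :=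
        ((((hc x).sub continuous_const).norm.pow 2).mul continuous_const).tendsto s₀
      simpa using this
  rw [integral_zero] at hlim
  simp only [← hsq] at hlim
  have := hlim.sqrt
  simpa only [Real.sqrt_sq (norm_nonneg _), Real.sqrt_zero] using this

/-! ### The free evolution of the test particle -/

/-- The Fourier multiplier of the free evolution. -/
noncomputable def freePhase (ε t : ℝ) (p : E3) : ℂ :=
  Complex.exp (-Complex.I * ((t * ε ^ 2 * (2 * Real.pi * ‖p‖) ^ 2 / 2 : ℝ) : ℂ))

theorem norm_exp_neg_I_mul (x : ℝ) : ‖Complex.exp (-Complex.I * (x : ℂ))‖ = 1 := by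
  rw [Complex.norm_exp]
  simp

theorem norm_freePhase (ε t : ℝ) (p : E3) : ‖freePhase ε t p‖ = 1 := norm_exp_neg_I_mul _

theorem continuous_freePhase (ε : ℝ) : Continuous fun q : ℝ × E3 => freePhase ε q.1 q.2 := by
  unfold freePhase
  fun_prop

theorem continuous_freePhase_right (ε t : ℝ) : Continuous (freePhase ε t) :=
  (continuous_freePhase ε).comp (continuous_const.prodMk continuous_id)

theorem freeEvol_eq (ε t : ℝ) (ψ : L2 E3) :
    freeEvol ε t ψ = (Lp.fourierTransformₗᵢ E3 ℂ).symm
      (mulL2 (freePhase ε t) (Lp.fourierTransformₗᵢ E3 ℂ ψ)) := rfl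

theorem norm_freeEvol (ε t : ℝ) (ψ : L2 E3) : ‖freeEvol ε t ψ‖ = ‖ψ‖ := by
  rw [freeEvol_eq, LinearIsometryEquiv.norm_map,
    norm_mulL2_of_norm_eq_one (continuous_freePhase_right ε t).aestronglyMeasurable
      (norm_freePhase ε t), LinearIsometryEquiv.norm_map]

/-- The free evolution as a bounded operator. -/
noncomputable def freeCLM (ε t : ℝ) : L2 E3 →L[ℂ] L2 E3 :=
  ((Lp.fourierTransformₗᵢ E3 ℂ).symm.toContinuousLinearEquiv : L2 E3 →L[ℂ] L2 E3).comp
    ((mulCLM (freePhase ε t) 1 (continuous_freePhase_right ε t).aestronglyMeasurable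
      (fun p => (norm_freePhase ε t p).le)).comp
      ((Lp.fourierTransformₗᵢ E3 ℂ).toContinuousLinearEquiv : L2 E3 →L[ℂ] L2 E3))

theorem freeCLM_apply (ε t : ℝ) (ψ : L2 E3) : freeCLM ε t ψ = freeEvol ε t ψ := rfl

theorem continuous_freeEvol_left (ε : ℝ) (ψ : L2 E3) : Continuous fun t => freeEvol ε t ψ := by
  simp only [freeEvol_eq]
  refine (LinearIsometryEquiv.continuous _).comp (continuous_mulL2 (fun s => ?_) (fun s x => ?_)
    (fun x => ?_) _)
  · exact (continuous_freePhase_right ε s).aestronglyMeasurable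
  · exact (norm_freePhase ε s x).le
  · exact (continuous_freePhase ε).comp (continuous_id.prodMk continuous_const)

/-- Strong continuity in time becomes joint continuity because every evolution operator is an
isometry. -/
theorem continuous_freeEvol (ε : ℝ) : Continuous fun q : ℝ × L2 E3 => freeEvol ε q.1 q.2 := by
  rw [continuous_iff_continuousAt]
  rintro ⟨t₀, ψ₀⟩
  rw [ContinuousAt, tendsto_iff_norm_sub_tendsto_zero]
  have h1 : Filter.Tendsto (fun q : ℝ × L2 E3 => ‖q.2 - ψ₀‖ +
      ‖freeEvol ε q.1 ψ₀ - freeEvol ε t₀ ψ₀‖) (nhds (t₀, ψ₀)) (nhds 0) := by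
    have : Continuous (fun q : ℝ × L2 E3 => ‖q.2 - ψ₀‖ +
      ‖freeEvol ε q.1 ψ₀ - freeEvol ε t₀ ψ₀‖) :=
      (continuous_snd.sub continuous_const).norm.add
        (((continuous_freeEvol_left ε ψ₀).comp continuous_fst).sub continuous_const).norm
    simpa using this.tendsto (t₀, ψ₀)
  refine squeeze_zero (fun _ => norm_nonneg _) (fun q => ?_) h1
  have h2 : freeEvol ε q.1 q.2 - freeEvol ε t₀ ψ₀ =
      freeEvol ε q.1 (q.2 - ψ₀) + (freeEvol ε q.1 ψ₀ - freeEvol ε t₀ ψ₀) := by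
    simp only [← freeCLM_apply, map_sub]
    abel
  rw [h2]
  refine (norm_add_le _ _).trans ?_
  rw [norm_freeEvol]

end SphericalWave

namespace SphericalWave

/-! ### Orthonormality of the oscillator eigenfunctions -/

theorem continuous_hermiteFun3 (n : Fin 3 → ℕ) : Continuous (hermiteFun3 n) := by
  unfold hermiteFun3
  refine continuous_finsetProd _ fun i _ => (continuous_hermiteFun (n i)).comp ?_
  fun_prop

theorem continuous_oscFun (ε : ℝ) (c : E3) (n : Fin 3 → ℕ) : Continuous (oscFun ε c n) := by
  unfold oscFun
  refine continuous_const.mul ((continuous_hermiteFun3 n).comp ?_)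
  fun_prop

theorem continuous_oscProd {N : ℕ} (ε : ℝ) (a : Fin N → E3) (n : Fin N → Fin 3 → ℕ) :
    Continuous (oscProd ε a n) := by
  unfold oscProd
  exact continuous_finsetProd _ fun k _ => (continuous_oscFun ε (a k) (n k)).comp
    (continuous_apply k)

theorem hermiteFun3_mul (m n : Fin 3 → ℕ) (x : E3) :
    hermiteFun3 m x * hermiteFun3 n x = ∏ i, hermiteFun (m i) (x i) * hermiteFun (n i) (x i) := by
  rw [hermiteFun3, hermiteFun3, Finset.prod_mul_distrib]

theorem integrable_hermiteFun3_mul (m n : Fin 3 → ℕ) :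
    Integrable fun x => hermiteFun3 m x * hermiteFun3 n x := by
  simp only [hermiteFun3_mul]
  rw [← (PiLp.volume_preserving_toLp (Fin 3)).integrable_comp_emb
    (MeasurableEquiv.toLp 2 (Fin 3 → ℝ)).measurableEmbedding]
  exact Integrable.fintype_prod (f := fun i x => hermiteFun (m i) x * hermiteFun (n i) x)
    fun i => integrable_hermiteFun_mul (m i) (n i)

theorem prod_ite_eq_ite {ι α : Type*} [Fintype ι] [DecidableEq α] (m n : ι → α) :
    (∏ i, if m i = n i then (1 : ℝ) else 0) = if m = n then 1 else 0 := by
  split_ifs with h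
  · subst h
    simp
  · obtain ⟨i, hi⟩ := Function.ne_iff.1 h
    exact Finset.prod_eq_zero (Finset.mem_univ i) (if_neg hi)

theorem integral_hermiteFun3_mul (m n : Fin 3 → ℕ) :
    ∫ x, hermiteFun3 m x * hermiteFun3 n x = if m = n then 1 else 0 := by
  simp only [hermiteFun3_mul]
  rw [← (PiLp.volume_preserving_toLp (Fin 3)).integral_comp
    (MeasurableEquiv.toLp 2 (Fin 3 → ℝ)).measurableEmbedding]
  have h := integral_fintype_prod_volume_eq_prod (𝕜 := ℝ) (ι := Fin 3)
    (fun i x => hermiteFun (m i) x * hermiteFun (n i) x)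
  simp only [integral_hermiteFun_mul, prod_ite_eq_ite] at h
  exact h

theorem oscFun_mul (ε : ℝ) (hε : 0 < ε) (c : E3) (m n : Fin 3 → ℕ) (r : E3) :
    oscFun ε c m r * oscFun ε c n r =
      (ε ^ 3)⁻¹ * (hermiteFun3 m (ε⁻¹ • (r - c)) * hermiteFun3 n (ε⁻¹ • (r - c))) := by
  have h : ε ^ (-(3 / 2) : ℝ) * ε ^ (-(3 / 2) : ℝ) = (ε ^ 3)⁻¹ := by
    rw [← Real.rpow_add hε, ← Real.rpow_natCast, ← Real.rpow_neg hε.le]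
    norm_num
  rw [oscFun, oscFun, ← h]
  ring

theorem integral_comp_rescale {F : Type*} [NormedAddCommGroup F] [NormedSpace ℝ F] (f : E3 → F)
    {ε : ℝ} (hε : 0 < ε) (c : E3) : ∫ r, f (ε⁻¹ • (r - c)) = ε ^ 3 • ∫ x, f x := by
  rw [integral_sub_right_eq_self (fun r => f (ε⁻¹ • r)) c,
    Measure.integral_comp_inv_smul_of_nonneg _ _ hε.le]
  simp

theorem integrable_comp_rescale {F : Type*} [NormedAddCommGroup F] {f : E3 → F}
    (hf : Integrable f) {ε : ℝ} (hε : 0 < ε) (c : E3) :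
    Integrable fun r => f (ε⁻¹ • (r - c)) :=
  (hf.comp_smul (inv_ne_zero hε.ne')).comp_sub_right c

theorem integrable_oscFun_mul {ε : ℝ} (hε : 0 < ε) (c : E3) (m n : Fin 3 → ℕ) :
    Integrable fun r => oscFun ε c m r * oscFun ε c n r := by
  simp only [oscFun_mul ε hε]
  exact (integrable_comp_rescale (integrable_hermiteFun3_mul m n) hε c).const_mul _

theorem integral_oscFun_mul {ε : ℝ} (hε : 0 < ε) (c : E3) (m n : Fin 3 → ℕ) :
    ∫ r, oscFun ε c m r * oscFun ε c n r = if m = n then 1 else 0 := by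
  simp only [oscFun_mul ε hε]
  rw [integral_const_mul, integral_comp_rescale (fun x => hermiteFun3 m x * hermiteFun3 n x) hε,
    integral_hermiteFun3_mul, smul_eq_mul, ← mul_assoc, inv_mul_cancel₀ (by positivity), one_mul]

theorem oscProd_mul {N : ℕ} (ε : ℝ) (a : Fin N → E3) (m n : Fin N → Fin 3 → ℕ)
    (r : Fin N → E3) : oscProd ε a m r * oscProd ε a n r =
      ∏ k, oscFun ε (a k) (m k) (r k) * oscFun ε (a k) (n k) (r k) := by
  rw [oscProd, oscProd, Finset.prod_mul_distrib]

theorem integral_oscProd_mul {N : ℕ} {ε : ℝ} (hε : 0 < ε) (a : Fin N → E3)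
    (m n : Fin N → Fin 3 → ℕ) :
    ∫ r, oscProd ε a m r * oscProd ε a n r = if m = n then 1 else 0 := by
  simp only [oscProd_mul]
  rw [integral_fintype_prod_volume_eq_prod (𝕜 := ℝ) (ι := Fin N)
    (fun k x => oscFun ε (a k) (m k) x * oscFun ε (a k) (n k) x)]
  simp only [integral_oscFun_mul hε, prod_ite_eq_ite]

theorem memLp_oscProd {N : ℕ} {ε : ℝ} (hε : 0 < ε) (a : Fin N → E3) (n : Fin N → Fin 3 → ℕ) :
    MemLp (fun r => (oscProd ε a n r : ℂ)) 2 (volume : Measure (Fin N → E3)) := by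
  have hc : Continuous fun r => (oscProd ε a n r : ℂ) :=
    Complex.continuous_ofReal.comp (continuous_oscProd ε a n)
  rw [memLp_two_iff_integrable_sq_norm hc.aestronglyMeasurable]
  have h : Integrable fun r => oscProd ε a n r * oscProd ε a n r := by
    simp only [oscProd_mul]
    exact Integrable.fintype_prod
      (f := fun k x => oscFun ε (a k) (n k) x * oscFun ε (a k) (n k) x)
      fun k => integrable_oscFun_mul hε (a k) (n k) (n k)
  refine h.congr (Filter.Eventually.of_forall fun r => ?_)
  simp only [Complex.norm_real, Real.norm_eq_abs, sq_abs]
  ring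

theorem inner_oscProd {N : ℕ} {ε : ℝ} (hε : 0 < ε) (a : Fin N → E3) (m n : Fin N → Fin 3 → ℕ) :
    inner ℂ (toL2 fun r : Fin N → E3 => (oscProd ε a m r : ℂ))
      (toL2 fun r : Fin N → E3 => (oscProd ε a n r : ℂ)) = if m = n then 1 else 0 := by
  rw [inner_toL2 (memLp_oscProd hε a m) (memLp_oscProd hε a n)]
  have h : ∀ r : Fin N → E3, inner ℂ (oscProd ε a m r : ℂ) (oscProd ε a n r : ℂ) =
      ((oscProd ε a m r * oscProd ε a n r : ℝ) : ℂ) := by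
    intro r
    rw [RCLike.inner_apply, Complex.conj_ofReal]
    push_cast
    ring
  simp only [h]
  rw [integral_complex_ofReal, integral_oscProd_mul hε]
  split_ifs <;> simp

/-! ### Tensor products -/

theorem coeFn_tensorRight {X Y : Type} [MeasureSpace X] [MeasureSpace Y]
    [SFinite (volume : Measure X)] [SFinite (volume : Measure Y)] (g : L2 Y) (f : L2 X) :
    tensorRight g f =ᵐ[volume] fun p => f p.1 * g p.2 :=
  (memLp_tensor f g).1.coeFn_toLp

theorem norm_tensorRight {X Y : Type} [MeasureSpace X] [MeasureSpace Y]
    [SFinite (volume : Measure X)] [SFinite (volume : Measure Y)] (g : L2 Y) (f : L2 X) :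
    ‖tensorRight g f‖ = ‖f‖ * ‖g‖ := by
  change ‖(memLp_tensor f g).1.toLp _‖ = _
  rw [Lp.norm_toLp, (memLp_tensor f g).2, ENNReal.toReal_mul, ← Lp.norm_def, ← Lp.norm_def]

theorem inner_tensorRight {X Y : Type} [MeasureSpace X] [MeasureSpace Y]
    [SFinite (volume : Measure X)] [SFinite (volume : Measure Y)] (g₁ g₂ : L2 Y) (f₁ f₂ : L2 X) :
    inner ℂ (tensorRight g₁ f₁) (tensorRight g₂ f₂) = inner ℂ f₁ f₂ * inner ℂ g₁ g₂ := by
  rw [L2.inner_def, L2.inner_def, L2.inner_def, ← integral_prod_mul, ← Measure.volume_eq_prod]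
  refine integral_congr_ae ?_
  filter_upwards [coeFn_tensorRight g₁ f₁, coeFn_tensorRight g₂ f₂] with p h1 h2
  rw [h1, h2]
  simp only [RCLike.inner_apply, map_mul]
  ring

theorem tensorRight_toL2 {X Y : Type} [MeasureSpace X] [MeasureSpace Y]
    [SFinite (volume : Measure X)] [SFinite (volume : Measure Y)] {f : X → ℂ} {g : Y → ℂ}
    (hf : MemLp f 2 (volume : Measure X)) (hg : MemLp g 2 (volume : Measure Y)) :
    tensorRight (toL2 g) (toL2 f) = toL2 fun p : X × Y => f p.1 * g p.2 := by
  refine eq_toL2 ?_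
  have h1 := Measure.quasiMeasurePreserving_fst
    (μ := (volume : Measure X)) (ν := (volume : Measure Y)) |>.ae (coeFn_toL2 hf)
  have h2 := Measure.quasiMeasurePreserving_snd
    (μ := (volume : Measure X)) (ν := (volume : Measure Y)) |>.ae (coeFn_toL2 hg)
  rw [← Measure.volume_eq_prod] at h1 h2
  filter_upwards [coeFn_tensorRight (toL2 g) (toL2 f), h1, h2] with p h3 h4 h5
  rw [h3, h4, h5]

theorem inner_oscEmbed {N : ℕ} {ε : ℝ} (hε : 0 < ε) (a : Fin N → E3) (m n : Fin N → Fin 3 → ℕ)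
    (φ ψ : L2 E3) :
    inner ℂ (oscEmbed ε a m φ) (oscEmbed ε a n ψ) = if m = n then inner ℂ φ ψ else 0 := by
  rw [oscEmbed, oscEmbed, inner_tensorRight, inner_oscProd hε]
  split_ifs <;> simp

theorem adjoint_oscEmbed_oscEmbed {N : ℕ} {ε : ℝ} (hε : 0 < ε) (a : Fin N → E3)
    (m n : Fin N → Fin 3 → ℕ) (ψ : L2 E3) :
    (oscEmbed ε a m).adjoint (oscEmbed ε a n ψ) = if m = n then ψ else 0 := by
  refine ext_inner_left ℂ fun φ => ?_
  rw [ContinuousLinearMap.adjoint_inner_right, inner_oscEmbed hε]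
  split_ifs <;> simp

theorem norm_oscEmbed {N : ℕ} {ε : ℝ} (hε : 0 < ε) (a : Fin N → E3) (n : Fin N → Fin 3 → ℕ)
    (ψ : L2 E3) : ‖oscEmbed ε a n ψ‖ = ‖ψ‖ := by
  have h := inner_oscEmbed hε a n n ψ ψ
  rw [if_pos rfl, inner_self_eq_norm_sq_to_K, inner_self_eq_norm_sq_to_K] at h
  have h2 : ‖oscEmbed ε a n ψ‖ ^ 2 = ‖ψ‖ ^ 2 := by exact_mod_cast h
  exact (sq_eq_sq₀ (norm_nonneg _) (norm_nonneg _)).1 h2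

/-- The embedding `ψ ↦ ψ ⊗ ∏_k φ^ε_{n_k,k}` as a linear isometry. -/
noncomputable def oscIsometry {N : ℕ} {ε : ℝ} (hε : 0 < ε) (a : Fin N → E3)
    (n : Fin N → Fin 3 → ℕ) : L2 E3 →ₗᵢ[ℂ] L2 (Config N) :=
  ⟨(oscEmbed ε a n : L2 E3 →ₗ[ℂ] L2 (Config N)), norm_oscEmbed hε a n⟩

theorem oscIsometry_apply {N : ℕ} {ε : ℝ} (hε : 0 < ε) (a : Fin N → E3)
    (n : Fin N → Fin 3 → ℕ) (ψ : L2 E3) : oscIsometry hε a n ψ = oscEmbed ε a n ψ := rfl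

theorem orthogonalFamily_oscIsometry {N : ℕ} {ε : ℝ} (hε : 0 < ε) (a : Fin N → E3) :
    OrthogonalFamily ℂ (fun _ : Fin N → Fin 3 → ℕ => L2 E3) (oscIsometry hε a) := by
  intro m n hmn φ ψ
  rw [oscIsometry_apply, oscIsometry_apply, inner_oscEmbed hε, if_neg hmn]

/-- Bessel's inequality: for the finite projection `P` of `Ψ` one has `⟨P, Ψ⟩ = ‖P‖²`, and
Cauchy–Schwarz gives `‖P‖ ≤ ‖Ψ‖`. -/
theorem sum_norm_sq_adjoint_oscEmbed_le {N : ℕ} {ε : ℝ} (hε : 0 < ε) (a : Fin N → E3)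
    (Ψ : L2 (Config N)) (S : Finset (Fin N → Fin 3 → ℕ)) :
    ∑ n ∈ S, ‖(oscEmbed ε a n).adjoint Ψ‖ ^ 2 ≤ ‖Ψ‖ ^ 2 := by
  set P := ∑ n ∈ S, oscEmbed ε a n ((oscEmbed ε a n).adjoint Ψ) with hP
  have h1 : ‖P‖ ^ 2 = ∑ n ∈ S, ‖(oscEmbed ε a n).adjoint Ψ‖ ^ 2 :=
    (orthogonalFamily_oscIsometry hε a).norm_sum (fun n => (oscEmbed ε a n).adjoint Ψ) S
  have h2 : inner ℂ P Ψ = ((∑ n ∈ S, ‖(oscEmbed ε a n).adjoint Ψ‖ ^ 2 : ℝ) : ℂ) := by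
    rw [hP, sum_inner]
    push_cast
    refine Finset.sum_congr rfl fun n _ => ?_
    rw [← ContinuousLinearMap.adjoint_inner_right, inner_self_eq_norm_sq_to_K]
    rfl
  have h3 : ‖P‖ ^ 2 ≤ ‖P‖ * ‖Ψ‖ := by
    refine le_trans (le_of_eq ?_) (norm_inner_le_norm (𝕜 := ℂ) P Ψ)
    rw [h2, ← h1, Complex.norm_real, Real.norm_of_nonneg (sq_nonneg _)]
  rw [← h1]
  have h4 : ‖P‖ ≤ ‖Ψ‖ := by
    rcases (norm_nonneg P).eq_or_lt with h | h
    · rw [← h]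
      exact norm_nonneg _
    · exact le_of_mul_le_mul_left (by nlinarith) h
  exact pow_le_pow_left₀ (norm_nonneg _) h4 2

/-! ### The free propagator -/

/-- The component of the free propagator on the oscillator state `n`. -/
noncomputable def propComponent {N : ℕ} (ε : ℝ) (a : Fin N → E3) (t : ℝ)
    (n : Fin N → Fin 3 → ℕ) (Ψ : L2 (Config N)) : L2 E3 :=
  Complex.exp (-Complex.I * ((t / ε ^ 2 * ∑ k, oscEnergy ε (n k) : ℝ) : ℂ)) •
    freeEvol ε t ((oscEmbed ε a n).adjoint Ψ)

theorem norm_propComponent {N : ℕ} (ε : ℝ) (a : Fin N → E3) (t : ℝ)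
    (n : Fin N → Fin 3 → ℕ) (Ψ : L2 (Config N)) :
    ‖propComponent ε a t n Ψ‖ = ‖(oscEmbed ε a n).adjoint Ψ‖ := by
  rw [propComponent, norm_smul, norm_exp_neg_I_mul, one_mul, norm_freeEvol]

theorem freeProp_eq {N : ℕ} (ε : ℝ) (a : Fin N → E3) (t : ℝ) (Ψ : L2 (Config N)) :
    freeProp ε a t Ψ = ∑' n, oscEmbed ε a n (propComponent ε a t n Ψ) := by
  simp only [freeProp, propComponent, map_smul]

theorem summable_freeProp {N : ℕ} {ε : ℝ} (hε : 0 < ε) (a : Fin N → E3) (t : ℝ)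
    (Ψ : L2 (Config N)) : Summable fun n => oscEmbed ε a n (propComponent ε a t n Ψ) := by
  refine ((orthogonalFamily_oscIsometry hε a).summable_iff_norm_sq_summable _).2 ?_
  simp only [norm_propComponent]
  exact summable_of_sum_le (fun _ => sq_nonneg _) (sum_norm_sq_adjoint_oscEmbed_le hε a Ψ)

/-- Only the inequality is needed, so Bessel suffices and completeness of the Hermite functions
plays no role. -/
theorem norm_freeProp_le {N : ℕ} {ε : ℝ} (hε : 0 < ε) (a : Fin N → E3) (t : ℝ)
    (Ψ : L2 (Config N)) : ‖freeProp ε a t Ψ‖ ≤ ‖Ψ‖ := by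
  rw [freeProp_eq]
  refine le_of_tendsto (summable_freeProp hε a t Ψ).hasSum.norm
    (Filter.Eventually.of_forall fun S => ?_)
  refine (sq_le_sq₀ (norm_nonneg _) (norm_nonneg _)).1 ?_
  refine ((orthogonalFamily_oscIsometry hε a).norm_sum
    (fun n => propComponent ε a t n Ψ) S).trans_le ?_
  simp only [norm_propComponent]
  exact sum_norm_sq_adjoint_oscEmbed_le hε a Ψ S

theorem continuous_freeEvol_comp (ε : ℝ) {f : ℝ → ℝ} {g : ℝ → L2 E3} (hf : Continuous f)
    (hg : Continuous g) : Continuous fun s => freeEvol ε (f s) (g s) := by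
  have h := (continuous_freeEvol ε).comp (hf.prodMk hg)
  exact h

theorem continuous_clm_comp {H K : Type*} [NormedAddCommGroup H] [NormedSpace ℂ H]
    [NormedAddCommGroup K] [NormedSpace ℂ K] (A : H →L[ℂ] K) {F : ℝ → H} (hF : Continuous F) :
    Continuous fun s => A (F s) := A.continuous.comp hF

theorem continuous_propComponent_comp {N : ℕ} (ε : ℝ) (a : Fin N → E3)
    (n : Fin N → Fin 3 → ℕ) {τ : ℝ → ℝ} (hτ : Continuous τ) {F : ℝ → L2 (Config N)}
    (hF : Continuous F) : Continuous fun s => propComponent ε a (τ s) n (F s) := by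
  have h1 : Continuous fun s : ℝ =>
      Complex.exp (-Complex.I * ((τ s / ε ^ 2 * ∑ k, oscEnergy ε (n k) : ℝ) : ℂ)) := by
    fun_prop
  have h2 : Continuous fun s : ℝ => (oscEmbed ε a n).adjoint (F s) :=
    continuous_clm_comp _ hF
  have h3 := continuous_freeEvol_comp ε hτ h2
  exact Continuous.smul h1 h3

/-- The propagator is a pointwise limit of its finite partial sums, which are continuous in `s`; the
index set is countable, so strong measurability passes to the limit. -/
theorem stronglyMeasurable_freeProp_comp {N : ℕ} {ε : ℝ} (hε : 0 < ε) (a : Fin N → E3)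
    {τ : ℝ → ℝ} (hτ : Continuous τ) {F : ℝ → L2 (Config N)} (hF : Continuous F) :
    StronglyMeasurable fun s => freeProp ε a (τ s) (F s) := by
  simp only [freeProp_eq]
  refine stronglyMeasurable_of_tendsto (u := Filter.atTop)
    (f := fun (S : Finset (Fin N → Fin 3 → ℕ)) s =>
      ∑ n ∈ S, oscEmbed ε a n (propComponent ε a (τ s) n (F s))) (fun S => ?_) ?_
  · refine Continuous.stronglyMeasurable (continuous_finsetSum _ fun n _ => ?_)
    exact continuous_clm_comp _ (continuous_propComponent_comp ε a n hτ hF)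
  · rw [tendsto_pi_nhds]
    exact fun s => (summable_freeProp hε a (τ s) (F s)).hasSum

theorem freeProp_oscEmbed {N : ℕ} {ε : ℝ} (hε : 0 < ε) (a : Fin N → E3) (t : ℝ)
    (n : Fin N → Fin 3 → ℕ) (ψ : L2 E3) :
    freeProp ε a t (oscEmbed ε a n ψ) =
      Complex.exp (-Complex.I * ((t / ε ^ 2 * ∑ k, oscEnergy ε (n k) : ℝ) : ℂ)) •
        oscEmbed ε a n (freeEvol ε t ψ) := by
  rw [freeProp_eq, tsum_eq_single n, propComponent, adjoint_oscEmbed_oscEmbed hε, if_pos rfl,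
    map_smul]
  intro m hm
  rw [propComponent, adjoint_oscEmbed_oscEmbed hε, if_neg hm, ← freeCLM_apply]
  simp

end SphericalWave

namespace SphericalWave

open scoped FourierTransform

/-! ### Gaussian wave packets -/

/-- `L²` embeds injectively into the tempered distributions, where the Fourier transform is defined
by duality; the multiplication formula for the integrable `f` identifies that distribution with `𝓕
f`. -/
theorem fourierTransform_toL2 {f : E3 → ℂ} (h1 : Integrable f) (h2 : MemLp f 2 volume)
    (h3 : MemLp (𝓕 f) 2 volume) :
    Lp.fourierTransformₗᵢ E3 ℂ (toL2 f) = toL2 (𝓕 f) := by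
  have hinj : Function.Injective (Lp.toTemperedDistributionCLM ℂ (volume : Measure E3) 2) := by
    have := Lp.ker_toTemperedDistributionCLM_eq_bot (F := ℂ) (μ := (volume : Measure E3)) (p := 2)
    exact LinearMap.ker_eq_bot.1 this
  apply hinj
  have h4 := Lp.fourier_toTemperedDistribution_eq (toL2 f)
  change 𝓕 (Lp.toTemperedDistribution (toL2 f)) =
    Lp.toTemperedDistribution (Lp.fourierTransformₗᵢ E3 ℂ (toL2 f)) at h4
  rw [Lp.toTemperedDistributionCLM_apply, Lp.toTemperedDistributionCLM_apply, ← h4]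
  ext u
  rw [TemperedDistribution.fourier_apply, Lp.toTemperedDistribution_apply,
    Lp.toTemperedDistribution_apply]
  have h5 : ∫ x, (𝓕 u : SchwartzMap E3 ℂ) x • toL2 f x = ∫ x, 𝓕 (u : E3 → ℂ) x • f x := by
    refine integral_congr_ae ?_
    filter_upwards [coeFn_toL2 h2] with x hx
    rw [hx, SchwartzMap.fourier_coe]
  have h6 : ∫ x, u x • toL2 (𝓕 f) x = ∫ x, u x • 𝓕 f x := by
    refine integral_congr_ae ?_
    filter_upwards [coeFn_toL2 h3] with x hx
    rw [hx]
  rw [h5, h6]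
  have h7 := VectorFourier.integral_fourierIntegral_smul_eq_flip (L := innerₗ E3)
    Real.continuous_fourierChar continuous_inner u.integrable h1 (μ := volume) (ν := volume)
  simpa using! h7

/-- The Gaussian wave packet `e^{-b|v-y|² + 2π i x·(v-y)}`. -/
noncomputable def wavePacket (b : ℂ) (y x v : E3) : ℂ :=
  Complex.exp (-b * ‖v - y‖ ^ 2 + 2 * Real.pi * Complex.I * (inner ℝ x (v - y) : ℝ))

theorem continuous_wavePacket (b : ℂ) (y x : E3) : Continuous (wavePacket b y x) := by
  unfold wavePacket
  fun_prop

theorem norm_wavePacket (b : ℂ) (y x v : E3) :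
    ‖wavePacket b y x v‖ = Real.exp (-b.re * ‖v - y‖ ^ 2) := by
  rw [wavePacket, Complex.norm_exp]
  congr 1
  have : ((‖v - y‖ : ℂ)) ^ 2 = ((‖v - y‖ ^ 2 : ℝ) : ℂ) := by push_cast; rfl
  rw [this]
  generalize ‖v - y‖ ^ 2 = r
  simp

theorem integrable_exp_neg_mul_sq_norm {b : ℝ} (hb : 0 < b) (y : E3) :
    Integrable fun v : E3 => Real.exp (-b * ‖v - y‖ ^ 2) := by
  have h := (GaussianFourier.integrable_cexp_neg_mul_sq_norm_add (V := E3) (b := b)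
    (by simpa using hb) 0 0).norm
  refine (h.comp_sub_right y).congr (Filter.Eventually.of_forall fun v => ?_)
  simp only [Complex.norm_exp]
  congr 1
  have : ((‖v - y‖ : ℂ)) ^ 2 = ((‖v - y‖ ^ 2 : ℝ) : ℂ) := by push_cast; rfl
  rw [this]
  generalize ‖v - y‖ ^ 2 = r
  simp

theorem integrable_wavePacket {b : ℂ} (hb : 0 < b.re) (y x : E3) :
    Integrable (wavePacket b y x) := by
  refine (integrable_exp_neg_mul_sq_norm hb y).mono'
    (continuous_wavePacket b y x).aestronglyMeasurable (Filter.Eventually.of_forall fun v => ?_)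
  rw [norm_wavePacket]

theorem memLp_of_norm_le_exp {f : E3 → ℂ} (hf : Continuous f) {b C : ℝ} (hb : 0 < b) (y : E3)
    (h : ∀ v, ‖f v‖ ≤ C * Real.exp (-b * ‖v - y‖ ^ 2)) : MemLp f 2 volume := by
  rw [memLp_two_iff_integrable_sq_norm hf.aestronglyMeasurable]
  refine ((integrable_exp_neg_mul_sq_norm (b := 2 * b) (by positivity) y).const_mul
    (C ^ 2)).mono' (by fun_prop) (Filter.Eventually.of_forall fun v => ?_)
  rw [Real.norm_of_nonneg (by positivity)]
  refine (pow_le_pow_left₀ (norm_nonneg _) (h v) 2).trans (le_of_eq ?_)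
  rw [mul_pow, ← Real.exp_nat_mul]
  congr 2
  push_cast
  ring

theorem memLp_wavePacket {b : ℂ} (hb : 0 < b.re) (y x : E3) :
    MemLp (wavePacket b y x) 2 volume :=
  memLp_of_norm_le_exp (C := 1) (continuous_wavePacket b y x) hb y fun v => by
    rw [norm_wavePacket, one_mul]

theorem fourier_wavePacket_zero {b : ℂ} (hb : 0 < b.re) (x w : E3) :
    𝓕 (wavePacket b 0 x) w =
      (Real.pi / b) ^ ((3 / 2 : ℝ) : ℂ) * Complex.exp (-Real.pi ^ 2 * ‖x - w‖ ^ 2 / b) := by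
  have h := fourier_gaussian_innerProductSpace' hb x w
  simp only [finrank_euclideanSpace, Fintype.card_fin] at h
  unfold wavePacket
  simp only [sub_zero]
  rw [h]
  congr 2
  push_cast
  rfl

theorem fourier_wavePacket {b : ℂ} (hb : 0 < b.re) (y x w : E3) :
    𝓕 (wavePacket b y x) w = Complex.exp (-2 * Real.pi * Complex.I * (inner ℝ y w : ℝ)) *
      ((Real.pi / b) ^ ((3 / 2 : ℝ) : ℂ) * Complex.exp (-Real.pi ^ 2 * ‖x - w‖ ^ 2 / b)) := by
  rw [← fourier_wavePacket_zero hb]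
  have h : wavePacket b y x = fun v => wavePacket b 0 x (v - y) := by
    ext v
    simp [wavePacket]
  rw [h, Real.fourier_eq', Real.fourier_eq']
  -- Shifting the variable by `y` turns the translation of the packet into a phase.
  rw [← integral_add_right_eq_self _ y, ← integral_const_mul]
  congr 1
  ext v
  rw [add_sub_cancel_right, smul_eq_mul, smul_eq_mul, ← mul_assoc, ← Complex.exp_add, inner_add_left]
  congr 2
  push_cast
  ring

theorem continuous_fourier_wavePacket {b : ℂ} (hb : 0 < b.re) (y x : E3) :
    Continuous (𝓕 (wavePacket b y x)) := by
  have h := fun w => fourier_wavePacket hb y x w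
  rw [funext h]
  fun_prop

theorem memLp_fourier_wavePacket {b : ℂ} (hb : 0 < b.re) (y x : E3) :
    MemLp (𝓕 (wavePacket b y x)) 2 volume := by
  have hb0 : b ≠ 0 := fun h => by simp [h] at hb
  have hinv : 0 < (b⁻¹).re := by
    rw [Complex.inv_re]
    exact div_pos hb (Complex.normSq_pos.2 hb0)
  refine memLp_of_norm_le_exp (C := ‖(Real.pi / b : ℂ) ^ ((3 / 2 : ℝ) : ℂ)‖)
    (b := Real.pi ^ 2 * (b⁻¹).re) (continuous_fourier_wavePacket hb y x) (by positivity) x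
    fun w => le_of_eq ?_
  rw [fourier_wavePacket hb, norm_mul, norm_mul, Complex.norm_exp, Complex.norm_exp]
  have h1 : (-2 * Real.pi * Complex.I * ((inner ℝ y w : ℝ) : ℂ)).re = 0 := by simp
  have h2 : (-Real.pi ^ 2 * ‖x - w‖ ^ 2 / b : ℂ) =
      ((-(Real.pi ^ 2 * ‖w - x‖ ^ 2) : ℝ) : ℂ) * b⁻¹ := by
    rw [norm_sub_rev]
    push_cast
    ring
  rw [h1, h2, Complex.re_ofReal_mul, Real.exp_zero, one_mul]
  congr 2
  ring

theorem fourierTransform_wavePacket {b : ℂ} (hb : 0 < b.re) (y x : E3) :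
    Lp.fourierTransformₗᵢ E3 ℂ (toL2 (wavePacket b y x)) = toL2 (𝓕 (wavePacket b y x)) :=
  fourierTransform_toL2 (integrable_wavePacket hb y x) (memLp_wavePacket hb y x)
    (memLp_fourier_wavePacket hb y x)

theorem toL2_const_mul {X : Type} [MeasureSpace X] {f : X → ℂ}
    (hf : MemLp f 2 (volume : Measure X)) (c : ℂ) :
    toL2 (fun x => c * f x) = c • toL2 f := by
  refine (eq_toL2 ?_).symm
  filter_upwards [Lp.coeFn_smul c (toL2 f), coeFn_toL2 hf] with x h1 h2
  rw [h1, Pi.smul_apply, h2, smul_eq_mul]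

/-- The complex width of a freely evolved Gaussian. -/
noncomputable def evolvedWidth (ε s : ℝ) : ℂ := (2 * ε ^ 2 * (1 + Complex.I * s))⁻¹

theorem evolvedWidth_re (ε s : ℝ) : (evolvedWidth ε s).re = (2 * ε ^ 2 * (1 + s ^ 2))⁻¹ := by
  have h : (evolvedWidth ε s) = ((2 * ε ^ 2 : ℝ) : ℂ)⁻¹ * (1 + Complex.I * s)⁻¹ := by
    rw [evolvedWidth, mul_inv]
    push_cast
    rfl
  rw [h, ← Complex.ofReal_inv, Complex.re_ofReal_mul, Complex.inv_re, mul_inv]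
  simp only [Complex.normSq_apply, Complex.add_re, Complex.add_im, Complex.mul_re, Complex.mul_im,
    Complex.one_re, Complex.one_im, Complex.I_re, Complex.I_im, Complex.ofReal_re,
    Complex.ofReal_im]
  ring_nf
  rw [show ε ^ 2 * 2 + ε ^ 2 * s ^ 2 * 2 = ε ^ 2 * (1 + s ^ 2) * 2 by ring, mul_inv, mul_inv]
  ring

theorem evolvedWidth_re_pos {ε : ℝ} (hε : 0 < ε) (s : ℝ) : 0 < (evolvedWidth ε s).re := by
  rw [evolvedWidth_re]
  positivity

/-- Substitute `|w|² = |x-w|² + 2 x·w - |x|²` in the free phase: the first term replaces the factor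
`ε²` of the width by `ε²(1+is)`, the second translates the packet by `2πε²s x`, and the third is a
constant phase. -/
theorem freePhase_mul_exp (ε s : ℝ) (x w : E3) :
    freePhase ε s w * Complex.exp (-Real.pi ^ 2 * ‖x - w‖ ^ 2 / evolvedWidth ε 0) =
      Complex.exp (Complex.I * (2 * Real.pi ^ 2 * ε ^ 2 * s * ‖x‖ ^ 2)) *
      (Complex.exp (-2 * Real.pi * Complex.I *
        (inner ℝ ((2 * Real.pi * ε ^ 2 * s) • x) w : ℝ)) *
        Complex.exp (-Real.pi ^ 2 * ‖x - w‖ ^ 2 / evolvedWidth ε s)) := by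
  have h : ‖x - w‖ ^ 2 = ‖x‖ ^ 2 - 2 * inner ℝ x w + ‖w‖ ^ 2 := norm_sub_sq_real x w
  have h' : (‖x - w‖ : ℂ) ^ 2 = (‖x‖ : ℂ) ^ 2 - 2 * ((inner ℝ x w : ℝ) : ℂ) + (‖w‖ : ℂ) ^ 2 := by
    exact_mod_cast congrArg (fun r : ℝ => (r : ℂ)) h
  rw [freePhase, ← Complex.exp_add, ← Complex.exp_add, ← Complex.exp_add, evolvedWidth,
    evolvedWidth, div_inv_eq_mul, div_inv_eq_mul, h', real_inner_smul_left]
  congr 1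
  push_cast
  ring

theorem freeEvol_wavePacket {ε : ℝ} (hε : 0 < ε) (s : ℝ) (x : E3) :
    ∃ κ : ℂ, ‖κ‖ ≤ 1 ∧ freeEvol ε s (toL2 (wavePacket (evolvedWidth ε 0) 0 x)) =
      κ • toL2 (wavePacket (evolvedWidth ε s) ((2 * Real.pi * ε ^ 2 * s) • x) x) := by
  set y : E3 := (2 * Real.pi * ε ^ 2 * s) • x with hy
  set c₀ : ℂ := (Real.pi / evolvedWidth ε 0 : ℂ) ^ ((3 / 2 : ℝ) : ℂ) with hc₀
  set c₁ : ℂ := (Real.pi / evolvedWidth ε s : ℂ) ^ ((3 / 2 : ℝ) : ℂ) with hc₁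
  have hz₁ : (Real.pi / evolvedWidth ε s : ℂ) =
      ((2 * Real.pi * ε ^ 2 : ℝ) : ℂ) * (1 + Complex.I * s) := by
    rw [evolvedWidth, div_inv_eq_mul]
    push_cast
    ring
  have hz₀ : (Real.pi / evolvedWidth ε 0 : ℂ) = ((2 * Real.pi * ε ^ 2 : ℝ) : ℂ) := by
    rw [evolvedWidth, div_inv_eq_mul]
    push_cast
    ring
  have hpos : 0 < 2 * Real.pi * ε ^ 2 := by positivity
  -- The Gaussian prefactors after and before the evolution differ by a power of `|1+is| ≥ 1`, so
  -- spreading can only lower the amplitude.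
  have hle : ‖c₀‖ ≤ ‖c₁‖ := by
    rw [hc₀, hc₁, Complex.norm_cpow_real, Complex.norm_cpow_real, hz₀, hz₁, norm_mul]
    refine Real.rpow_le_rpow (norm_nonneg _) ?_ (by norm_num)
    refine le_mul_of_one_le_right (norm_nonneg _) ?_
    have := Complex.abs_re_le_norm (1 + Complex.I * s)
    simpa using this
  have hc₀pos : 0 < ‖c₀‖ := by
    rw [hc₀, Complex.norm_cpow_real, hz₀]
    exact Real.rpow_pos_of_pos (norm_pos_iff.2 (by exact_mod_cast hpos.ne')) _
  have hc₁ne : c₁ ≠ 0 := norm_pos_iff.1 (hc₀pos.trans_le hle)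
  set θ : ℂ := Complex.exp (Complex.I * (2 * Real.pi ^ 2 * ε ^ 2 * s * ‖x‖ ^ 2)) with hθ
  have hθ1 : ‖θ‖ = 1 := by
    rw [hθ, show Complex.I * (2 * Real.pi ^ 2 * ε ^ 2 * s * ‖x‖ ^ 2 : ℂ) =
      -Complex.I * ((-(2 * Real.pi ^ 2 * ε ^ 2 * s * ‖x‖ ^ 2) : ℝ) : ℂ) by push_cast; ring]
    exact norm_exp_neg_I_mul _
  refine ⟨θ * c₀ / c₁, ?_, ?_⟩
  · rw [norm_div, norm_mul, hθ1, one_mul]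
    exact div_le_one_of_le₀ hle (norm_nonneg _)
  · have h0 := evolvedWidth_re_pos hε 0
    have hs := evolvedWidth_re_pos hε s
    rw [freeEvol_eq, LinearIsometryEquiv.symm_apply_eq, fourierTransform_wavePacket h0, map_smul,
      fourierTransform_wavePacket hs, ← toL2_const_mul (memLp_fourier_wavePacket hs y x)]
    refine eq_toL2 ?_
    filter_upwards [coeFn_mulL2 (continuous_freePhase_right ε s).aestronglyMeasurable
      (fun p => (norm_freePhase ε s p).le) (toL2 (𝓕 (wavePacket (evolvedWidth ε 0) 0 x))),
      coeFn_toL2 (memLp_fourier_wavePacket h0 0 x)] with w h1 h2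
    rw [h1, h2, fourier_wavePacket_zero h0, fourier_wavePacket hs, ← hc₀, ← hc₁,
      mul_left_comm, freePhase_mul_exp, ← hθ, ← hy]
    field_simp

end SphericalWave

namespace SphericalWave

open scoped FourierTransform

/-! ### The spherical wave as a superposition of wave packets -/

/-- The frequency of the plane wave in the direction `u`. -/
noncomputable def waveFreq (v₀ ε : ℝ) (u : S2) : E3 := (v₀ / (2 * Real.pi * ε ^ 2)) • (u : E3)

/-- The Gaussian wave packet travelling in the direction `u`. -/
noncomputable def dirPacket (v₀ ε : ℝ) (u : S2) : E3 → ℂ :=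
  wavePacket (evolvedWidth ε 0) 0 (waveFreq v₀ ε u)

/-- The amplitude of the spherical wave. -/
noncomputable def waveAmp (ε : ℝ) : ℝ := ε ^ (-(5 / 2) : ℝ) * Real.pi ^ (-(3 / 4) : ℝ)

/-- The surface measure on the sphere. -/
noncomputable abbrev sphereMeasure : Measure S2 := (volume : Measure E3).toSphere

theorem continuous_waveFreq (v₀ ε : ℝ) : Continuous (waveFreq v₀ ε) := by
  unfold waveFreq
  fun_prop

theorem continuous_dirPacket (v₀ ε : ℝ) :
    Continuous fun q : S2 × E3 => dirPacket v₀ ε q.1 q.2 := by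
  unfold dirPacket wavePacket
  have := continuous_waveFreq v₀ ε
  fun_prop

theorem norm_dirPacket (v₀ ε : ℝ) (u : S2) (R : E3) :
    ‖dirPacket v₀ ε u R‖ = Real.exp (-(evolvedWidth ε 0).re * ‖R - 0‖ ^ 2) :=
  norm_wavePacket _ _ _ _

theorem memLp_dirPacket (v₀ : ℝ) {ε : ℝ} (hε : 0 < ε) (u : S2) :
    MemLp (dirPacket v₀ ε u) 2 volume :=
  memLp_wavePacket (evolvedWidth_re_pos hε 0) _ _

/-- A packet is one fixed Gaussian times a plane wave depending continuously on `u`. This makes the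
`L²`-valued integral over the sphere meaningful. -/
theorem continuous_toL2_dirPacket (v₀ : ℝ) {ε : ℝ} (hε : 0 < ε) :
    Continuous fun u => toL2 (dirPacket v₀ ε u) := by
  set m : S2 → E3 → ℂ := fun u R =>
    Complex.exp (-Complex.I * ((-(2 * Real.pi * inner ℝ (waveFreq v₀ ε u) R) : ℝ) : ℂ)) with hm
  have hw := continuous_waveFreq v₀ ε
  have hmc : ∀ u, Continuous (m u) := fun u => by
    simp only [hm]
    fun_prop
  have h := continuous_mulL2 (m := m) (fun u => (hmc u).aestronglyMeasurable)
    (fun u R => (norm_exp_neg_I_mul _).le) (fun R => by simp only [hm]; fun_prop)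
    (toL2 (wavePacket (evolvedWidth ε 0) 0 0))
  refine h.congr fun u => eq_toL2 ?_
  filter_upwards [coeFn_mulL2 (hmc u).aestronglyMeasurable
    (fun R => (norm_exp_neg_I_mul _).le) (toL2 (wavePacket (evolvedWidth ε 0) 0 0)),
    coeFn_toL2 (memLp_wavePacket (evolvedWidth_re_pos hε 0) 0 0)] with R h1 h2
  rw [h1, h2]
  simp only [hm, dirPacket, wavePacket, ← Complex.exp_add, sub_zero, inner_zero_left]
  congr 1
  push_cast
  ring

theorem norm_toL2_dirPacket (v₀ : ℝ) {ε : ℝ} (hε : 0 < ε) (u : S2) :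
    ‖toL2 (dirPacket v₀ ε u)‖ ≤ ‖toL2 (wavePacket (evolvedWidth ε 0) 0 0)‖ := by
  refine Lp.norm_le_norm_of_ae_le ?_
  filter_upwards [coeFn_toL2 (memLp_dirPacket v₀ hε u),
    coeFn_toL2 (memLp_wavePacket (evolvedWidth_re_pos hε 0) 0 0)] with R h1 h2
  rw [h1, h2, norm_dirPacket, norm_wavePacket]

theorem integrable_toL2_dirPacket (v₀ : ℝ) {ε : ℝ} (hε : 0 < ε) (ν : Measure S2)
    [IsFiniteMeasure ν] : Integrable (fun u => toL2 (dirPacket v₀ ε u)) ν :=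
  Integrable.of_bound (continuous_toL2_dirPacket v₀ hε).aestronglyMeasurable _
    (Filter.Eventually.of_forall fun u => norm_toL2_dirPacket v₀ hε u)

theorem continuous_integral_dirPacket (v₀ : ℝ) {ε : ℝ} (hε : 0 < ε) (ν : Measure S2)
    [IsFiniteMeasure ν] : Continuous fun R => ∫ u, dirPacket v₀ ε u R ∂ν := by
  refine continuous_of_dominated (bound := fun _ => 1) (fun R => ?_) (fun R => ?_)
    (integrable_const 1) ?_
  · have h := (continuous_dirPacket v₀ ε).comp
      (Continuous.prodMk_left R : Continuous fun u : S2 => (u, R))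
    exact h.aestronglyMeasurable
  · filter_upwards with u
    rw [norm_dirPacket]
    refine Real.exp_le_one_iff.2 ?_
    have := (evolvedWidth_re_pos hε 0).le
    have := mul_nonneg this (sq_nonneg ‖R - 0‖)
    linarith
  · filter_upwards with u
    exact continuous_wavePacket _ _ _

theorem memLp_integral_dirPacket (v₀ : ℝ) {ε : ℝ} (hε : 0 < ε) (ν : Measure S2)
    [IsFiniteMeasure ν] : MemLp (fun R => ∫ u, dirPacket v₀ ε u R ∂ν) 2 volume := by
  refine memLp_of_norm_le_exp (C := ν.real Set.univ) (b := (evolvedWidth ε 0).re)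
    (continuous_integral_dirPacket v₀ hε ν) (evolvedWidth_re_pos hε 0) 0 fun R => ?_
  rw [mul_comm]
  exact norm_integral_le_of_norm_le_const
    (Filter.Eventually.of_forall fun u => (norm_dirPacket v₀ ε u R).le)

/-- Tested against an arbitrary `h`, this is Fubini. It turns the pointwise superposition into a
Bochner integral, through which norms and bounded operators pass. -/
theorem toL2_integral_dirPacket (v₀ : ℝ) {ε : ℝ} (hε : 0 < ε) (ν : Measure S2)
    [IsFiniteMeasure ν] :
    toL2 (fun R => ∫ u, dirPacket v₀ ε u R ∂ν) = ∫ u, toL2 (dirPacket v₀ ε u) ∂ν := by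
  refine ext_inner_left ℂ fun h => ?_
  rw [← integral_inner (integrable_toL2_dirPacket v₀ hε ν)]
  have h1 : ∀ u, inner ℂ h (toL2 (dirPacket v₀ ε u)) =
      ∫ R, (starRingEnd ℂ) (h R) * dirPacket v₀ ε u R := by
    intro u
    rw [L2.inner_def]
    refine integral_congr_ae ?_
    filter_upwards [coeFn_toL2 (memLp_dirPacket v₀ hε u)] with R hR
    rw [hR, RCLike.inner_apply, mul_comm]
  simp only [h1]
  rw [L2.inner_def, integral_integral_swap]
  · refine integral_congr_ae ?_
    filter_upwards [coeFn_toL2 (memLp_integral_dirPacket v₀ hε ν)] with R hR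
    rw [hR, RCLike.inner_apply, integral_const_mul, mul_comm]
  · have h2 : Integrable fun R : E3 =>
        ‖h R‖ * Real.exp (-(evolvedWidth ε 0).re * ‖R - 0‖ ^ 2) := by
      have hm := memLp_wavePacket (evolvedWidth_re_pos hε 0) 0 0
      refine ((Lp.memLp h).norm.integrable_mul hm.norm).congr
        (Filter.Eventually.of_forall fun R => ?_)
      simp only [Pi.mul_apply, norm_wavePacket]
    have h3 : AEStronglyMeasurable (fun R => (starRingEnd ℂ) (h R)) (volume : Measure E3) :=
      Complex.continuous_conj.comp_aestronglyMeasurable (Lp.aestronglyMeasurable h)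
    refine (h2.comp_snd ν).mono'
      (h3.comp_snd.mul (continuous_dirPacket v₀ ε).aestronglyMeasurable) ?_
    filter_upwards with q
    simp only [Function.uncurry, norm_mul, norm_dirPacket, RCLike.norm_conj, le_refl]

theorem rawWave_eq (v₀ : ℝ) {ε : ℝ} (hε : 0 < ε) (A : Set S2) (R : E3) :
    rawWave v₀ ε A R = waveAmp ε * ∫ u in A, dirPacket v₀ ε u R ∂sphereMeasure := by
  have h : ∀ u : S2, dirPacket v₀ ε u R = (Real.exp (-‖ε⁻¹ • R‖ ^ 2 / 2) : ℂ) *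
      Complex.exp (Complex.I * ((v₀ / ε ^ 2 * inner ℝ (u : E3) R : ℝ) : ℂ)) := by
    intro u
    have hε' : (ε : ℂ) ≠ 0 := by exact_mod_cast hε.ne'
    have hπ : (Real.pi : ℂ) ≠ 0 := by exact_mod_cast Real.pi_ne_zero
    rw [dirPacket, wavePacket, waveFreq, evolvedWidth, sub_zero, Complex.ofReal_exp,
      ← Complex.exp_add, real_inner_smul_left, norm_smul, norm_inv, Real.norm_of_nonneg hε.le]
    congr 1
    push_cast
    field_simp
    ring
  simp only [h]
  rw [integral_const_mul, rawWave, waveAmp, gaussian]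
  push_cast
  ring

theorem toL2_rawWave (v₀ : ℝ) {ε : ℝ} (hε : 0 < ε) (A : Set S2) :
    toL2 (rawWave v₀ ε A) =
      (waveAmp ε : ℂ) • ∫ u in A, toL2 (dirPacket v₀ ε u) ∂sphereMeasure := by
  rw [funext (rawWave_eq v₀ hε A), toL2_const_mul (memLp_integral_dirPacket v₀ hε _),
    toL2_integral_dirPacket v₀ hε]

theorem memLp_rawWave (v₀ : ℝ) {ε : ℝ} (hε : 0 < ε) (A : Set S2) :
    MemLp (rawWave v₀ ε A) 2 volume := by
  rw [funext (rawWave_eq v₀ hε A)]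
  exact (memLp_integral_dirPacket v₀ hε _).const_mul _

theorem waveAmp_pos {ε : ℝ} (hε : 0 < ε) : 0 < waveAmp ε := by
  unfold waveAmp
  positivity

theorem normConst_mul_waveAmp (v₀ : ℝ) {ε : ℝ} (hε : 0 < ε) :
    normConst v₀ ε * waveAmp ε = ‖∫ u, toL2 (dirPacket v₀ ε u) ∂sphereMeasure‖⁻¹ := by
  have h : normConst v₀ ε = ‖toL2 (rawWave v₀ ε Set.univ)‖⁻¹ := by
    rw [normConst, ← norm_sq_toL2 (memLp_rawWave v₀ hε _), Real.sqrt_sq (norm_nonneg _)]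
  have hA := waveAmp_pos hε
  rw [h, toL2_rawWave v₀ hε, norm_smul, Measure.restrict_univ, Complex.norm_real,
    Real.norm_of_nonneg hA.le]
  field_simp

/-! ### The normalization constant -/

/-- A spherical shell. -/
def shell (ρ δ : ℝ) : Set E3 := Metric.ball 0 (ρ + δ) \ Metric.closedBall 0 (ρ - δ)

theorem measurableSet_shell (ρ δ : ℝ) : MeasurableSet (shell ρ δ) :=
  measurableSet_ball.diff measurableSet_closedBall

theorem ball_subset_shell {x : E3} {ρ δ : ℝ} (hx : ‖x‖ = ρ) : Metric.ball x δ ⊆ shell ρ δ := by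
  intro w hw
  rw [mem_ball_iff_norm] at hw
  have h1 := norm_sub_norm_le w x
  have h2 := norm_sub_norm_le x w
  rw [norm_sub_rev] at h2
  simp only [shell, Set.mem_sdiff, Metric.mem_ball, dist_zero_right, Metric.mem_closedBall, not_le]
  constructor <;> linarith

theorem volume_shell_ne_top (ρ δ : ℝ) : volume (shell ρ δ) ≠ ⊤ :=
  ((measure_mono Set.sdiff_subset).trans_lt measure_ball_lt_top).ne

theorem volume_real_ball {r : ℝ} (hr : 0 ≤ r) (x : E3) :
    volume.real (Metric.ball x r) = r ^ 3 * volume.real (Metric.ball (0 : E3) 1) := by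
  rw [Measure.real, Measure.addHaar_ball _ _ hr, ENNReal.toReal_mul, finrank_euclideanSpace,
    Fintype.card_fin, ENNReal.toReal_ofReal (by positivity), Measure.real]

/-- For `δ ≤ ρ` this is `(ρ+δ)³ - (ρ-δ)³ = 6ρ²δ + 2δ³`; for `δ ≥ ρ` the inner ball is at most a
point, and the outer one has `(ρ+δ)³ ≤ 8δ³`. -/
theorem volume_shell_le {ρ δ : ℝ} (hρ : 0 ≤ ρ) (hδ : 0 ≤ δ) :
    volume.real (shell ρ δ) ≤
      (6 * ρ ^ 2 * δ + 8 * δ ^ 3) * volume.real (Metric.ball (0 : E3) 1) := by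
  have hκ : 0 ≤ volume.real (Metric.ball (0 : E3) 1) := measureReal_nonneg
  rcases le_total δ ρ with h | h
  · have h1 : volume.real (shell ρ δ) ≤ volume.real (Metric.ball (0 : E3) (ρ + δ)) -
        volume.real (Metric.ball (0 : E3) (ρ - δ)) := by
      rw [← measureReal_sdiff (Metric.ball_subset_ball (by linarith)) measurableSet_ball
        measure_ball_lt_top.ne]
      exact measureReal_mono (Set.sdiff_subset_sdiff_right Metric.ball_subset_closedBall)
        ((measure_mono Set.sdiff_subset).trans_lt measure_ball_lt_top).ne
    rw [volume_real_ball (by linarith : 0 ≤ ρ + δ), volume_real_ball (by linarith : 0 ≤ ρ - δ),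
      ← sub_mul] at h1
    refine h1.trans (mul_le_mul_of_nonneg_right ?_ hκ)
    have : 0 ≤ δ ^ 3 := by positivity
    nlinarith
  · have h1 : volume.real (shell ρ δ) ≤ volume.real (Metric.ball (0 : E3) (ρ + δ)) :=
      measureReal_mono Set.sdiff_subset measure_ball_lt_top.ne
    rw [volume_real_ball (by linarith)] at h1
    refine h1.trans (mul_le_mul_of_nonneg_right ?_ hκ)
    have h2 : (ρ + δ) ^ 3 ≤ (2 * δ) ^ 3 := pow_le_pow_left₀ (by linarith) (by linarith) 3
    have h3 : 0 ≤ ρ ^ 2 * δ := by positivity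
    nlinarith

/-- The Fourier transform of a wave packet is a positive Gaussian. -/
noncomputable def dirGauss (v₀ ε : ℝ) (u : S2) (w : E3) : ℝ :=
  (2 * Real.pi * ε ^ 2) ^ (3 / 2 : ℝ) *
    Real.exp (-(2 * Real.pi ^ 2 * ε ^ 2) * ‖w - waveFreq v₀ ε u‖ ^ 2)

theorem fourier_dirPacket (v₀ : ℝ) {ε : ℝ} (hε : 0 < ε) (u : S2) (w : E3) :
    𝓕 (dirPacket v₀ ε u) w = (dirGauss v₀ ε u w : ℂ) := by
  rw [dirPacket, fourier_wavePacket_zero (evolvedWidth_re_pos hε 0), evolvedWidth, div_inv_eq_mul,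
    div_inv_eq_mul, dirGauss, Complex.ofReal_mul, Complex.ofReal_exp,
    Complex.ofReal_cpow (by positivity), norm_sub_rev]
  congr 2
  · push_cast
    ring
  · push_cast
    ring

theorem integrable_dirGauss (v₀ : ℝ) {ε : ℝ} (hε : 0 < ε) (u : S2) :
    Integrable (dirGauss v₀ ε u) :=
  (integrable_exp_neg_mul_sq_norm (by positivity) _).const_mul _

theorem dirGauss_nonneg (v₀ : ℝ) {ε : ℝ} (hε : 0 < ε) (u : S2) (w : E3) :
    0 ≤ dirGauss v₀ ε u w := by
  unfold dirGauss
  positivity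

/-- A lower bound for the mass of `dirGauss` near its centre. -/
noncomputable def coreMass : ℝ :=
  (2 * Real.pi) ^ (3 / 2 : ℝ) * Real.exp (-(2 * Real.pi ^ 2)) *
    volume.real (Metric.ball (0 : E3) 1)

theorem volume_real_unitBall_pos : 0 < volume.real (Metric.ball (0 : E3) 1) :=
  ENNReal.toReal_pos (Metric.measure_ball_pos _ _ one_pos).ne' measure_ball_lt_top.ne

theorem coreMass_pos : 0 < coreMass := by
  have := volume_real_unitBall_pos
  unfold coreMass
  positivity

theorem norm_waveFreq {v₀ ε : ℝ} (hv₀ : 0 < v₀) (hε : 0 < ε) (u : S2) :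
    ‖waveFreq v₀ ε u‖ = v₀ / (2 * Real.pi * ε ^ 2) := by
  rw [waveFreq, norm_smul, norm_eq_of_mem_sphere, mul_one, Real.norm_of_nonneg (by positivity)]

/-- Within `ε⁻¹` of its centre the Gaussian exceeds `e^{-2π²}` times its peak `(2πε²)^{3/2}`; the
peak's `ε³` cancels the `ε^{-3}` in the volume of the ball. -/
theorem coreMass_le_setIntegral {v₀ ε : ℝ} (hv₀ : 0 < v₀) (hε : 0 < ε) (u : S2) :
    coreMass ≤ ∫ w in shell (v₀ / (2 * Real.pi * ε ^ 2)) ε⁻¹, dirGauss v₀ ε u w := by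
  have hε1 : 0 < ε⁻¹ := inv_pos.2 hε
  have h1 : ∫ w in Metric.ball (waveFreq v₀ ε u) ε⁻¹, dirGauss v₀ ε u w ≤
      ∫ w in shell (v₀ / (2 * Real.pi * ε ^ 2)) ε⁻¹, dirGauss v₀ ε u w :=
    setIntegral_mono_set (integrable_dirGauss v₀ hε u).integrableOn
      (Filter.Eventually.of_forall fun w => dirGauss_nonneg v₀ hε u w)
      (ball_subset_shell (norm_waveFreq hv₀ hε u)).eventuallyLE
  refine le_trans ?_ h1
  have h2 : ∀ w ∈ Metric.ball (waveFreq v₀ ε u) ε⁻¹,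
      (2 * Real.pi * ε ^ 2) ^ (3 / 2 : ℝ) * Real.exp (-(2 * Real.pi ^ 2)) ≤
        dirGauss v₀ ε u w := by
    intro w hw
    rw [mem_ball_iff_norm] at hw
    refine mul_le_mul_of_nonneg_left (Real.exp_le_exp.2 ?_) (by positivity)
    have h3 : ε * ‖w - waveFreq v₀ ε u‖ ≤ 1 := by
      rw [← mul_inv_cancel₀ hε.ne']
      exact mul_le_mul_of_nonneg_left hw.le hε.le
    have h4 : (ε * ‖w - waveFreq v₀ ε u‖) ^ 2 ≤ 1 :=
      pow_le_one₀ (by positivity) h3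
    have h5 := mul_le_mul_of_nonneg_left h4 (show 0 ≤ 2 * Real.pi ^ 2 by positivity)
    nlinarith
  have h6 := setIntegral_mono_on (μ := (volume : Measure E3))
    (integrableOn_const measure_ball_lt_top.ne) (integrable_dirGauss v₀ hε u).integrableOn
    measurableSet_ball h2
  refine le_trans (le_of_eq ?_) h6
  rw [setIntegral_const, volume_real_ball hε1.le, smul_eq_mul, coreMass,
    Real.mul_rpow (x := 2 * Real.pi) (by positivity) (by positivity), ← Real.rpow_natCast ε 2, ← Real.rpow_mul hε.le,
    show ((2 : ℕ) : ℝ) * (3 / 2) = ((3 : ℕ) : ℝ) by norm_num, Real.rpow_natCast]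
  field_simp

/-- Pair the wave with the indicator of the shell in Fourier space. The transforms of the packets
are all positive, so their contributions add without cancellation, and Cauchy–Schwarz turns the
total mass into a lower bound for the norm. -/
theorem le_norm_integral_dirPacket {v₀ ε : ℝ} (hv₀ : 0 < v₀) (hε : 0 < ε) :
    sphereMeasure.real Set.univ * coreMass ≤
      √(volume.real (shell (v₀ / (2 * Real.pi * ε ^ 2)) ε⁻¹)) *
        ‖∫ u, toL2 (dirPacket v₀ ε u) ∂sphereMeasure‖ := by
  set S := shell (v₀ / (2 * Real.pi * ε ^ 2)) ε⁻¹ with hS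
  set h : L2 E3 := indicatorConstLp 2 (measurableSet_shell _ _ : MeasurableSet S)
    (volume_shell_ne_top _ _) (1 : ℂ) with hh
  set W := ∫ u, toL2 (dirPacket v₀ ε u) ∂sphereMeasure with hW
  set ℱ := Lp.fourierTransformₗᵢ E3 ℂ with hℱ
  have h1 : inner ℂ h (ℱ W) =
      ((∫ u, (∫ w in S, dirGauss v₀ ε u w) ∂sphereMeasure : ℝ) : ℂ) := by
    have h2 : ℱ W = ∫ u, ℱ (toL2 (dirPacket v₀ ε u)) ∂sphereMeasure :=
      (ContinuousLinearMap.integral_comp_comm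
        (ℱ.toContinuousLinearEquiv : L2 E3 →L[ℂ] L2 E3)
        (integrable_toL2_dirPacket v₀ hε sphereMeasure)).symm
    have h3 : Integrable (fun u => ℱ (toL2 (dirPacket v₀ ε u))) sphereMeasure :=
      ContinuousLinearMap.integrable_comp (ℱ.toContinuousLinearEquiv : L2 E3 →L[ℂ] L2 E3)
        (integrable_toL2_dirPacket v₀ hε sphereMeasure)
    rw [h2, ← integral_inner h3, ← integral_complex_ofReal]
    refine integral_congr_ae (Filter.Eventually.of_forall fun u => ?_)
    simp only
    rw [L2.inner_indicatorConstLp_one, ← integral_complex_ofReal]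
    refine integral_congr_ae (ae_restrict_of_ae ?_)
    have h4 : ℱ (toL2 (dirPacket v₀ ε u)) = toL2 (𝓕 (dirPacket v₀ ε u)) :=
      fourierTransform_wavePacket (evolvedWidth_re_pos hε 0) _ _
    rw [h4]
    filter_upwards [coeFn_toL2 (memLp_fourier_wavePacket (evolvedWidth_re_pos hε 0) 0
      (waveFreq v₀ ε u))] with w hw
    exact hw.trans (fourier_dirPacket v₀ hε u w)
  have h5 : sphereMeasure.real Set.univ * coreMass ≤
      ∫ u, (∫ w in S, dirGauss v₀ ε u w) ∂sphereMeasure := by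
    have h6 : ∀ u, (∫ w in S, dirGauss v₀ ε u w) ≤ ∫ w, dirGauss v₀ ε u w := fun u =>
      setIntegral_le_integral (integrable_dirGauss v₀ hε u)
        (Filter.Eventually.of_forall fun w => dirGauss_nonneg v₀ hε u w)
    have h7 : Integrable (fun u => ∫ w in S, dirGauss v₀ ε u w) sphereMeasure := by
      have hc : Continuous fun q : S2 × E3 => dirGauss v₀ ε q.1 q.2 := by
        have := continuous_waveFreq v₀ ε
        unfold dirGauss
        fun_prop
      -- The integral of the full Gaussian is independent of `u` by translation invariance and
      -- dominates the shell integral.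
      refine Integrable.of_bound
        (hc.stronglyMeasurable.integral_prod_right
          (ν := (volume : Measure E3).restrict S)).aestronglyMeasurable
        (∫ w : E3, (2 * Real.pi * ε ^ 2) ^ (3 / 2 : ℝ) *
          Real.exp (-(2 * Real.pi ^ 2 * ε ^ 2) * ‖w‖ ^ 2)) (Filter.Eventually.of_forall fun u => ?_)
      rw [Real.norm_of_nonneg (integral_nonneg fun w => dirGauss_nonneg v₀ hε u w)]
      refine (h6 u).trans (le_of_eq ?_)
      exact integral_sub_right_eq_self (fun w : E3 => (2 * Real.pi * ε ^ 2) ^ (3 / 2 : ℝ) *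
          Real.exp (-(2 * Real.pi ^ 2 * ε ^ 2) * ‖w‖ ^ 2)) (waveFreq v₀ ε u)
    have h8 := integral_mono (integrable_const coreMass) h7
      (fun u => coreMass_le_setIntegral hv₀ hε u)
    rwa [integral_const, smul_eq_mul] at h8
  refine h5.trans ?_
  have h9 : ‖h‖ = √(volume.real S) := by
    rw [hh, norm_indicatorConstLp (by norm_num) (by norm_num), norm_one, one_mul,
      Real.sqrt_eq_rpow, ENNReal.toReal_ofNat]
  calc ∫ u, (∫ w in S, dirGauss v₀ ε u w) ∂sphereMeasure
      ≤ ‖inner ℂ h (ℱ W)‖ := by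
        rw [h1, Complex.norm_real]
        exact le_abs_self _
    _ ≤ ‖h‖ * ‖ℱ W‖ := norm_inner_le_norm _ _
    _ = √(volume.real S) * ‖W‖ := by rw [h9, LinearIsometryEquiv.norm_map]

theorem sphereMeasure_real_univ_pos : 0 < sphereMeasure.real Set.univ := by
  rw [Measure.real, Measure.toSphere_apply_univ, finrank_euclideanSpace, Fintype.card_fin]
  refine ENNReal.toReal_pos ?_ ?_
  · exact mul_ne_zero (by norm_num) (Metric.measure_ball_pos _ _ one_pos).ne'
  · exact ENNReal.mul_ne_top (by norm_num) measure_ball_lt_top.ne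

/-- The normalized amplitude is at most `C (1 + ε) ε^{-5/2}`. -/
theorem exists_normConst_mul_waveAmp_le {v₀ : ℝ} (hv₀ : 0 < v₀) :
    ∃ C : ℝ, 0 < C ∧ ∀ ε : ℝ, 0 < ε →
      normConst v₀ ε * waveAmp ε ≤ C * ((1 + ε) * ε ^ (-(5 / 2) : ℝ)) := by
  set m := sphereMeasure.real Set.univ * coreMass with hm
  have hmpos : 0 < m := mul_pos sphereMeasure_real_univ_pos coreMass_pos
  set κ := volume.real (Metric.ball (0 : E3) 1) with hκ
  have hκpos : 0 < κ := volume_real_unitBall_pos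
  set K := (6 * (v₀ / (2 * Real.pi)) ^ 2 + 8) * κ with hK
  have hKpos : 0 < K := by positivity
  refine ⟨√K / m, by positivity, fun ε hε => ?_⟩
  rw [normConst_mul_waveAmp v₀ hε]
  have h1 := le_norm_integral_dirPacket hv₀ hε
  rw [← hm] at h1
  set w := ‖∫ u, toL2 (dirPacket v₀ ε u) ∂sphereMeasure‖ with hw
  set D := (1 + ε) * ε ^ (-(5 / 2) : ℝ) with hD
  have hDpos : 0 < D := by positivity
  have h2 : √(volume.real (shell (v₀ / (2 * Real.pi * ε ^ 2)) ε⁻¹)) ≤ √K * D := by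
    rw [show √K * D = √(K * D ^ 2) by rw [Real.sqrt_mul hKpos.le, Real.sqrt_sq hDpos.le]]
    refine Real.sqrt_le_sqrt ((volume_shell_le (by positivity) (by positivity)).trans ?_)
    rw [← hκ, hK, mul_right_comm _ κ]
    refine mul_le_mul_of_nonneg_right ?_ hκpos.le
    have h3 : D ^ 2 = (1 + ε) ^ 2 * (ε ^ 5)⁻¹ := by
      rw [hD, mul_pow, ← Real.rpow_natCast (ε ^ _) 2, ← Real.rpow_mul hε.le, ← Real.rpow_natCast ε 5,
        ← Real.rpow_neg hε.le]
      norm_num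
    rw [h3]
    -- Radius of order `ε^{-2}` and thickness `ε^{-1}` give a volume of order `ε^{-5}` for small
    -- `ε`; the cubic term, dominant for large `ε`, is the source of the factor `1+ε`.
    have h4 : 6 * (v₀ / (2 * Real.pi * ε ^ 2)) ^ 2 * ε⁻¹ + 8 * ε⁻¹ ^ 3 =
        (6 * (v₀ / (2 * Real.pi)) ^ 2 + 8 * ε ^ 2) * (ε ^ 5)⁻¹ := by
      field_simp
    rw [h4, ← mul_assoc]
    refine mul_le_mul_of_nonneg_right ?_ (by positivity)
    have h5 : 0 ≤ (v₀ / (2 * Real.pi)) ^ 2 := sq_nonneg _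
    have h6 : 0 ≤ (v₀ / (2 * Real.pi)) ^ 2 * (2 * ε + ε ^ 2) := by positivity
    nlinarith
  have h7 : m ≤ √K * D * w :=
    h1.trans (mul_le_mul_of_nonneg_right h2 (norm_nonneg _))
  have hwpos : 0 < w := by
    have hw0 : 0 ≤ w := norm_nonneg _
    refine hw0.lt_of_ne fun h => ?_
    rw [← h, mul_zero] at h7
    linarith
  rw [div_mul_eq_mul_div, inv_le_iff_one_le_mul₀ hwpos, div_mul_eq_mul_div, one_le_div hmpos]
  exact h7

end SphericalWave

namespace SphericalWave

open scoped FourierTransform ContDiff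

/-! ### Weak partial derivatives of integrable functions -/

theorem contDiff_partialDeriv {φ : E3 → ℝ} (h : ContDiff ℝ ∞ φ) (i : Fin 3) :
    ContDiff ℝ ∞ (partialDeriv i φ) := by
  unfold partialDeriv
  exact (h.fderiv_right (m := ∞) (by simp)).clm_apply contDiff_const

theorem hasCompactSupport_partialDeriv {φ : E3 → ℝ} (h : HasCompactSupport φ) (i : Fin 3) :
    HasCompactSupport (partialDeriv i φ) := by
  unfold partialDeriv
  exact (h.fderiv (𝕜 := ℝ)).comp_left
    (g := fun L : E3 →L[ℝ] ℝ => L (EuclideanSpace.single i 1)) rfl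

theorem multiDeriv_single (i : Fin 3) (m : ℕ) (φ : E3 → ℝ) :
    multiDeriv (Pi.single i m) φ = (partialDeriv i)^[m] φ := by
  fin_cases i <;> simp [multiDeriv]

theorem sum_single (i : Fin 3) (m : ℕ) : ∑ l, (Pi.single i m : Fin 3 → ℕ) l = m := by
  simp

theorem single_mem_multiIndices {k m : ℕ} (h : m ≤ k) (i : Fin 3) :
    (Pi.single i m : Fin 3 → ℕ) ∈ multiIndices k := by
  rw [multiIndices, Finset.mem_filter, sum_single]
  refine ⟨Fintype.mem_piFinset.2 fun l => Finset.mem_range.2 ?_, h⟩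
  rw [Pi.single_apply]
  split_ifs <;> omega

theorem isWeakDeriv_weakDeriv {α : Fin 3 → ℕ} {f : E3 → ℂ} (h : ∃ g, IsWeakDeriv α f g) :
    IsWeakDeriv α f (weakDeriv α f) := by
  rw [weakDeriv, dif_pos h]
  exact h.choose_spec

/-- `g` is the weak derivative of `f` in the direction `i`. -/
def IsWeakPartial (i : Fin 3) (f g : E3 → ℂ) : Prop :=
  ∀ φ : E3 → ℝ, ContDiff ℝ ∞ φ → HasCompactSupport φ →
    ∫ x, (partialDeriv i φ x : ℂ) * f x = -∫ x, (φ x : ℂ) * g x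

/-- Testing the `m`-th derivative against `∂_i φ` and cancelling the common sign `(-1)^m` lets pure
derivatives be peeled off one at a time. -/
theorem isWeakPartial_of_isWeakDeriv {i : Fin 3} {m : ℕ} {f g h : E3 → ℂ}
    (hg : IsWeakDeriv (Pi.single i m) f g) (hh : IsWeakDeriv (Pi.single i (m + 1)) f h) :
    IsWeakPartial i g h := by
  intro φ hφ hc
  have h1 := hg.2.2 (partialDeriv i φ) (contDiff_partialDeriv hφ i)
    (hasCompactSupport_partialDeriv hc i)
  have h2 := hh.2.2 φ hφ hc
  rw [multiDeriv_single, sum_single] at h1 h2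
  rw [Function.iterate_succ_apply, h1, pow_succ, mul_assoc] at h2
  have h3 := mul_left_cancel₀ (pow_ne_zero m (by norm_num : (-1 : ℂ) ≠ 0)) h2
  rw [h3, neg_one_mul]

theorem partialDeriv_mul {φ ψ : E3 → ℝ} (hφ : ContDiff ℝ ∞ φ) (hψ : ContDiff ℝ ∞ ψ) (i : Fin 3)
    (x : E3) : partialDeriv i (fun y => φ y * ψ y) x =
      φ x * partialDeriv i ψ x + partialDeriv i φ x * ψ x := by
  unfold partialDeriv
  rw [fderiv_fun_mul (hφ.differentiable (by simp) x) (hψ.differentiable (by simp) x)]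
  simp
  ring

theorem partialDeriv_comp_smul {φ : E3 → ℝ} (hφ : ContDiff ℝ ∞ φ) (i : Fin 3) (c : ℝ) (x : E3) :
    partialDeriv i (fun y => φ (c • y)) x = c * partialDeriv i φ (c • x) := by
  unfold partialDeriv
  have h1 : HasFDerivAt (fun y : E3 => c • y) (c • ContinuousLinearMap.id ℝ E3) x :=
    (hasFDerivAt_id x).const_smul c
  have h2 := ((hφ.differentiable (by simp) (c • x)).hasFDerivAt).comp x h1
  rw [show (fun y => φ (c • y)) = φ ∘ fun y : E3 => c • y from rfl, h2.fderiv]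
  simp

/-- Integration by parts against bounded smooth functions. -/
theorem IsWeakPartial.integral_eq {i : Fin 3} {f g : E3 → ℂ} (h : IsWeakPartial i f g)
    (hf : Integrable f) (hg : Integrable g) {ψ : E3 → ℝ} (hψ : ContDiff ℝ ∞ ψ) {C : ℝ}
    (h0 : ∀ x, |ψ x| ≤ C) (h1 : ∀ x, |partialDeriv i ψ x| ≤ C) :
    ∫ x, (partialDeriv i ψ x : ℂ) * f x = -∫ x, (ψ x : ℂ) * g x := by
  -- The dilated cut-offs `χ(x/(n+1))` give `ψ` compact support; differentiating the cut-off
  -- produces a factor `1/(n+1)`, so that term disappears in the dominated limit.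
  let χ : ContDiffBump (0 : E3) := ⟨1, 2, one_pos, one_lt_two⟩
  have hχ : ContDiff ℝ ∞ (χ : E3 → ℝ) := χ.contDiff
  have hχc : HasCompactSupport (χ : E3 → ℝ) := χ.hasCompactSupport
  have hχ1 : ∀ x, |χ x| ≤ 1 := fun x => by
    rw [abs_of_nonneg χ.nonneg]
    exact χ.le_one
  have hχ0 : χ 0 = 1 := χ.one_of_mem_closedBall (by simp [χ])
  obtain ⟨M, hM⟩ := (hasCompactSupport_partialDeriv hχc i).exists_bound_of_continuous
    (contDiff_partialDeriv hχ i).continuous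
  have hM0 : 0 ≤ M := (norm_nonneg _).trans (hM 0)
  have hC0 : 0 ≤ C := (abs_nonneg _).trans (h0 0)
  set c : ℕ → ℝ := fun n => 1 / ((n : ℝ) + 1) with hc
  have hcpos : ∀ n, 0 < c n := fun n => by positivity
  have hcle : ∀ n, c n ≤ 1 := fun n => by
    have : (0 : ℝ) ≤ n := Nat.cast_nonneg n
    rw [hc]
    simp only
    rw [div_le_one (by positivity)]
    linarith
  have hclim : Filter.Tendsto c Filter.atTop (nhds 0) := tendsto_one_div_add_atTop_nhds_zero_nat
  have hχs : ∀ n, ContDiff ℝ ∞ fun x : E3 => χ (c n • x) := fun n =>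
    hχ.comp (contDiff_const_smul (c n))
  have hlim1 : ∀ x : E3, Filter.Tendsto (fun n => c n • x) Filter.atTop (nhds 0) := fun x => by
    simpa using hclim.smul_const x
  have hlimχ : ∀ x : E3, Filter.Tendsto (fun n => χ (c n • x)) Filter.atTop (nhds 1) := fun x => by
    rw [← hχ0]
    exact (hχ.continuous.tendsto 0).comp (hlim1 x)
  have hlimD : ∀ x : E3, Filter.Tendsto (fun n => c n * partialDeriv i χ (c n • x)) Filter.atTop
      (nhds 0) := fun x => by
    have := hclim.mul (((contDiff_partialDeriv hχ i).continuous.tendsto 0).comp (hlim1 x))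
    simpa using this
  have hpart : ∀ n, ∫ x, (partialDeriv i (fun y => χ (c n • y) * ψ y) x : ℂ) * f x =
      -∫ x, ((χ (c n • x) * ψ x : ℝ) : ℂ) * g x := fun n => by
    refine h _ ((hχs n).mul hψ) ?_
    exact (hχc.comp_homeomorph (Homeomorph.smulOfNeZero (c n) (hcpos n).ne')).mul_right
  have hcontD : ∀ n, Continuous fun x => partialDeriv i (fun y => χ (c n • y) * ψ y) x := fun n =>
    (contDiff_partialDeriv ((hχs n).mul hψ) i).continuous
  have hform : ∀ n x, partialDeriv i (fun y => χ (c n • y) * ψ y) x =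
      χ (c n • x) * partialDeriv i ψ x + c n * partialDeriv i χ (c n • x) * ψ x := fun n x => by
    rw [partialDeriv_mul (hχs n) hψ, partialDeriv_comp_smul hχ]
  have hL : Filter.Tendsto (fun n => ∫ x, (partialDeriv i (fun y => χ (c n • y) * ψ y) x : ℂ) * f x)
      Filter.atTop (nhds (∫ x, (partialDeriv i ψ x : ℂ) * f x)) := by
    refine tendsto_integral_of_dominated_convergence (fun x => (C + M * C) * ‖f x‖)
      (fun n => ?_) (hf.norm.const_mul _) (fun n => ?_) ?_
    · exact (Complex.continuous_ofReal.comp (hcontD n)).aestronglyMeasurable.mul hf.1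
    · filter_upwards with x
      rw [norm_mul, Complex.norm_real, Real.norm_eq_abs, hform]
      refine mul_le_mul_of_nonneg_right ((abs_add_le _ _).trans ?_) (norm_nonneg _)
      rw [abs_mul, abs_mul, abs_mul, abs_of_pos (hcpos n)]
      refine add_le_add ?_ ?_
      · exact (mul_le_mul (hχ1 _) (h1 x) (abs_nonneg _) zero_le_one).trans (one_mul C).le
      · refine mul_le_mul ?_ (h0 x) (abs_nonneg _) hM0
        exact (mul_le_mul (hcle n) (hM _) (norm_nonneg _) zero_le_one).trans (one_mul M).le
    · filter_upwards with x
      refine Filter.Tendsto.mul_const _ ?_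
      refine (Complex.continuous_ofReal.tendsto _).comp ?_
      simp only [hform]
      simpa using ((hlimχ x).mul_const (partialDeriv i ψ x)).add ((hlimD x).mul_const (ψ x))
  have hR : Filter.Tendsto (fun n => -∫ x, ((χ (c n • x) * ψ x : ℝ) : ℂ) * g x)
      Filter.atTop (nhds (-∫ x, (ψ x : ℂ) * g x)) := by
    refine (tendsto_integral_of_dominated_convergence (fun x => C * ‖g x‖)
      (fun n => ?_) (hg.norm.const_mul _) (fun n => ?_) ?_).neg
    · exact (Complex.continuous_ofReal.comp
        ((hχs n).mul hψ).continuous).aestronglyMeasurable.mul hg.1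
    · filter_upwards with x
      rw [norm_mul, Complex.norm_real, Real.norm_eq_abs, abs_mul]
      refine mul_le_mul_of_nonneg_right ?_ (norm_nonneg _)
      exact (mul_le_mul (hχ1 _) (h0 x) (abs_nonneg _) zero_le_one).trans (one_mul C).le
    · filter_upwards with x
      refine Filter.Tendsto.mul_const _ ((Complex.continuous_ofReal.tendsto _).comp ?_)
      simpa using (hlimχ x).mul_const (ψ x)
  simp only [hpart] at hL
  exact tendsto_nhds_unique hL hR

/-! ### Decay of the inverse Fourier transform -/

/-- The inverse Fourier integral `∫ e^{i ξ·x} f(ξ) dξ`, without normalization. -/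
noncomputable def invFourierIntegral (f : E3 → ℂ) (x : E3) : ℂ :=
  ∫ ξ : E3, Complex.exp (Complex.I * ((inner ℝ x ξ : ℝ) : ℂ)) * f ξ

theorem norm_exp_I_mul (x : ℝ) : ‖Complex.exp (Complex.I * (x : ℂ))‖ = 1 := by
  rw [Complex.norm_exp]
  simp

theorem norm_invFourierIntegral_le (f : E3 → ℂ) (x : E3) :
    ‖invFourierIntegral f x‖ ≤ ∫ ξ, ‖f ξ‖ := by
  refine (norm_integral_le_integral_norm _).trans (le_of_eq ?_)
  simp only [norm_mul, norm_exp_I_mul, one_mul]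

theorem continuous_invFourierIntegral {f : E3 → ℂ} (hf : Integrable f) :
    Continuous (invFourierIntegral f) := by
  refine continuous_of_dominated (bound := fun ξ => ‖f ξ‖) (fun x => ?_) (fun x => ?_) hf.norm ?_
  · exact (Continuous.aestronglyMeasurable (by fun_prop)).mul hf.1
  · filter_upwards with ξ
    rw [norm_mul, norm_exp_I_mul, one_mul]
  · filter_upwards with ξ
    fun_prop

/-- Weak derivatives are tested against real functions only, so the exponential is split before
integrating by parts. -/
theorem invFourierIntegral_eq_cos_add_sin {f : E3 → ℂ} (hf : Integrable f) (x : E3) :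
    invFourierIntegral f x = (∫ ξ, ((Real.cos (inner ℝ x ξ) : ℝ) : ℂ) * f ξ) +
      Complex.I * ∫ ξ, ((Real.sin (inner ℝ x ξ) : ℝ) : ℂ) * f ξ := by
  have hb : ∀ ψ : E3 → ℝ, Continuous ψ → (∀ ξ, |ψ ξ| ≤ 1) →
      Integrable fun ξ => (ψ ξ : ℂ) * f ξ := by
    intro ψ hψ h1
    refine hf.norm.mono' ((Complex.continuous_ofReal.comp hψ).aestronglyMeasurable.mul hf.1) ?_
    filter_upwards with ξ
    rw [norm_mul, Complex.norm_real, Real.norm_eq_abs]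
    exact mul_le_of_le_one_left (norm_nonneg _) (h1 ξ)
  rw [← integral_const_mul, ← integral_add (hb _ (by fun_prop) fun ξ => Real.abs_cos_le_one _)
    ((hb _ (by fun_prop) fun ξ => Real.abs_sin_le_one _).const_mul _)]
  refine integral_congr_ae (Filter.Eventually.of_forall fun ξ => ?_)
  simp only
  rw [mul_comm Complex.I, Complex.exp_mul_I, Complex.ofReal_cos, Complex.ofReal_sin]
  ring

theorem partialDeriv_comp_inner {F F' : ℝ → ℝ} (hF : ∀ r, HasDerivAt F (F' r) r) (i : Fin 3)
    (x ξ : E3) : partialDeriv i (fun η => F (inner ℝ x η)) ξ = F' (inner ℝ x ξ) * x i := by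
  unfold partialDeriv
  have h1 : HasFDerivAt (fun η : E3 => (inner ℝ x η : ℝ)) (innerSL ℝ x) ξ :=
    (innerSL ℝ x).hasFDerivAt
  have h2 := (hF (inner ℝ x ξ)).comp_hasFDerivAt ξ h1
  have h3 : fderiv ℝ (fun η => F (inner ℝ x η)) ξ = F' (inner ℝ x ξ) • innerSL ℝ x := h2.fderiv
  rw [h3]
  simp [EuclideanSpace.inner_single_right]

theorem IsWeakPartial.invFourierIntegral_eq {i : Fin 3} {f g : E3 → ℂ} (h : IsWeakPartial i f g)
    (hf : Integrable f) (hg : Integrable g) (x : E3) :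
    invFourierIntegral g x = -Complex.I * x i * invFourierIntegral f x := by
  have hbd : ∀ r : ℝ, |r| ≤ 1 → |r| ≤ 1 + |x i| := fun r hr =>
    hr.trans (le_add_of_nonneg_right (abs_nonneg _))
  have hbd' : ∀ r : ℝ, |r| ≤ 1 → |r * x i| ≤ 1 + |x i| := fun r hr => by
    rw [abs_mul]
    exact (mul_le_of_le_one_left (abs_nonneg _) hr).trans (le_add_of_nonneg_left zero_le_one)
  have hcos : ContDiff ℝ ∞ fun ξ : E3 => Real.cos (inner ℝ x ξ) :=
    Real.contDiff_cos.comp (contDiff_const.inner ℝ contDiff_id)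
  have hsin : ContDiff ℝ ∞ fun ξ : E3 => Real.sin (inner ℝ x ξ) :=
    Real.contDiff_sin.comp (contDiff_const.inner ℝ contDiff_id)
  have hc : ∀ ξ, partialDeriv i (fun η => Real.cos (inner ℝ x η)) ξ =
      -Real.sin (inner ℝ x ξ) * x i := partialDeriv_comp_inner Real.hasDerivAt_cos i x
  have hs : ∀ ξ, partialDeriv i (fun η => Real.sin (inner ℝ x η)) ξ =
      Real.cos (inner ℝ x ξ) * x i := partialDeriv_comp_inner Real.hasDerivAt_sin i x
  have h1 := h.integral_eq hf hg hcos (fun ξ => hbd _ (Real.abs_cos_le_one _)) fun ξ => by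
    rw [hc]
    exact hbd' _ (by rw [abs_neg]; exact Real.abs_sin_le_one _)
  have h2 := h.integral_eq hf hg hsin (fun ξ => hbd _ (Real.abs_sin_le_one _)) fun ξ => by
    rw [hs]
    exact hbd' _ (Real.abs_cos_le_one _)
  simp only [hc] at h1
  simp only [hs] at h2
  have h3 : ∫ ξ, ((-Real.sin (inner ℝ x ξ) * x i : ℝ) : ℂ) * f ξ =
      -(x i : ℂ) * ∫ ξ, ((Real.sin (inner ℝ x ξ) : ℝ) : ℂ) * f ξ := by
    rw [← integral_const_mul]
    congr 1
    ext ξ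
    push_cast
    ring
  have h4 : ∫ ξ, ((Real.cos (inner ℝ x ξ) * x i : ℝ) : ℂ) * f ξ =
      (x i : ℂ) * ∫ ξ, ((Real.cos (inner ℝ x ξ) : ℝ) : ℂ) * f ξ := by
    rw [← integral_const_mul]
    congr 1
    ext ξ
    push_cast
    ring
  rw [h3] at h1
  rw [h4] at h2
  rw [invFourierIntegral_eq_cos_add_sin hf, invFourierIntegral_eq_cos_add_sin hg]
  linear_combination h1 + Complex.I * h2 + (x i : ℂ) *
    (∫ ξ, ((Real.sin (inner ℝ x ξ) : ℝ) : ℂ) * f ξ) * Complex.I_sq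

theorem one_le_weight {k : ℕ} (x : E3) : 1 ≤ weight k x :=
  Real.one_le_rpow (by nlinarith [sq_nonneg ‖x‖]) (by positivity)

theorem MemW.integrable_weakDeriv {k : ℕ} {f : E3 → ℂ} (h : MemW k k f) {α : Fin 3 → ℕ}
    (hα : α ∈ multiIndices k) : Integrable (weakDeriv α f) := by
  refine (h α hα).2.mono' (isWeakDeriv_weakDeriv (h α hα).1).2.1.aestronglyMeasurable ?_
  filter_upwards with x
  exact le_mul_of_one_le_left (norm_nonneg _) (one_le_weight x)

theorem MemW.integral_norm_weakDeriv_le {k : ℕ} {f : E3 → ℂ} (h : MemW k k f) {α : Fin 3 → ℕ}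
    (hα : α ∈ multiIndices k) : ∫ x, ‖weakDeriv α f x‖ ≤ normW k k f := by
  have h1 : ∫ x, ‖weakDeriv α f x‖ ≤ ∫ x, weight k x * ‖weakDeriv α f x‖ :=
    integral_mono (h.integrable_weakDeriv hα).norm (h α hα).2
      fun x => le_mul_of_one_le_left (norm_nonneg _) (one_le_weight x)
  refine h1.trans ?_
  refine Finset.single_le_sum (f := fun α => ∫ x, weight k x * ‖weakDeriv α f x‖)
    (fun β _ => integral_nonneg fun x => ?_) hα
  exact mul_nonneg (zero_le_one.trans (one_le_weight x)) (norm_nonneg _)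

theorem IsWeakDeriv.ae_eq {f g : E3 → ℂ} (h : IsWeakDeriv 0 f g) : f =ᵐ[volume] g := by
  refine ae_eq_of_integral_contDiff_smul_eq h.1 h.2.1 fun φ hφ hc => ?_
  have := h.2.2 φ hφ hc
  simpa [multiDeriv] using this

theorem MemW.ae_eq_weakDeriv_zero {k : ℕ} {f : E3 → ℂ} (h : MemW k k f) :
    f =ᵐ[volume] weakDeriv 0 f := by
  have h0 : (0 : Fin 3 → ℕ) ∈ multiIndices k := by
    simpa using single_mem_multiIndices (Nat.zero_le k) 0
  exact (isWeakDeriv_weakDeriv (h 0 h0).1).ae_eq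

theorem MemW.integrable {k : ℕ} {f : E3 → ℂ} (h : MemW k k f) : Integrable f := by
  have h0 : (0 : Fin 3 → ℕ) ∈ multiIndices k := by
    simpa using single_mem_multiIndices (Nat.zero_le k) 0
  exact (h.integrable_weakDeriv h0).congr h.ae_eq_weakDeriv_zero.symm

theorem MemW.norm_invFourierIntegral_weakDeriv {k : ℕ} {f : E3 → ℂ} (h : MemW k k f) (i : Fin 3)
    (x : E3) {m : ℕ} (hm : m ≤ k) :
    ‖invFourierIntegral (weakDeriv (Pi.single i m) f) x‖ =
      |x i| ^ m * ‖invFourierIntegral f x‖ := by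
  induction m with
  | zero =>
    rw [pow_zero, one_mul, Pi.single_zero]
    congr 1
    -- The weak derivative of order zero is a chosen representative, equal to `f` only almost
    -- everywhere.
    refine integral_congr_ae ?_
    filter_upwards [h.ae_eq_weakDeriv_zero] with ξ hξ
    rw [hξ]
  | succ m ih =>
    have h1 := single_mem_multiIndices (Nat.le_of_succ_le hm) i
    have h2 := single_mem_multiIndices hm i
    have h3 := isWeakPartial_of_isWeakDeriv (isWeakDeriv_weakDeriv (h _ h1).1)
      (isWeakDeriv_weakDeriv (h _ h2).1)
    rw [h3.invFourierIntegral_eq (h.integrable_weakDeriv h1) (h.integrable_weakDeriv h2), norm_mul,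
      norm_mul, norm_neg, Complex.norm_I, one_mul, Complex.norm_real, Real.norm_eq_abs,
      ih (Nat.le_of_succ_le hm), pow_succ]
    ring

theorem exists_norm_le_two_mul_abs (x : E3) : ∃ i, ‖x‖ ≤ 2 * |x i| := by
  by_contra! h
  have h0 := EuclideanSpace.real_norm_sq_eq x
  rw [Fin.sum_univ_three] at h0
  have hi : ∀ i, 4 * x i ^ 2 < ‖x‖ ^ 2 := fun i => by
    rw [← sq_abs (x i)]
    nlinarith [h i, abs_nonneg (x i)]
  have := hi 0
  have := hi 1
  have := hi 2
  nlinarith [sq_nonneg ‖x‖]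

/-- It suffices to use orders `0` and `k` in one coordinate direction, chosen so that `‖x‖ ≤ 2|x
i|`. The factor `2^(k-1)` is the convexity bound for `(1+‖x‖)^k`. -/
theorem MemW.norm_invFourierIntegral_mul_le {k : ℕ} {f : E3 → ℂ} (h : MemW k k f) (x : E3) :
    (1 + ‖x‖) ^ k * ‖invFourierIntegral f x‖ ≤ 2 ^ (k - 1) * (1 + 2 ^ k) * normW k k f := by
  have hm : ∀ i m, m ≤ k → |x i| ^ m * ‖invFourierIntegral f x‖ ≤ normW k k f := fun i m hmk => by
    rw [← h.norm_invFourierIntegral_weakDeriv i x hmk]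
    exact (norm_invFourierIntegral_le _ _).trans
      (h.integral_norm_weakDeriv_le (single_mem_multiIndices hmk i))
  obtain ⟨i, hi⟩ := exists_norm_le_two_mul_abs x
  have h0 := hm i 0 (Nat.zero_le k)
  rw [pow_zero, one_mul] at h0
  have hk := hm i k le_rfl
  have h1 : ‖x‖ ^ k ≤ 2 ^ k * |x i| ^ k := by
    rw [← mul_pow]
    exact pow_le_pow_left₀ (norm_nonneg _) hi k
  have h2 : (1 + ‖x‖) ^ k ≤ 2 ^ (k - 1) * (1 + 2 ^ k * |x i| ^ k) := by
    refine (add_pow_le zero_le_one (norm_nonneg x) k).trans ?_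
    rw [one_pow]
    exact mul_le_mul_of_nonneg_left (by linarith) (by positivity)
  calc (1 + ‖x‖) ^ k * ‖invFourierIntegral f x‖
      ≤ 2 ^ (k - 1) * (1 + 2 ^ k * |x i| ^ k) * ‖invFourierIntegral f x‖ :=
        mul_le_mul_of_nonneg_right h2 (norm_nonneg _)
    _ = 2 ^ (k - 1) * (‖invFourierIntegral f x‖ +
          2 ^ k * (|x i| ^ k * ‖invFourierIntegral f x‖)) := by ring
    _ ≤ 2 ^ (k - 1) * (normW k k f + 2 ^ k * normW k k f) := by gcongr
    _ = _ := by ring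

/-! ### The potential as an inverse Fourier transform -/

/-- Near any point `V` coincides with its product with a bump function, which is a Schwartz test
function. -/
theorem IsFourierTransform.locallyIntegrable {V : E3 → ℝ} {g : E3 → ℂ}
    (h : IsFourierTransform V g) : LocallyIntegrable fun x => (V x : ℂ) := by
  intro x
  let χ : ContDiffBump x := ⟨1, 2, one_pos, one_lt_two⟩
  have hχ : ContDiff ℝ ∞ (fun y => (χ y : ℂ)) := Complex.ofRealCLM.contDiff.comp χ.contDiff
  have hχc : HasCompactSupport (fun y => (χ y : ℂ)) :=
    χ.hasCompactSupport.comp_left (g := fun r : ℝ => (r : ℂ)) Complex.ofReal_zero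
  refine ⟨Metric.closedBall x 1, Metric.closedBall_mem_nhds x one_pos, ?_⟩
  refine ((h (hχc.toSchwartzMap hχ)).1.integrableOn).congr_fun (fun y hy => ?_)
    measurableSet_closedBall
  have : χ y = 1 := χ.one_of_mem_closedBall hy
  change (V y : ℂ) * (χ y : ℂ) = V y
  rw [this]
  simp

theorem invFourierIntegral_eq_fourier (f : E3 → ℂ) (x : E3) :
    invFourierIntegral f x = 𝓕 f ((-(2 * Real.pi)⁻¹ : ℝ) • x) := by
  rw [invFourierIntegral, Real.fourier_eq']
  congr 1
  ext ξ
  rw [smul_eq_mul, real_inner_smul_right, real_inner_comm]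
  congr 2
  have : (Real.pi : ℂ) ≠ 0 := by exact_mod_cast Real.pi_ne_zero
  push_cast
  field_simp

theorem fourierT_fourier (h : SchwartzMap E3 ℂ) (ξ : E3) :
    fourierT (𝓕 h : SchwartzMap E3 ℂ) ξ =
      (((2 * Real.pi) ^ (-(3 / 2) : ℝ) : ℝ) : ℂ) * h ((-(2 * Real.pi)⁻¹ : ℝ) • ξ) := by
  rw [fourierT]
  congr 1
  conv_rhs => rw [← FourierTransform.fourierInv_fourier_eq (F := SchwartzMap E3 ℂ) h,
    SchwartzMap.fourierInv_coe, Real.fourierInv_eq']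
  congr 1
  ext x
  rw [smul_eq_mul, real_inner_smul_right, real_inner_comm]
  congr 2
  have : (Real.pi : ℂ) ≠ 0 := by exact_mod_cast Real.pi_ne_zero
  push_cast
  field_simp

theorem IsFourierTransform.ae_eq {V : E3 → ℝ} {g : E3 → ℂ} (h : IsFourierTransform V g)
    (hg : Integrable g) :
    ∀ᵐ x, (V x : ℂ) = (((2 * Real.pi) ^ (-(3 / 2) : ℝ) : ℝ) : ℂ) * invFourierIntegral g x := by
  refine ae_eq_of_integral_contDiff_smul_eq h.locallyIntegrable
    ((continuous_const.mul (continuous_invFourierIntegral hg)).locallyIntegrable) fun ψ hψ hψc => ?_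
  -- Chosen so that the angular-frequency transform of `𝓕 η` is a constant times `ψ`. Testing `V`
  -- with `𝓕 η` thus tests it with `ψ`, while on the other side the transform is moved onto `g`.
  set η : E3 → ℂ := fun w => (ψ ((-(2 * Real.pi)) • w) : ℂ) with hη
  have hπ : (-(2 * Real.pi)) ≠ 0 := by
    have := Real.pi_pos
    linarith
  have hηs : ContDiff ℝ ∞ η :=
    Complex.ofRealCLM.contDiff.comp (hψ.comp (contDiff_const_smul _))
  have hηc : HasCompactSupport η :=
    (hψc.comp_homeomorph (Homeomorph.smulOfNeZero _ hπ)).comp_left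
      (g := fun r : ℝ => (r : ℂ)) Complex.ofReal_zero
  set u : SchwartzMap E3 ℂ := hηc.toSchwartzMap hηs with hu
  have huη : ∀ w, u w = η w := fun w => rfl
  set c : ℝ := (2 * Real.pi) ^ (-(3 / 2) : ℝ) with hc
  have hcpos : 0 < c := by positivity
  have hc2 : c * c = ((2 * Real.pi) ^ 3)⁻¹ := by
    rw [hc, ← Real.rpow_add (by positivity), ← Real.rpow_natCast, ← Real.rpow_neg (by positivity)]
    norm_num
  have h1 := (h (𝓕 u)).2.2
  simp only [fourierT_fourier, huη, hη, smul_smul] at h1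
  have hinv : (-(2 * Real.pi)) * (-(2 * Real.pi)⁻¹) = 1 := by
    have := Real.pi_ne_zero
    field_simp
  simp only [hinv, one_smul] at h1
  have h2 : ∫ ξ, g ξ * (𝓕 u : SchwartzMap E3 ℂ) ξ = ∫ w, 𝓕 g w * u w := by
    have h3 := VectorFourier.integral_fourierIntegral_smul_eq_flip (L := innerₗ E3)
      Real.continuous_fourierChar continuous_inner hg u.integrable (μ := volume) (ν := volume)
    simpa using! h3.symm
  have h4 : ∫ x, (fun w => 𝓕 g w * u w) ((-(2 * Real.pi)⁻¹ : ℝ) • x) =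
      (2 * Real.pi) ^ 3 * ∫ w, 𝓕 g w * u w := by
    refine (Measure.integral_comp_smul volume (fun w => 𝓕 g w * u w) _).trans ?_
    have : |((-(2 * Real.pi)⁻¹) ^ Module.finrank ℝ E3)⁻¹| = (2 * Real.pi) ^ 3 := by
      rw [finrank_euclideanSpace, Fintype.card_fin, abs_inv, abs_pow, abs_neg, abs_inv,
        abs_of_pos (by positivity), inv_pow, inv_inv]
    rw [this, Complex.real_smul]
    push_cast
    rfl
  simp only [huη, hη, smul_smul, hinv, one_smul, ← invFourierIntegral_eq_fourier] at h4
  rw [h2] at h1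
  simp only [huη, hη] at h1
  have h5 : ∫ x, ψ x • (V x : ℂ) = (c : ℂ)⁻¹ * ∫ x, (V x : ℂ) * ((c : ℂ) * (ψ x : ℂ)) := by
    rw [← integral_const_mul]
    congr 1
    ext x
    have : (c : ℂ) ≠ 0 := by exact_mod_cast hcpos.ne'
    rw [Complex.real_smul]
    field_simp
  have h6 : ∫ x, ψ x • ((c : ℂ) * invFourierIntegral g x) =
      (c : ℂ) * ∫ x, invFourierIntegral g x * (ψ x : ℂ) := by
    rw [← integral_const_mul]
    congr 1
    ext x
    rw [Complex.real_smul]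
    ring
  have hc2' : (c : ℂ) * c * (2 * Real.pi) ^ 3 = 1 := by
    have h7 : c * c * (2 * Real.pi) ^ 3 = 1 := by
      rw [hc2]
      exact inv_mul_cancel₀ (by positivity)
    exact_mod_cast h7
  have hcne : (c : ℂ) ≠ 0 := by exact_mod_cast hcpos.ne'
  rw [h5, h6, h1, h4, inv_mul_eq_iff_eq_mul₀ hcne]
  linear_combination -(∫ w, 𝓕 g w * (ψ ((-(2 * Real.pi)) • w) : ℂ)) * hc2'

/-- A potential with Fourier transform in `W^{k,1}_k` agrees almost everywhere with a continuous
function that decays like `|x|^{-k}`. -/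
theorem exists_continuous_decaying_ae_eq (k : ℕ) : ∃ C : ℝ, 0 < C ∧
    ∀ (V : E3 → ℝ) (g : E3 → ℂ), IsFourierTransform V g → MemW k k g →
      ∃ W : E3 → ℂ, Continuous W ∧ (∀ᵐ x, (V x : ℂ) = W x) ∧
        ∀ x, (1 + ‖x‖) ^ k * ‖W x‖ ≤ C * normW k k g := by
  refine ⟨(2 * Real.pi) ^ (-(3 / 2) : ℝ) * (2 ^ (k - 1) * (1 + 2 ^ k)), by positivity,
    fun V g hV hg => ⟨fun x => _ * invFourierIntegral g x, continuous_const.mul (continuous_invFourierIntegral hg.integrable),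
      hV.ae_eq hg.integrable, fun x => ?_⟩⟩
  rw [norm_mul, Complex.norm_real, Real.norm_of_nonneg (by positivity), mul_left_comm, mul_assoc]
  exact mul_le_mul_of_nonneg_left (hg.norm_invFourierIntegral_mul_le x) (by positivity)

end SphericalWave

namespace SphericalWave

/-! ### Geometry of the cap -/

/-- The infimum runs over a finite set, hence is attained, and (B) excludes a zero angle. -/
theorem theta0_pos {N : ℕ} {a : Fin N → E3} (hB : PositionsB a) : 0 < theta0 a := by
  set S : Set ℝ := {θ | ∃ j k : Fin N, j ≠ k ∧ θ = InnerProductGeometry.angle (a j) (a k)} with hS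
  have hfin : S.Finite := by
    refine (Set.finite_range fun p : Fin N × Fin N =>
      InnerProductGeometry.angle (a p.1) (a p.2)).subset ?_
    rintro θ ⟨j, k, -, rfl⟩
    exact ⟨(j, k), rfl⟩
  have hmem : sInf ({Real.pi} ∪ S) ∈ {Real.pi} ∪ S :=
    Set.Nonempty.csInf_mem ⟨Real.pi, Or.inl rfl⟩ ((Set.finite_singleton _).union hfin)
  have hpos : ∀ θ ∈ {Real.pi} ∪ S, 0 < θ := by
    rintro θ (h | ⟨j, k, hjk, rfl⟩)
    · rw [Set.mem_singleton_iff.1 h]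
      exact Real.pi_pos
    · refine (InnerProductGeometry.angle_nonneg _ _).lt_of_ne fun h => hB.2 j k hjk ?_
      exact InnerProductGeometry.inner_eq_mul_norm_of_angle_eq_zero h.symm
  exact mul_pos (by norm_num) (hpos _ hmem)

theorem theta0_le {N : ℕ} (a : Fin N → E3) : theta0 a ≤ Real.pi / 2 := by
  have h : sInf ({Real.pi} ∪
      {θ | ∃ j k : Fin N, j ≠ k ∧ θ = InnerProductGeometry.angle (a j) (a k)}) ≤ Real.pi := by
    refine csInf_le ⟨0, ?_⟩ (Or.inl rfl)
    rintro θ (h | ⟨j, k, -, rfl⟩)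
    · rw [Set.mem_singleton_iff.1 h]
      exact Real.pi_pos.le
    · exact InnerProductGeometry.angle_nonneg _ _
  unfold theta0
  linarith

theorem sin_theta0_pos {N : ℕ} {a : Fin N → E3} (hB : PositionsB a) : 0 < Real.sin (theta0 a) :=
  Real.sin_pos_of_pos_of_lt_pi (theta0_pos hB) (by linarith [theta0_le a, Real.pi_pos])

/-- A ray in a direction outside the cap around `â_j` stays away from `a_j`. -/
theorem le_norm_smul_sub_of_notMem_cap {N : ℕ} {a : Fin N → E3} (ha : ∀ j, a j ≠ 0) {j : Fin N}
    {u : S2} (hu : u ∉ cap a j) {s : ℝ} (hs : 0 ≤ s) :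
    ‖a j‖ * |Real.sin (theta0 a)| ≤ ‖s • (u : E3) - a j‖ := by
  have hn : 0 < ‖a j‖ := norm_pos_iff.2 (ha j)
  set α : ℝ := inner ℝ (u : E3) (‖a j‖⁻¹ • a j) with hα
  have hin : inner ℝ (u : E3) (a j) = α * ‖a j‖ := by
    rw [hα, real_inner_smul_right]
    field_simp
  have hsq : ‖s • (u : E3) - a j‖ ^ 2 = s ^ 2 - 2 * s * (α * ‖a j‖) + ‖a j‖ ^ 2 := by
    rw [norm_sub_sq_real, norm_smul, norm_eq_of_mem_sphere, real_inner_smul_left, hin,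
      Real.norm_of_nonneg hs]
    ring
  refine le_of_sq_le_sq ?_ (norm_nonneg _)
  rw [hsq, mul_pow, sq_abs]
  have h1 := Real.sin_sq_le_one (theta0 a)
  have hn2 : 0 ≤ ‖a j‖ ^ 2 := sq_nonneg _
  -- If `u` points forward, the distance to the whole line, `|a_j| √(1-α²)`, is large enough;
  -- otherwise the ray recedes from `a_j` and the distance is at least `|a_j|`.
  by_cases h : 0 < α
  · have h2 : Real.sin (theta0 a) ^ 2 ≤ 1 - α ^ 2 := by
      by_contra! h3
      exact hu ⟨h3, h⟩
    nlinarith [sq_nonneg (s - α * ‖a j‖), mul_le_mul_of_nonneg_left h2 hn2]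
  · have h2 : 0 ≤ s * (-α * ‖a j‖) := by
      have : 0 ≤ -α := by linarith
      positivity
    nlinarith [mul_le_mul_of_nonneg_left h1 hn2, sq_nonneg s]

theorem measurableSet_cap {N : ℕ} (a : Fin N → E3) (j : Fin N) : MeasurableSet (cap a j) := by
  have hc : Continuous fun u : S2 => inner ℝ (u : E3) (‖a j‖⁻¹ • a j) := by fun_prop
  exact (isOpen_lt (continuous_const.sub (hc.pow 2)) continuous_const).measurableSet.inter
    (isOpen_lt continuous_const hc).measurableSet

/-! ### Gaussian moments -/

/-- Half of the Gaussian absorbs the polynomial: apply `y^m ≤ m! e^y` with `y = (b/2)(1+r²)`, after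
`1+r ≤ 2(1+r²)`. -/
theorem exists_pow_mul_exp_le (m : ℕ) {b : ℝ} (hb : 0 < b) : ∃ C : ℝ, ∀ r : ℝ, 0 ≤ r →
    (1 + r) ^ m * Real.exp (-b * r ^ 2) ≤ C * Real.exp (-(b / 2) * r ^ 2) := by
  refine ⟨2 ^ m * (m.factorial * (2 / b) ^ m * Real.exp (b / 2)), fun r hr => ?_⟩
  have h1 : (1 + r) ^ m ≤ 2 ^ m * (1 + r ^ 2) ^ m := by
    rw [← mul_pow]
    refine pow_le_pow_left₀ (by positivity) ?_ m
    nlinarith [sq_nonneg (r - 1)]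
  have h2 : (1 + r ^ 2) ^ m ≤ m.factorial * (2 / b) ^ m * Real.exp (b / 2 * (1 + r ^ 2)) := by
    have h3 := Real.pow_div_factorial_le_exp (b / 2 * (1 + r ^ 2)) (by positivity) m
    rw [div_le_iff₀ (by positivity), mul_pow] at h3
    have h4 : (2 / b) ^ m * (b / 2) ^ m = 1 := by
      rw [← mul_pow, div_mul_div_comm, mul_comm 2 b, div_self (by positivity), one_pow]
    calc (1 + r ^ 2) ^ m = (2 / b) ^ m * ((b / 2) ^ m * (1 + r ^ 2) ^ m) := by
          rw [← mul_assoc, h4, one_mul]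
      _ ≤ (2 / b) ^ m * (Real.exp (b / 2 * (1 + r ^ 2)) * m.factorial) :=
          mul_le_mul_of_nonneg_left h3 (by positivity)
      _ = _ := by ring
  have h5 : Real.exp (b / 2 * (1 + r ^ 2)) * Real.exp (-b * r ^ 2) =
      Real.exp (b / 2) * Real.exp (-(b / 2) * r ^ 2) := by
    rw [← Real.exp_add, ← Real.exp_add]
    congr 1
    ring
  calc (1 + r) ^ m * Real.exp (-b * r ^ 2)
      ≤ 2 ^ m * (m.factorial * (2 / b) ^ m * Real.exp (b / 2 * (1 + r ^ 2))) *
          Real.exp (-b * r ^ 2) := by gcongr; exact h1.trans (by gcongr)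
    _ = 2 ^ m * (m.factorial * (2 / b) ^ m) *
          (Real.exp (b / 2 * (1 + r ^ 2)) * Real.exp (-b * r ^ 2)) := by ring
    _ = _ := by rw [h5]; ring

theorem integrable_pow_mul_exp (m : ℕ) {b : ℝ} (hb : 0 < b) :
    Integrable fun x : E3 => (1 + ‖x‖) ^ m * Real.exp (-b * ‖x‖ ^ 2) := by
  obtain ⟨C, hC⟩ := exists_pow_mul_exp_le m hb
  have h := (integrable_exp_neg_mul_sq_norm (half_pos hb) 0).const_mul C
  simp only [sub_zero] at h
  refine h.mono' (Continuous.aestronglyMeasurable (by fun_prop))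
    (Filter.Eventually.of_forall fun x => ?_)
  rw [Real.norm_of_nonneg (by positivity)]
  exact hC _ (norm_nonneg x)

/-- The Gaussian moment `∫ (1 + |x|)^{2k} e^{-b|x|²} dx`. -/
noncomputable def gaussMoment (k : ℕ) (b : ℝ) : ℝ :=
  ∫ x : E3, (1 + ‖x‖) ^ (2 * k) * Real.exp (-b * ‖x‖ ^ 2)

/-- The weight `(1 + |r - c|/ε)^k`. -/
noncomputable def scaledWeight (k : ℕ) (ε : ℝ) (c r : E3) : ℝ := (1 + ‖ε⁻¹ • (r - c)‖) ^ k

theorem continuous_scaledWeight (k : ℕ) (ε : ℝ) (c : E3) : Continuous (scaledWeight k ε c) := by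
  unfold scaledWeight
  fun_prop

theorem scaledWeight_nonneg (k : ℕ) (ε : ℝ) (c r : E3) : 0 ≤ scaledWeight k ε c r := by
  unfold scaledWeight
  positivity

theorem memLp_scaledWeight_mul (k : ℕ) {ε b : ℝ} (hε : 0 < ε) (hb : 0 < b) (c : E3)
    {Φ : E3 → ℂ} (hΦ : Continuous Φ)
    (h : ∀ r, ‖Φ r‖ ^ 2 ≤ Real.exp (-b * ‖ε⁻¹ • (r - c)‖ ^ 2)) :
    MemLp (fun r => (scaledWeight k ε c r : ℂ) * Φ r) 2 volume ∧
      ‖toL2 fun r => (scaledWeight k ε c r : ℂ) * Φ r‖ ^ 2 ≤ ε ^ 3 * gaussMoment k b := by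
  have hw := continuous_scaledWeight k ε c
  have hint := integrable_comp_rescale (integrable_pow_mul_exp (2 * k) hb) hε c
  have hle : ∀ r, ‖(scaledWeight k ε c r : ℂ) * Φ r‖ ^ 2 ≤
      (1 + ‖ε⁻¹ • (r - c)‖) ^ (2 * k) * Real.exp (-b * ‖ε⁻¹ • (r - c)‖ ^ 2) := fun r => by
    rw [norm_mul, mul_pow, Complex.norm_real, Real.norm_of_nonneg (scaledWeight_nonneg k ε c r),
      scaledWeight, ← pow_mul, mul_comm k 2]
    exact mul_le_mul_of_nonneg_left (h r) (by positivity)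
  have hmem : MemLp (fun r => (scaledWeight k ε c r : ℂ) * Φ r) 2 volume := by
    rw [memLp_two_iff_integrable_sq_norm (Continuous.aestronglyMeasurable (by fun_prop))]
    refine hint.mono' (Continuous.aestronglyMeasurable (by fun_prop))
      (Filter.Eventually.of_forall fun r => ?_)
    rw [Real.norm_of_nonneg (by positivity)]
    exact hle r
  refine ⟨hmem, ?_⟩
  rw [norm_sq_toL2 hmem]
  refine (integral_mono ((memLp_two_iff_integrable_sq_norm hmem.1).1 hmem) hint hle).trans
    (le_of_eq ?_)
  exact integral_comp_rescale (fun x : E3 => (1 + ‖x‖) ^ (2 * k) * Real.exp (-b * ‖x‖ ^ 2)) hε c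

/-! ### Weighted norm of the oscillator ground state -/

theorem hermiteFun_zero_sq (x : ℝ) :
    hermiteFun 0 x * hermiteFun 0 x = (Real.sqrt Real.pi)⁻¹ * Real.exp (-x ^ 2) := by
  have h : (Real.sqrt (Real.sqrt Real.pi))⁻¹ * (Real.sqrt (Real.sqrt Real.pi))⁻¹ =
      (Real.sqrt Real.pi)⁻¹ := by
    rw [← mul_inv, Real.mul_self_sqrt (Real.sqrt_nonneg _)]
  have h2 : Real.exp (-x ^ 2 / 2) * Real.exp (-x ^ 2 / 2) = Real.exp (-x ^ 2) := by
    rw [← Real.exp_add]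
    congr 1
    ring
  simp only [hermiteFun, Nat.factorial_zero, Nat.cast_one, one_mul, Polynomial.hermite_zero, map_one,
    mul_one]
  rw [← h, ← h2]
  ring

theorem hermiteFun3_zero_sq (x : E3) :
    hermiteFun3 0 x * hermiteFun3 0 x = (Real.sqrt Real.pi)⁻¹ ^ 3 * Real.exp (-‖x‖ ^ 2) := by
  rw [hermiteFun3_mul]
  simp only [Pi.zero_apply, hermiteFun_zero_sq]
  rw [Finset.prod_mul_distrib, Finset.prod_const, ← Real.exp_sum, EuclideanSpace.real_norm_sq_eq,
    Finset.sum_neg_distrib]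
  simp

/-- The weighted norm of the ground state. -/
noncomputable def groundMoment (k : ℕ) : ℝ := (Real.sqrt Real.pi)⁻¹ ^ 3 * gaussMoment k 1

theorem scaledWeight_sq_mul_oscFun_sq (k : ℕ) {ε : ℝ} (hε : 0 < ε) (c r : E3) :
    scaledWeight k ε c r ^ 2 * (oscFun ε c 0 r * oscFun ε c 0 r) =
      (ε ^ 3)⁻¹ * (Real.sqrt Real.pi)⁻¹ ^ 3 * ((1 + ‖ε⁻¹ • (r - c)‖) ^ (2 * k) *
        Real.exp (-1 * ‖ε⁻¹ • (r - c)‖ ^ 2)) := by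
  rw [oscFun_mul ε hε, hermiteFun3_zero_sq, scaledWeight, ← pow_mul, mul_comm k 2, neg_one_mul]
  ring

theorem integrable_scaledWeight_sq_mul_oscFun_sq (k : ℕ) {ε : ℝ} (hε : 0 < ε) (c : E3) :
    Integrable fun r => scaledWeight k ε c r ^ 2 * (oscFun ε c 0 r * oscFun ε c 0 r) := by
  simp only [scaledWeight_sq_mul_oscFun_sq k hε]
  exact (integrable_comp_rescale (integrable_pow_mul_exp (2 * k) one_pos) hε c).const_mul _

theorem integral_scaledWeight_sq_mul_oscFun_sq (k : ℕ) {ε : ℝ} (hε : 0 < ε) (c : E3) :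
    ∫ r, scaledWeight k ε c r ^ 2 * (oscFun ε c 0 r * oscFun ε c 0 r) = groundMoment k := by
  simp only [scaledWeight_sq_mul_oscFun_sq k hε]
  rw [integral_const_mul, integral_comp_rescale (fun x : E3 => (1 + ‖x‖) ^ (2 * k) *
    Real.exp (-1 * ‖x‖ ^ 2)) hε, smul_eq_mul, groundMoment, gaussMoment]
  field_simp

theorem memLp_scaledWeight_mul_oscProd {N : ℕ} (k : ℕ) {ε : ℝ} (hε : 0 < ε) (a : Fin N → E3)
    (j : Fin N) :
    MemLp (fun r : Fin N → E3 => (scaledWeight k ε (a j) (r j) : ℂ) *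
      (oscProd ε a (fun _ => 0) r : ℂ)) 2 volume ∧
      ‖toL2 fun r : Fin N → E3 => (scaledWeight k ε (a j) (r j) : ℂ) *
        (oscProd ε a (fun _ => 0) r : ℂ)‖ ^ 2 = groundMoment k := by
  have hw := (continuous_scaledWeight k ε (a j)).comp
    (continuous_apply j : Continuous fun r : Fin N → E3 => r j)
  have ho := continuous_oscProd ε a (fun _ => 0)
  have hc : Continuous fun r : Fin N → E3 => (scaledWeight k ε (a j) (r j) : ℂ) *
      (oscProd ε a (fun _ => 0) r : ℂ) :=
    (Complex.continuous_ofReal.comp hw).mul (Complex.continuous_ofReal.comp ho)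
  -- Only the `j`-th factor carries the weight; every other factor integrates to one.
  set F : Fin N → E3 → ℝ := fun l r =>
    (if l = j then scaledWeight k ε (a l) r ^ 2 else 1) * (oscFun ε (a l) 0 r * oscFun ε (a l) 0 r)
    with hF
  have hsq : ∀ r : Fin N → E3, ‖(scaledWeight k ε (a j) (r j) : ℂ) *
      (oscProd ε a (fun _ => 0) r : ℂ)‖ ^ 2 = ∏ l, F l (r l) := fun r => by
    simp only [hF]
    rw [Finset.prod_mul_distrib, ← oscProd_mul, Finset.prod_ite_eq' Finset.univ j
      (fun l => scaledWeight k ε (a l) (r l) ^ 2), if_pos (Finset.mem_univ j), norm_mul, mul_pow,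
      Complex.norm_real, Complex.norm_real, Real.norm_eq_abs, Real.norm_eq_abs, sq_abs, sq_abs]
    ring
  have hFi : ∀ l, Integrable (F l) := fun l => by
    by_cases h : l = j
    · simp only [hF, h, if_true]
      exact integrable_scaledWeight_sq_mul_oscFun_sq k hε _
    · simp only [hF, h, if_false, one_mul]
      exact integrable_oscFun_mul hε _ _ _
  have hmem : MemLp (fun r : Fin N → E3 => (scaledWeight k ε (a j) (r j) : ℂ) *
      (oscProd ε a (fun _ => 0) r : ℂ)) 2 volume := by
    rw [memLp_two_iff_integrable_sq_norm hc.aestronglyMeasurable]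
    simp only [hsq]
    exact Integrable.fintype_prod hFi
  refine ⟨hmem, ?_⟩
  rw [norm_sq_toL2 hmem]
  simp only [hsq]
  rw [integral_fintype_prod_volume_eq_prod (𝕜 := ℝ) F, Finset.prod_eq_single j]
  · simp only [hF, if_true]
    exact integral_scaledWeight_sq_mul_oscFun_sq k hε _
  · intro l _ hl
    simp only [hF, hl, if_false, one_mul]
    rw [integral_oscFun_mul hε, if_pos rfl]
  · intro h
    exact absurd (Finset.mem_univ j) h

/-! ### The interaction on a localized state -/

/-- Applied with `z = (R-r_j)/ε`, `x = (R-y)/ε` and `y` replaced by `(r_j-a_j)/ε`, this splits the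
distance between the two centres into the argument of the potential and two Gaussian deviations. -/
theorem one_add_norm_sub_add_le (x y z : E3) :
    1 + ‖z - x + y‖ ≤ (1 + ‖z‖) * ((1 + ‖x‖) * (1 + ‖y‖)) := by
  have h : ‖z - x + y‖ ≤ ‖z‖ + ‖x‖ + ‖y‖ :=
    (norm_add_le _ _).trans (by linarith [norm_sub_le z x])
  have hx := norm_nonneg x
  have hy := norm_nonneg y
  have hz := norm_nonneg z
  nlinarith [mul_nonneg hx hy, mul_nonneg hz hx, mul_nonneg hz hy,
    mul_nonneg hz (mul_nonneg hx hy)]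

/-- The interaction with the decaying potential `W` instead of `V`. -/
noncomputable def interactionC {N : ℕ} (W : E3 → ℂ) (ε : ℝ) (j : Fin N) (q : Config N) : ℂ :=
  W (ε⁻¹ • (q.1 - q.2 j))

theorem continuous_interactionC {N : ℕ} {W : E3 → ℂ} (hW : Continuous W) (ε : ℝ) (j : Fin N) :
    Continuous (interactionC W ε j) := by
  unfold interactionC
  fun_prop

theorem norm_interactionC_mul_le {N : ℕ} {W : E3 → ℂ} {k : ℕ} {K : ℝ}
    (hK : ∀ x, (1 + ‖x‖) ^ k * ‖W x‖ ≤ K) (ε : ℝ) (a : Fin N → E3) (j : Fin N) (y : E3)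
    (q : Config N) :
    (1 + ‖ε⁻¹ • (y - a j)‖) ^ k * ‖interactionC W ε j q‖ ≤
      K * (scaledWeight k ε y q.1 * scaledWeight k ε (a j) (q.2 j)) := by
  have h1 : ε⁻¹ • (y - a j) =
      ε⁻¹ • (q.1 - q.2 j) - ε⁻¹ • (q.1 - y) + ε⁻¹ • (q.2 j - a j) := by
    rw [← smul_sub, ← smul_add]
    congr 1
    abel
  have h2 := pow_le_pow_left₀ (by positivity) (one_add_norm_sub_add_le (ε⁻¹ • (q.1 - y))
    (ε⁻¹ • (q.2 j - a j)) (ε⁻¹ • (q.1 - q.2 j))) k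
  rw [← h1, mul_pow, mul_pow] at h2
  calc (1 + ‖ε⁻¹ • (y - a j)‖) ^ k * ‖interactionC W ε j q‖
      ≤ (1 + ‖ε⁻¹ • (q.1 - q.2 j)‖) ^ k * ((1 + ‖ε⁻¹ • (q.1 - y)‖) ^ k *
          (1 + ‖ε⁻¹ • (q.2 j - a j)‖) ^ k) * ‖interactionC W ε j q‖ :=
        mul_le_mul_of_nonneg_right h2 (norm_nonneg _)
    _ = ((1 + ‖ε⁻¹ • (q.1 - q.2 j)‖) ^ k * ‖W (ε⁻¹ • (q.1 - q.2 j))‖) *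
          ((1 + ‖ε⁻¹ • (q.1 - y)‖) ^ k * (1 + ‖ε⁻¹ • (q.2 j - a j)‖) ^ k) := by
        rw [interactionC]
        ring
    _ ≤ _ := mul_le_mul_of_nonneg_right (hK _) (by positivity)

/-- The pointwise bound dominates the product by a tensor product in which each weight multiplies
its own Gaussian, so the norm factorizes into two Gaussian moments. -/
theorem norm_mulL2_interactionC_le {N : ℕ} {W : E3 → ℂ} (hW : Continuous W) {k : ℕ} {K : ℝ}
    (hK : ∀ x, (1 + ‖x‖) ^ k * ‖W x‖ ≤ K) {ε b : ℝ} (hε : 0 < ε) (hb : 0 < b)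
    (a : Fin N → E3) (j : Fin N) (y : E3) {Φ : E3 → ℂ} (hΦ : Continuous Φ)
    (hΦ2 : MemLp Φ 2 volume)
    (h : ∀ r, ‖Φ r‖ ^ 2 ≤ Real.exp (-b * ‖ε⁻¹ • (r - y)‖ ^ 2)) :
    (1 + ‖ε⁻¹ • (y - a j)‖) ^ k *
      ‖mulL2 (interactionC W ε j) (oscEmbed ε a (fun _ => 0) (toL2 Φ))‖ ≤
      K * (√(ε ^ 3 * gaussMoment k b) * √(groundMoment k)) := by
  have hK0 : 0 ≤ K := le_trans (by positivity) (hK 0)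
  have hWb : ∀ q : Config N, ‖interactionC W ε j q‖ ≤ K := fun q => by
    refine le_trans (le_mul_of_one_le_left (norm_nonneg _) ?_) (hK (ε⁻¹ • (q.1 - q.2 j)))
    exact one_le_pow₀ (by linarith [norm_nonneg (ε⁻¹ • (q.1 - q.2 j))])
  obtain ⟨hf, hfn⟩ := memLp_scaledWeight_mul k hε hb y hΦ h
  obtain ⟨hg, hgn⟩ := memLp_scaledWeight_mul_oscProd k hε a j
  set f := toL2 fun r => (scaledWeight k ε y r : ℂ) * Φ r with hfdef
  set g := toL2 fun r : Fin N → E3 => (scaledWeight k ε (a j) (r j) : ℂ) *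
      (oscProd ε a (fun _ => 0) r : ℂ) with hgdef
  set T := mulL2 (interactionC W ε j) (oscEmbed ε a (fun _ => 0) (toL2 Φ)) with hT
  have hD : 0 < (1 + ‖ε⁻¹ • (y - a j)‖) ^ k := by positivity
  have h1 : ‖T‖ ≤ K / (1 + ‖ε⁻¹ • (y - a j)‖) ^ k * ‖tensorRight g f‖ := by
    refine Lp.norm_le_mul_norm_of_ae_le_mul ?_
    rw [oscEmbed, tensorRight_toL2 hΦ2 (memLp_oscProd hε a _)] at hT
    have hE : MemLp (fun p : E3 × (Fin N → E3) =>
        Φ p.1 * (oscProd ε a (fun _ => 0) p.2 : ℂ)) 2 volume := by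
      rw [Measure.volume_eq_prod]
      refine (memLp_two_iff_integrable_sq_norm (Continuous.aestronglyMeasurable ?_)).2 ?_
      · exact (hΦ.comp continuous_fst).mul (Complex.continuous_ofReal.comp
          ((continuous_oscProd ε a _).comp continuous_snd))
      · have := ((memLp_two_iff_integrable_sq_norm hΦ2.1).1 hΦ2).mul_prod
          ((memLp_two_iff_integrable_sq_norm (memLp_oscProd hε a (fun _ => 0)).1).1
            (memLp_oscProd hε a (fun _ => 0)))
        simpa only [norm_mul, mul_pow] using this
    rw [hfdef, hgdef, tensorRight_toL2 hf hg]
    have hfg : MemLp (fun p : E3 × (Fin N → E3) => (scaledWeight k ε y p.1 : ℂ) * Φ p.1 *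
        ((scaledWeight k ε (a j) (p.2 j) : ℂ) * (oscProd ε a (fun _ => 0) p.2 : ℂ))) 2 volume := by
      refine (memLp_congr_ae ?_).1 (memLp_tensor f g).1
      rw [Measure.volume_eq_prod]
      have e1 := Measure.quasiMeasurePreserving_fst
        (μ := (volume : Measure E3)) (ν := (volume : Measure (Fin N → E3))) |>.ae (coeFn_toL2 hf)
      have e2 := Measure.quasiMeasurePreserving_snd
        (μ := (volume : Measure E3)) (ν := (volume : Measure (Fin N → E3))) |>.ae (coeFn_toL2 hg)
      filter_upwards [e1, e2] with p h3 h4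
      rw [h3, h4]
    rw [hT]
    filter_upwards [coeFn_mulL2 (continuous_interactionC hW ε j).aestronglyMeasurable hWb
      (toL2 fun p : E3 × (Fin N → E3) => Φ p.1 * (oscProd ε a (fun _ => 0) p.2 : ℂ)),
      coeFn_toL2 hE, coeFn_toL2 hfg] with q e1 e2 e3
    rw [e1, e2, e3]
    have h5 := norm_interactionC_mul_le hK ε a j y q
    rw [norm_mul, norm_mul, norm_mul, norm_mul, norm_mul, Complex.norm_real, Complex.norm_real,
      Complex.norm_real, Real.norm_of_nonneg (scaledWeight_nonneg k ε y q.1),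
      Real.norm_of_nonneg (scaledWeight_nonneg k ε (a j) (q.2 j)), div_mul_eq_mul_div,
      le_div_iff₀ hD]
    calc ‖interactionC W ε j q‖ * (‖Φ q.1‖ * ‖oscProd ε a (fun _ => 0) q.2‖) *
          (1 + ‖ε⁻¹ • (y - a j)‖) ^ k
        = ((1 + ‖ε⁻¹ • (y - a j)‖) ^ k * ‖interactionC W ε j q‖) *
          (‖Φ q.1‖ * ‖oscProd ε a (fun _ => 0) q.2‖) := by ring
      _ ≤ (K * (scaledWeight k ε y q.1 * scaledWeight k ε (a j) (q.2 j))) *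
          (‖Φ q.1‖ * ‖oscProd ε a (fun _ => 0) q.2‖) :=
          mul_le_mul_of_nonneg_right h5 (by positivity)
      _ = _ := by ring
  rw [norm_tensorRight] at h1
  have h6 : ‖f‖ ≤ √(ε ^ 3 * gaussMoment k b) := Real.le_sqrt_of_sq_le hfn
  have h7 : ‖g‖ = √(groundMoment k) := by rw [← hgn, Real.sqrt_sq (norm_nonneg _)]
  calc (1 + ‖ε⁻¹ • (y - a j)‖) ^ k * ‖T‖
      ≤ (1 + ‖ε⁻¹ • (y - a j)‖) ^ k *
        (K / (1 + ‖ε⁻¹ • (y - a j)‖) ^ k * (‖f‖ * ‖g‖)) := mul_le_mul_of_nonneg_left h1 hD.le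
    _ = K * (‖f‖ * ‖g‖) := by field_simp
    _ ≤ _ := by
      rw [h7]
      gcongr

/-! ### Replacing the potential by its continuous representative -/

/-- For fixed `r`, the map `R ↦ ε⁻¹(R - r_j)` pulls null sets back to null sets; Fubini in `r`
concludes. -/
theorem ae_interaction_eq {N : ℕ} {V : E3 → ℝ} {W : E3 → ℂ} (h : ∀ᵐ x, (V x : ℂ) = W x)
    {ε : ℝ} (hε : 0 < ε) (j : Fin N) :
    ∀ᵐ q : Config N, (interaction V ε j q : ℂ) = interactionC W ε j q := by
  have hqmp : Measure.QuasiMeasurePreserving (fun q : Config N => ε⁻¹ • (q.1 - q.2 j))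
      volume volume := by
    have hmeas : Measurable fun q : Config N => ε⁻¹ • (q.1 - q.2 j) :=
      Continuous.measurable (by fun_prop)
    refine ⟨hmeas, Measure.AbsolutelyContinuous.mk fun Z hZ h0 => ?_⟩
    rw [Measure.map_apply hmeas hZ, Measure.volume_eq_prod, Measure.prod_apply_symm (hmeas hZ)]
    refine (lintegral_congr fun r => ?_).trans lintegral_zero
    have : (fun R : E3 => (R, r)) ⁻¹' ((fun q : Config N => ε⁻¹ • (q.1 - q.2 j)) ⁻¹' Z) =
        (fun R => R + -r j) ⁻¹' ((fun x => ε⁻¹ • x) ⁻¹' Z) := by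
      ext R
      simp only [Set.mem_preimage, sub_eq_add_neg]
    rw [this, measure_preimage_add_right, Measure.addHaar_preimage_smul _ (inv_ne_zero hε.ne'), h0,
      mul_zero]
  exact hqmp.ae h

end SphericalWave

namespace SphericalWave

/-! ### The evolved state away from the cap -/

/-- The superposition of the wave packets travelling in the directions in `A`. -/
noncomputable def packetSum (v₀ ε : ℝ) (A : Set S2) : L2 E3 :=
  ∫ u in A, toL2 (dirPacket v₀ ε u) ∂sphereMeasure

theorem waveState_eq {N : ℕ} (v₀ : ℝ) {ε : ℝ} (hε : 0 < ε) (a : Fin N → E3) (A : Set S2) :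
    waveState v₀ ε a A =
      oscEmbed ε a (fun _ => 0) (((normConst v₀ ε * waveAmp ε : ℝ) : ℂ) • packetSum v₀ ε A) := by
  have h1 : ((normConst v₀ ε * waveAmp ε : ℝ) : ℂ) • packetSum v₀ ε A =
      toL2 fun R => (normConst v₀ ε : ℂ) * rawWave v₀ ε A R := by
    rw [toL2_const_mul (memLp_rawWave v₀ hε A), toL2_rawWave v₀ hε, smul_smul, packetSum]
    push_cast
    rfl
  rw [h1, oscEmbed, tensorRight_toL2 ((memLp_rawWave v₀ hε A).const_mul _)
    (memLp_oscProd hε a _)]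
  rfl

theorem initialState_sub_eq {N : ℕ} (v₀ : ℝ) {ε : ℝ} (hε : 0 < ε) (a : Fin N → E3) (j : Fin N) :
    initialState v₀ ε a - initialStatePortion v₀ ε a j =
      oscEmbed ε a (fun _ => 0)
        (((normConst v₀ ε * waveAmp ε : ℝ) : ℂ) • packetSum v₀ ε (cap a j)ᶜ) := by
  rw [initialState, initialStatePortion, waveState_eq v₀ hε, waveState_eq v₀ hε, ← map_sub,
    ← smul_sub]
  congr 2
  rw [packetSum, packetSum, packetSum, Measure.restrict_univ,
    setIntegral_compl (measurableSet_cap a j) (integrable_toL2_dirPacket v₀ hε _)]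

/-! ### Measurability and size of the Born integrand -/

theorem bornIntegrand_congr {N : ℕ} {V : E3 → ℝ} {W : E3 → ℂ} (h : ∀ᵐ x, (V x : ℂ) = W x)
    {ε : ℝ} (hε : 0 < ε) (a : Fin N → E3) (j : Fin N) (Ψ : L2 (Config N)) (s : ℝ) :
    bornIntegrand V ε a j Ψ s =
      freeProp ε a (-s) (mulL2 (interactionC W ε j) (freeProp ε a s Ψ)) := by
  rw [bornIntegrand]
  congr 1
  refine toL2_congr ?_
  filter_upwards [ae_interaction_eq h hε j] with q hq
  rw [hq]

theorem stronglyMeasurable_bornIntegrand_oscEmbed {N : ℕ} {V : E3 → ℝ} {W : E3 → ℂ}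
    (h : ∀ᵐ x, (V x : ℂ) = W x) (hW : Continuous W) {K : ℝ} (hK : ∀ x, ‖W x‖ ≤ K)
    {ε : ℝ} (hε : 0 < ε) (a : Fin N → E3) (j : Fin N) (n : Fin N → Fin 3 → ℕ) (ψ : L2 E3) :
    StronglyMeasurable (bornIntegrand V ε a j (oscEmbed ε a n ψ)) := by
  have hm := (continuous_interactionC hW ε j).aestronglyMeasurable (μ := volume)
  have hWI : ∀ q : Config N, ‖interactionC W ε j q‖ ≤ K := fun q => hK _
  have h1 : Continuous fun s : ℝ =>
      Complex.exp (-Complex.I * ((s / ε ^ 2 * ∑ k, oscEnergy ε (n k) : ℝ) : ℂ)) := by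
    fun_prop
  have h2 : Continuous fun s => oscEmbed ε a n (freeEvol ε s ψ) :=
    continuous_clm_comp _ (continuous_freeEvol_left ε ψ)
  have h3 := continuous_clm_comp (mulCLM (interactionC W ε j) K hm hWI)
    (Continuous.smul h1 h2)
  have h4 := stronglyMeasurable_freeProp_comp hε a continuous_neg h3
  have h5 : ∀ s, bornIntegrand V ε a j (oscEmbed ε a n ψ) s = freeProp ε a (-s)
      (mulCLM (interactionC W ε j) K hm hWI
        (Complex.exp (-Complex.I * ((s / ε ^ 2 * ∑ k, oscEnergy ε (n k) : ℝ) : ℂ)) •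
          oscEmbed ε a n (freeEvol ε s ψ))) := fun s => by
    rw [bornIntegrand_congr h hε, freeProp_oscEmbed hε, mulCLM_apply hm hWI]
  rw [funext h5]
  exact h4

theorem norm_bornIntegrand_oscEmbed_le {N : ℕ} {V : E3 → ℝ} {W : E3 → ℂ}
    (h : ∀ᵐ x, (V x : ℂ) = W x) (hW : Continuous W) {K : ℝ} (hK : ∀ x, ‖W x‖ ≤ K)
    {ε : ℝ} (hε : 0 < ε) (a : Fin N → E3) (j : Fin N) (n : Fin N → Fin 3 → ℕ) (ψ : L2 E3)
    (s : ℝ) : ‖bornIntegrand V ε a j (oscEmbed ε a n ψ) s‖ ≤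
      ‖mulL2 (interactionC W ε j) (oscEmbed ε a n (freeEvol ε s ψ))‖ := by
  have hm := (continuous_interactionC hW ε j).aestronglyMeasurable (μ := volume)
  rw [bornIntegrand_congr h hε, freeProp_oscEmbed hε]
  refine (norm_freeProp_le hε a _ _).trans (le_of_eq ?_)
  rw [← mulCLM_apply hm (C := K) fun q => hK _, ← mulCLM_apply hm (C := K) fun q => hK _, map_smul,
    norm_smul, norm_exp_neg_I_mul, one_mul]

/-- At time `s` the width is `ε √(1+s²)`, at most its value at time `t`; one Gaussian rate thus
serves the whole interval, and this is how the moment constant comes to depend on `t`. -/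
theorem norm_sq_wavePacket_evolvedWidth_le {ε s t : ℝ} (hε : 0 < ε) (hs : 0 ≤ s) (hst : s ≤ t)
    (x y r : E3) : ‖wavePacket (evolvedWidth ε s) y x r‖ ^ 2 ≤
      Real.exp (-(1 + t ^ 2)⁻¹ * ‖ε⁻¹ • (r - y)‖ ^ 2) := by
  rw [norm_wavePacket, ← Real.exp_nat_mul, Real.exp_le_exp, evolvedWidth_re, norm_smul, norm_inv,
    Real.norm_of_nonneg hε.le]
  have h1 : (1 + t ^ 2)⁻¹ ≤ (1 + s ^ 2)⁻¹ := by gcongr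
  have h2 : ((2 : ℕ) : ℝ) * (-(2 * ε ^ 2 * (1 + s ^ 2))⁻¹ * ‖r - y‖ ^ 2) =
      -((1 + s ^ 2)⁻¹ * (ε⁻¹ * ‖r - y‖) ^ 2) := by
    push_cast
    field_simp
  rw [h2, neg_mul, neg_le_neg_iff]
  exact mul_le_mul_of_nonneg_right h1 (sq_nonneg _)

theorem norm_mulL2_freeEvol_dirPacket_le {N : ℕ} {W : E3 → ℂ} (hW : Continuous W) {k : ℕ} {K : ℝ}
    (hK : ∀ x, (1 + ‖x‖) ^ k * ‖W x‖ ≤ K) {v₀ ε s t : ℝ} (hε : 0 < ε) (hs : 0 ≤ s) (hst : s ≤ t)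
    (a : Fin N → E3) (j : Fin N) (u : S2) :
    (1 + ε⁻¹ * ‖(s * v₀) • (u : E3) - a j‖) ^ k *
      ‖mulL2 (interactionC W ε j)
        (oscEmbed ε a (fun _ => 0) (freeEvol ε s (toL2 (dirPacket v₀ ε u))))‖ ≤
      K * (√(ε ^ 3 * gaussMoment k (1 + t ^ 2)⁻¹) * √(groundMoment k)) := by
  have hWK : ∀ x, ‖W x‖ ≤ K := fun x => by
    refine le_trans (le_mul_of_one_le_left (norm_nonneg _) ?_) (hK x)
    exact one_le_pow₀ (by linarith [norm_nonneg x])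
  have hm := (continuous_interactionC (N := N) hW ε j).aestronglyMeasurable (μ := volume)
  obtain ⟨κ, hκ, hev⟩ := freeEvol_wavePacket hε s (waveFreq v₀ ε u)
  have hy : (2 * Real.pi * ε ^ 2 * s) • waveFreq v₀ ε u = (s * v₀) • (u : E3) := by
    rw [waveFreq, smul_smul]
    congr 1
    field_simp
  rw [hy] at hev
  have h1 := norm_mulL2_interactionC_le hW hK hε (b := (1 + t ^ 2)⁻¹) (by positivity) a j
    ((s * v₀) • (u : E3)) (continuous_wavePacket (evolvedWidth ε s) _ (waveFreq v₀ ε u))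
    (memLp_wavePacket (evolvedWidth_re_pos hε s) _ _)
    (fun r => norm_sq_wavePacket_evolvedWidth_le hε hs hst _ _ r)
  rw [norm_smul, norm_inv, Real.norm_of_nonneg hε.le] at h1
  refine le_trans (mul_le_mul_of_nonneg_left ?_ (by positivity)) h1
  rw [dirPacket, hev, ← mulCLM_apply hm (C := K) fun q => hWK _,
    ← mulCLM_apply hm (C := K) fun q => hWK _, map_smul, map_smul, norm_smul]
  exact mul_le_of_le_one_left (norm_nonneg _) hκ

/-- Evolution, embedding and interaction form one bounded operator, which commutes with the integral
over directions; the triangle inequality then ignores any cancellation between packets. -/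
theorem norm_mulL2_freeEvol_packetSum_le {N : ℕ} {W : E3 → ℂ} (hW : Continuous W) {K : ℝ}
    (hK : ∀ x, ‖W x‖ ≤ K) {v₀ ε s B : ℝ} (hε : 0 < ε) (a : Fin N → E3) (j : Fin N)
    (n : Fin N → Fin 3 → ℕ) {A : Set S2} (hB0 : 0 ≤ B)
    (hB : ∀ u ∈ A, ‖mulL2 (interactionC W ε j)
      (oscEmbed ε a n (freeEvol ε s (toL2 (dirPacket v₀ ε u))))‖ ≤ B) :
    ‖mulL2 (interactionC W ε j) (oscEmbed ε a n (freeEvol ε s (packetSum v₀ ε A)))‖ ≤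
      B * sphereMeasure.real Set.univ := by
  have hm := (continuous_interactionC (N := N) hW ε j).aestronglyMeasurable (μ := volume)
  set L : L2 E3 →L[ℂ] L2 (Config N) :=
    (mulCLM (interactionC W ε j) K hm fun q => hK _).comp ((oscEmbed ε a n).comp (freeCLM ε s))
    with hL
  have hLa : ∀ ψ, mulL2 (interactionC W ε j) (oscEmbed ε a n (freeEvol ε s ψ)) = L ψ :=
    fun ψ => rfl
  simp only [hLa] at hB ⊢
  rw [packetSum, ← L.integral_comp_comm (integrable_toL2_dirPacket v₀ hε _)]
  refine (norm_setIntegral_le_of_norm_le_const_ae' (C := B) (measure_lt_top _ _)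
    (Filter.Eventually.of_forall hB)).trans ?_
  exact mul_le_mul_of_nonneg_left (measureReal_mono (Set.subset_univ _)) hB0

/-! ### Uniform lower bounds for the distances -/

theorem exists_pos_le_norm {N : ℕ} {a : Fin N → E3} (ha : ∀ j, a j ≠ 0) :
    ∃ β : ℝ, 0 < β ∧ ∀ j, β ≤ ‖a j‖ := by
  rcases isEmpty_or_nonempty (Fin N) with h | h
  · exact ⟨1, one_pos, fun j => h.elim j⟩
  · obtain ⟨i, hi⟩ := Finite.exists_min fun j => ‖a j‖
    exact ⟨‖a i‖, norm_pos_iff.2 (ha i), hi⟩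

/-- The right side is `(ε+d)^k`. One factor `ε+d`, available since `k ≥ 1`, absorbs the `1+ε` of the
normalization, so the final bound holds for all `ε` and not just small ones. -/
theorem one_add_mul_pow_le {k : ℕ} (hk : 1 ≤ k) {ε β d : ℝ} (hε : 0 < ε) (hβ : 0 < β)
    (hd : β ≤ d) :
    (1 + ε) * (β ^ (k - 1) * min 1 β) ≤ ε ^ k * (1 + ε⁻¹ * d) ^ k := by
  have h1 : ε ^ k * (1 + ε⁻¹ * d) ^ k = (ε + d) ^ k := by
    rw [← mul_pow]
    congr 1
    field_simp
  have h2 : (ε + d) ^ k = (ε + d) ^ (k - 1) * (ε + d) := by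
    rw [← pow_succ, Nat.sub_add_cancel hk]
  have h3 : β ^ (k - 1) ≤ (ε + d) ^ (k - 1) := pow_le_pow_left₀ hβ.le (by linarith) _
  have h4 : (1 + ε) * min 1 β ≤ ε + d := by
    have h5 : ε * min 1 β ≤ ε := mul_le_of_le_one_right hε.le (min_le_left _ _)
    linarith [min_le_right 1 β]
  rw [h1, h2]
  calc (1 + ε) * (β ^ (k - 1) * min 1 β) = β ^ (k - 1) * ((1 + ε) * min 1 β) := by ring
    _ ≤ (ε + d) ^ (k - 1) * (ε + d) :=
      mul_le_mul h3 h4 (by positivity) (pow_nonneg (by linarith) _)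

end SphericalWave

/-- The first-order term applied to the part of the spherical wave away from `â_j` is
`O(ε^{k-1})`. The condition `a j ≠ 0` (so that the directions `â_j` make sense) is implied by
`(B)` unless there is only one oscillator. -/
theorem proposition3p2 (k : ℕ) (hk : 1 ≤ k) (v₀ : ℝ) (hv₀ : 0 < v₀) (N : ℕ)
    (a : Fin N → E3) (hB : PositionsB a) (ha : ∀ j, a j ≠ 0) (t : ℝ) (ht : 0 < t) :
    ∃ C : ℝ, 0 < C ∧
      ∀ (V : E3 → ℝ) (Vhat : E3 → ℂ), IsFourierTransform V Vhat → MemW k k Vhat →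
      ∀ (j : Fin N) (ε : ℝ), 0 < ε →
        IntervalIntegrable
          (bornIntegrand V ε a j (initialState v₀ ε a - initialStatePortion v₀ ε a j))
          volume 0 t ∧
        ‖bornTerm V ε a j t (initialState v₀ ε a - initialStatePortion v₀ ε a j)‖ ≤
          C * normW k k Vhat * ε ^ (k - 1) := by
  obtain ⟨CV, hCV, hV⟩ := exists_continuous_decaying_ae_eq k
  obtain ⟨CN, hCN, hN⟩ := exists_normConst_mul_waveAmp_le hv₀
  obtain ⟨α, hα, hαa⟩ := exists_pos_le_norm ha
  -- A lower bound, uniform in `j`, for the distance from `a_j` to every ray outside its cap.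
  set β := α * Real.sin (theta0 a) with hβ
  have hβpos : 0 < β := mul_pos hα (sin_theta0_pos hB)
  set γ := β ^ (k - 1) * min 1 β with hγ
  have hγpos : 0 < γ := by positivity
  set M := √(gaussMoment k (1 + t ^ 2)⁻¹) * √(groundMoment k) with hM
  have hM0 : 0 ≤ M := by positivity
  set σ := sphereMeasure.real Set.univ with hσ
  have hσ0 : 0 < σ := sphereMeasure_real_univ_pos
  set C₀ := CN * CV * M * σ / γ with hC₀
  have hC₀0 : 0 ≤ C₀ := by positivity
  -- `C₀` is only known to be nonnegative; adding `1` makes the constant positive.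
  refine ⟨C₀ * t + 1, by positivity, fun V Vhat hVF hVW j ε hε => ?_⟩
  obtain ⟨W, hWc, hVW', hWK⟩ := hV V Vhat hVF hVW
  set K := CV * normW k k Vhat with hK
  have hK0 : 0 ≤ K := le_trans (by positivity) (hWK 0)
  have hW0 : 0 ≤ normW k k Vhat := by
    rw [hK] at hK0
    exact nonneg_of_mul_nonneg_right hK0 hCV
  have hWb : ∀ x, ‖W x‖ ≤ K := fun x => by
    refine le_trans (le_mul_of_one_le_left (norm_nonneg _) ?_) (hWK x)
    exact one_le_pow₀ (by linarith [norm_nonneg x])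
  -- The contribution of a single packet: `ε^{3/2}` from its weighted norm and `ε^k / ((1+ε)γ)` from
  -- its distance to `a_j`.
  set B := K * (√(ε ^ 3) * M) / ((1 + ε) * γ / ε ^ k) with hBdef
  have hB0 : 0 ≤ B := by positivity
  have hpacket : ∀ s, 0 ≤ s → s ≤ t → ∀ u ∈ (cap a j)ᶜ,
      ‖mulL2 (interactionC W ε j)
        (oscEmbed ε a (fun _ => 0) (freeEvol ε s (toL2 (dirPacket v₀ ε u))))‖ ≤ B := by
    intro s hs hst u hu
    have h1 := norm_mulL2_freeEvol_dirPacket_le hWc hWK (v₀ := v₀) hε hs hst a j u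
    have h2 : β ≤ ‖(s * v₀) • (u : E3) - a j‖ := by
      refine le_trans ?_ (le_norm_smul_sub_of_notMem_cap ha hu (mul_nonneg hs hv₀.le))
      rw [abs_of_pos (sin_theta0_pos hB)]
      exact mul_le_mul_of_nonneg_right (hαa j) (sin_theta0_pos hB).le
    have h3 := one_add_mul_pow_le hk hε hβpos h2
    have h4 : (1 + ε) * γ / ε ^ k ≤ (1 + ε⁻¹ * ‖(s * v₀) • (u : E3) - a j‖) ^ k := by
      rw [div_le_iff₀ (by positivity), mul_comm _ (ε ^ k)]
      exact h3
    rw [Real.sqrt_mul (by positivity), mul_assoc (√(ε ^ 3)), ← hM] at h1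
    rw [hBdef, le_div_iff₀ (by positivity), mul_comm]
    exact (mul_le_mul_of_nonneg_right h4 (norm_nonneg _)).trans h1
  set c := normConst v₀ ε * waveAmp ε with hc
  have hc0 : 0 ≤ c := by
    rw [hc, normConst_mul_waveAmp v₀ hε]
    positivity
  have hbound : ∀ s ∈ Set.uIoc 0 t,
      ‖bornIntegrand V ε a j (initialState v₀ ε a - initialStatePortion v₀ ε a j) s‖ ≤
        C₀ * normW k k Vhat * ε ^ (k - 1) := by
    intro s hs
    rw [Set.uIoc_of_le ht.le] at hs
    rw [initialState_sub_eq v₀ hε]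
    refine (norm_bornIntegrand_oscEmbed_le hVW' hWc hWb hε a j _ _ s).trans ?_
    have hm := (continuous_interactionC (N := N) hWc ε j).aestronglyMeasurable (μ := volume)
    have h1 := norm_mulL2_freeEvol_packetSum_le hWc hWb (v₀ := v₀) hε a j (fun _ => 0)
      hB0 (hpacket s hs.1.le hs.2)
    rw [← mulCLM_apply hm (C := K) fun q => hWb _] at h1
    rw [← mulCLM_apply hm (C := K) fun q => hWb _, ← freeCLM_apply, map_smul, map_smul, map_smul,
      norm_smul, Complex.norm_real, Real.norm_of_nonneg hc0]
    refine (mul_le_mul (hN ε hε) h1 (norm_nonneg _) (by positivity)).trans (le_of_eq ?_)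
    -- Power count: amplitude times packet norm costs `ε⁻¹`, the decay of the potential gains `ε^k`,
    -- and the two factors `1+ε` cancel.
    have h2 : ε ^ (-(5 / 2) : ℝ) * √(ε ^ 3) = ε⁻¹ := by
      rw [Real.sqrt_eq_rpow, ← Real.rpow_natCast, ← Real.rpow_mul hε.le, ← Real.rpow_add hε,
        ← Real.rpow_neg_one]
      norm_num
    have h3 : ε ^ k = ε ^ (k - 1) * ε := by rw [← pow_succ, Nat.sub_add_cancel hk]
    rw [hBdef, hC₀, hK, h3]
    calc CN * ((1 + ε) * ε ^ (-(5 / 2) : ℝ)) *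
          (CV * normW k k Vhat * (√(ε ^ 3) * M) / ((1 + ε) * γ / (ε ^ (k - 1) * ε)) * σ)
        = CN * ((1 + ε) * (ε ^ (-(5 / 2) : ℝ) * √(ε ^ 3))) *
          (CV * normW k k Vhat * M / ((1 + ε) * γ / (ε ^ (k - 1) * ε)) * σ) := by ring
      _ = _ := by
        rw [h2]
        field_simp
  have hmeas : StronglyMeasurable
      (bornIntegrand V ε a j (initialState v₀ ε a - initialStatePortion v₀ ε a j)) := by
    rw [initialState_sub_eq v₀ hε]
    exact stronglyMeasurable_bornIntegrand_oscEmbed hVW' hWc hWb hε a j _ _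
  constructor
  · rw [intervalIntegrable_iff]
    refine Measure.integrableOn_of_bounded (M := C₀ * normW k k Vhat * ε ^ (k - 1)) ?_
      hmeas.aestronglyMeasurable ?_
    · rw [Set.uIoc_of_le ht.le]
      exact measure_Ioc_lt_top.ne
    · exact (ae_restrict_iff' measurableSet_uIoc).2 (Filter.Eventually.of_forall hbound)
  · rw [bornTerm, norm_smul, norm_neg, Complex.norm_I, one_mul]
    refine (intervalIntegral.norm_integral_le_of_norm_le_const hbound).trans ?_
    rw [sub_zero, abs_of_pos ht]
    have h1 : 0 ≤ normW k k Vhat * ε ^ (k - 1) := by positivity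
    nlinarith
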